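/- Let $G=(V_G,E_G)$ and $H=(V_H,E_H)$ be finite directed multigraphs, and let $X^e_G$, $X^e_H$ be their edge shifts (the sets of bi-infinite walks, written as sequences of edges). For $k\ge 1$, a map $\Phi$ from the blocks of length $k$ that occur in $X^e_G$ to $E_H$, and integers $\mu,a$ with $\mu+a+1=k$, let $\Phi_\infty(x)_i=\Phi(x_{i-\mu}\cdots x_{i+a})$ be the $k$-block code with memory $\mu$ and anticipation $a$. It is a conjugacy from $X^e_G$ to $X^e_H$ if it maps $X^e_G$ into $X^e_H$ and has a two-sided inverse $X^e_H\to X^e_G$ that is also a sliding block code. Assume that $H$ is essential (every vertex has an incoming and an outgoing edge) or that $|E_H|\le|E_G|^k$. Then, given $k$, $G$, $H$ (as edge lists) and $\Phi$ (as a table indexed by the words of length $k$ over $E_G$, with arbitrary entries at words that do not occur in $X^e_G$), it can be decided in $O(|E_G|^{4k})$ time whether $\Phi_\infty$ is a conjugacy from $X^e_G$ to $X^e_H$. More precisely, there are a single program for a random access machine (unit cost; addition, truncated subtraction, indirect addressing and zero tests on natural numbers) and a constant $C$ such that for all such inputs, with all $k\ge1$, the program halts with the correct answer after at most $C(|E_G|^{4k}+1)$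 steps. -/

import Mathlib

/-! ### Directed multigraphs and edge shifts -/

/-- A directed multigraph with vertex set `V` and edge set `E`: parallel edges and loops are
allowed, and the edges carry distinct names (the elements of `E`). -/
structure DirMultigraph (V E : Type*) where
  /-- initial vertex of an edge -/
  src : E → V
  /-- terminal vertex of an edge -/
  tgt : E → V

namespace DirMultigraph

variable {V E : Type*}

/-- No vertex is stranded: every vertex has an outgoing and an incoming edge. -/
def IsEssential (G : DirMultigraph V E) : Prop :=
  ∀ v : V, (∃ e, G.src e = v) ∧ (∃ e, G.tgt e = v)

/-- The edge shift: all bi-infinite walks on the graph, as sequences of edges. -/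
def edgeShift (G : DirMultigraph V E) : Set (ℤ → E) :=
  {x | ∀ i : ℤ, G.tgt (x i) = G.src (x (i + 1))}

end DirMultigraph

/-! ### Sliding block codes and conjugacies -/

/-- The blocks of length `k` that occur in points of `X`. -/
def shiftBlocks {A : Type*} (X : Set (ℤ → A)) (k : ℕ) : Set (Fin k → A) :=
  {w | ∃ x ∈ X, ∃ i : ℤ, ∀ j : Fin k, w j = x (i + (j : ℤ))}

/-- The sliding block code of the block map `Φ` on `k`-blocks with memory `mem` (an integer) and
anticipation `k - 1 - mem`: the symbol at `i` of the image of `x` is `Φ` of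
`x_{i - mem} ⋯ x_{i - mem + k - 1}`. -/
def slidingBlockCode {A B : Type*} (X : Set (ℤ → A)) {k : ℕ} (mem : ℤ)
    (Φ : shiftBlocks X k → B) (x : X) : ℤ → B :=
  fun i => Φ ⟨fun j => x.1 (i - mem + (j : ℤ)), x.1, x.2, i - mem, fun _ => rfl⟩

/-- The `k`-block code of `Φ` with memory `mem` maps `X` into `Y`, and as a map from `X` to `Y` it
has a two-sided inverse which is itself a sliding block code (of some window size `l ≥ 1`). -/
def IsBlockConjugacy {A B : Type*} (X : Set (ℤ → A)) (Y : Set (ℤ → B)) {k : ℕ} (mem : ℤ)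
    (Φ : shiftBlocks X k → B) : Prop :=
  ∃ hf : ∀ x : X, slidingBlockCode X mem Φ x ∈ Y,
    ∃ (l : ℕ) (_ : 1 ≤ l) (mem' : ℤ) (Ψ : shiftBlocks Y l → A),
      ∃ hg : ∀ y : Y, slidingBlockCode Y mem' Ψ y ∈ X,
        (∀ x : X, slidingBlockCode Y mem' Ψ ⟨slidingBlockCode X mem Φ x, hf x⟩ = x.1) ∧
        (∀ y : Y, slidingBlockCode X mem Φ ⟨slidingBlockCode Y mem' Ψ y, hg y⟩ = y.1)

/-! ### Random access machines

Structured programs for a random access machine with the uniform cost measure.  The machine has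
registers and a memory, whose cells hold natural numbers.  The arithmetic is addition and truncated
subtraction only, there is no multiplication.  A program names finitely many registers, and reaches
the memory by indirect addressing. -/

/-- Programs of the random access machine. -/
inductive RamProgram : Type
  /-- do nothing -/
  | skip : RamProgram
  /-- `const d c`: register `d` gets the literal `c` -/
  | const (d c : ℕ) : RamProgram
  /-- `add d a b`: register `d` gets the sum of registers `a` and `b` -/
  | add (d a b : ℕ) : RamProgram
  /-- `sub d a b`: register `d` gets the truncated difference of registers `a` and `b` -/
  | sub (d a b : ℕ) : RamProgram
  /-- `load d a`: register `d` gets the content of the memory cell addressed by register `a` -/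
  | load (d a : ℕ) : RamProgram
  /-- `store a b`: the memory cell addressed by register `a` gets the content of register `b` -/
  | store (a b : ℕ) : RamProgram
  /-- first `P`, then `Q` -/
  | seq (P Q : RamProgram) : RamProgram
  /-- `P` if register `a` is nonzero, `Q` otherwise -/
  | ite (a : ℕ) (P Q : RamProgram) : RamProgram
  /-- repeat `P` as long as register `a` is nonzero -/
  | loop (a : ℕ) (P : RamProgram) : RamProgram

/-- A configuration: the contents of the registers and of the memory. -/
structure RamState where
  reg : ℕ → ℕ
  mem : ℕ → ℕ

namespace RamState

/-- Write `v` into register `d`. -/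
def setReg (s : RamState) (d v : ℕ) : RamState := ⟨Function.update s.reg d v, s.mem⟩

/-- Write `v` into the memory cell `p`. -/
def setMem (s : RamState) (p v : ℕ) : RamState := ⟨s.reg, Function.update s.mem p v⟩

/-- Start on an input: the memory holds the input from cell `0` on, register `0` holds the length of
the input, everything else is `0`. -/
def init (input : List ℕ) : RamState :=
  ⟨Function.update (fun _ => 0) 0 input.length, fun p => input.getD p 0⟩

end RamState

namespace RamProgram

/-- `Exec P s s' t`: started in `s`, the program `P` halts in `s'` after exactly `t` steps.  Each
elementary instruction and each evaluation of a test is one step. -/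
inductive Exec : RamProgram → RamState → RamState → ℕ → Prop
  | skip (s) : Exec skip s s 1
  | const (s d c) : Exec (const d c) s (s.setReg d c) 1
  | add (s d a b) : Exec (add d a b) s (s.setReg d (s.reg a + s.reg b)) 1
  | sub (s d a b) : Exec (sub d a b) s (s.setReg d (s.reg a - s.reg b)) 1
  | load (s d a) : Exec (load d a) s (s.setReg d (s.mem (s.reg a))) 1
  | store (s a b) : Exec (store a b) s (s.setMem (s.reg a) (s.reg b)) 1
  | seq {P Q s s₁ s₂ t₁ t₂} :
      Exec P s s₁ t₁ → Exec Q s₁ s₂ t₂ → Exec (seq P Q) s s₂ (t₁ + t₂)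
  | ite_true {a P Q s s' t} :
      s.reg a ≠ 0 → Exec P s s' t → Exec (ite a P Q) s s' (1 + t)
  | ite_false {a P Q s s' t} :
      s.reg a = 0 → Exec Q s s' t → Exec (ite a P Q) s s' (1 + t)
  | loop_step {a P s s₁ s₂ t₁ t₂} :
      s.reg a ≠ 0 → Exec P s s₁ t₁ → Exec (loop a P) s₁ s₂ t₂ →
        Exec (loop a P) s s₂ (1 + t₁ + t₂)
  | loop_done {a P s} : s.reg a = 0 → Exec (loop a P) s s 1

/-- On the given input, `P` halts after at most `T` steps, and then register `0` holds `1` if `Q` is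
true and `0` if `Q` is false. -/
def DecidesWithin (P : RamProgram) (input : List ℕ) (Q : Prop) (T : ℕ) : Prop :=
  ∃ (s : RamState) (t : ℕ), P.Exec (RamState.init input) s t ∧ t ≤ T ∧
    (Q → s.reg 0 = 1) ∧ (¬ Q → s.reg 0 = 0)

end RamProgram

/-! ### The input of the verification problem -/

/-- The initial and terminal vertices of all edges, in the order of the edges. -/
def DirMultigraph.encode {p m : ℕ} (G : DirMultigraph (Fin p) (Fin m)) : List ℕ :=
  List.ofFn (fun e => (G.src e : ℕ)) ++ List.ofFn (fun e => (G.tgt e : ℕ))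

/-- The input as a list of numbers: the window size, the numbers of vertices and edges of both
graphs, their edge lists, and the table of the block map, with one entry for each of the `m ^ k`
words `w` of length `k` over the edges of `G`, at position `∑ j, w j * m ^ j`. -/
def encodeInstance {p m q n : ℕ} (k : ℕ) (G : DirMultigraph (Fin p) (Fin m))
    (H : DirMultigraph (Fin q) (Fin n)) (table : (Fin k → Fin m) → ℕ) : List ℕ :=
  [k, p, m, q, n] ++ G.encode ++ H.encode ++
    List.ofFn (fun i : Fin (m ^ k) => table (finFunctionFinEquiv.symm i))

/-! By compactness, a bijective block code between edge shifts has an inverse that is again a block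
code, and the memory only composes the code with a shift. So the question is whether the code with
memory `0` is a bijection (`isBlockConjugacy_iff`). The words of length `k` over the edges of `G`,
overlapping in `k - 1` letters, form a graph with at most `N = m ^ k` edges. Its walks are the codes
of the points of the edge shift of `G`, and the block map labels its edges (`Presents`,
`bijOn_iff_of_presents`). It remains to decide in `O(N ^ 4)` steps whether reading labels maps the
walks of this graph bijectively onto those of `H`.

Injectivity fails exactly if two different edges with the same label have equally labelled infinite
pasts and equally labelled infinite futures (`injOn_walks_iff`). Such pasts and futures are infinite
paths in a graph of pairs with at most `N ^ 2` vertices and `N ^ 2` edges. They are found by `N ^ 2`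
rounds of deleting dead ends, each of cost `O(N ^ 2)`; this gives the exponent `4`. Mapping walks to
walks is a condition on consecutive edges (`mapsTo_walks_iff`).

Surjectivity is decided by counting, once the other two conditions hold. Fix a left ray and a right
ray at every edge that lies on a walk. A path in `H` from the label of `u` to the label of `u'`,
continued by the labels of the left ray at `u` and of the right ray at `u'`, is a point of the edge
shift of `H`. It is in the image if and only if the path is the label word of a path from a left
mate of `u` to a right mate of `u'`, and by injectivity there is at most one such path. Hence mate
paths are at most as many as label paths, and equality for all `u`, `u'` and all lengths means that
the map is onto, provided every edge of `H` on a walk is a label (`surjOn_walks_iff`). As the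
inequality holds for each pair `u`, `u'`, it suffices to compare the sums over all pairs, and these
come from iterating a single vector for each graph. Both sums are linear in powers of `N × N`
matrices, so by Cayley-Hamilton on the direct sum of dimension `2 * N` it suffices to compare the
lengths below `2 * N` (`sum_iterate_stepVec_eq`). The counts are exact natural numbers and are
obtained by additions only.

Two cases are separate. If `m ≤ 1`, both shifts are so small that the answer is read off in constant
time. If `m ≥ 2`, `H` is essential and `n > N`, some edge of `H` is missed. The algorithm is written
in a loop language; compilation preserves meaning and cost (`Cmd.exec_compile`), and the exponent is
the nesting depth of the loops, weighted by the size of their bounds (`Cmd.cost_le`). -/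

open Finset

/-! ### A small loop language, compiled to the random access machine -/

namespace LoopLang

/-- Scalar variables. -/
inductive Var : Type
  | k | m | n | pw | pw' | sq | dbl | i | j | c | d | r | t | res
  deriving DecidableEq

/-- Array names. -/
inductive Arr : Type
  | mulP | mulM | mulP' | src | tgt | fst | lab | ok | past | fut | ess | pred | succ
  | left | right | hfut | hpast | hit | vecG | vecH | tmp | accG | accH
  | badInj | badMap | badHit | badCnt
  deriving DecidableEq

/-- The register that holds a variable. -/
def Var.reg (x : Var) : ℕ := x.ctorIdx + 1

/-- The residue class of cells that holds an array. -/
def Arr.idx (A : Arr) : ℕ := A.ctorIdx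

lemma Var.reg_injective : Function.Injective Var.reg := by
  intro x y h
  cases x <;> cases y <;> first | rfl | (exact absurd h (by decide))

lemma Var.reg_pos (x : Var) : 0 < x.reg := Nat.succ_pos _

/-- Register `0` keeps the input length, the variables follow, and the registers from `16` on are
scratch space of the compiled code. -/
lemma Var.reg_lt (x : Var) : x.reg < 16 := by cases x <;> decide

lemma Arr.idx_injective : Function.Injective Arr.idx := by
  intro x y h
  cases x <;> cases y <;> first | rfl | (exact absurd h (by decide))

/-- All arrays grow without bound side by side, interleaved with stride `32` behind the input. A
power of two is chosen because an index can then be scaled by doublings, without multiplication. -/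
lemma Arr.idx_lt (x : Arr) : x.idx < 32 := by cases x <;> decide

/-- Contents of the variables and of the arrays. -/
structure St where
  v : Var → ℕ
  a : Arr → ℕ → ℕ

/-- Write a variable. -/
def St.setV (s : St) (x : Var) (w : ℕ) : St := ⟨Function.update s.v x w, s.a⟩

/-- Write an array cell. -/
def St.setA (s : St) (A : Arr) (i w : ℕ) : St :=
  ⟨s.v, Function.update s.a A (Function.update (s.a A) i w)⟩

/-- Expressions. -/
inductive Expr : Type
  | lit (c : ℕ) | var (x : Var) | add (e f : Expr) | sub (e f : Expr)
  | arr (A : Arr) (e : Expr) | inp (e : Expr) | ite (e f g : Expr)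

/-- Commands; `loop x b P` runs `P` with `x = 0, 1, …` as many times as the variable `b` says at
the start. -/
inductive Cmd : Type
  | skip | assign (x : Var) (e : Expr) | store (A : Arr) (e f : Expr) | seq (P Q : Cmd)
  | ite (e : Expr) (P Q : Cmd) | loop (x b : Var) (P : Cmd)

namespace Expr

/-- The value of an expression. -/
def eval (I : List ℕ) (s : St) : Expr → ℕ
  | lit c => c
  | var x => s.v x
  | add e f => e.eval I s + f.eval I s
  | sub e f => e.eval I s - f.eval I s
  | arr A e => s.a A (e.eval I s)
  | inp e => I.getD (e.eval I s) 0
  | ite e f g => if e.eval I s = 0 then g.eval I s else f.eval I s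

/-- Bound for the evaluation time. -/
def cost : Expr → ℕ
  | lit _ => 1
  | var _ => 2
  | add e f => e.cost + f.cost + 1
  | sub e f => e.cost + f.cost + 1
  | arr _ e => e.cost + 9
  | inp e => e.cost + 3
  | ite e f g => e.cost + f.cost + g.cost + 1

/-- Whether an expression mentions an array. -/
def reads (A : Arr) : Expr → Bool
  | lit _ => false
  | var _ => false
  | add e f => e.reads A || f.reads A
  | sub e f => e.reads A || f.reads A
  | arr A' e => decide (A' = A) || e.reads A
  | inp e => e.reads A
  | ite e f g => e.reads A || f.reads A || g.reads A

/-- Whether an expression mentions a variable. -/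
def readsV (x : Var) : Expr → Bool
  | lit _ => false
  | var y => decide (y = x)
  | add e f => e.readsV x || f.readsV x
  | sub e f => e.readsV x || f.readsV x
  | arr _ e => e.readsV x
  | inp e => e.readsV x
  | ite e f g => e.readsV x || f.readsV x || g.readsV x

end Expr

/-- Replace register `d`, which holds an index, by the address of that cell of `A`. -/
def address (A : Arr) (d : ℕ) : RamProgram :=
  .seq (.add d d d) <| .seq (.add d d d) <| .seq (.add d d d) <| .seq (.add d d d) <|
  .seq (.add d d d) <| .seq (.add d d 0) <| .seq (.const (d + 1) A.idx) (.add d d (d + 1))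

/-- Evaluate into register `d`, using registers from `d` on. -/
def Expr.compile : Expr → ℕ → RamProgram
  | lit c, d => .const d c
  | var x, d => .seq (.const d 0) (.add d d x.reg)
  | add e f, d => .seq (e.compile d) (.seq (f.compile (d + 1)) (.add d d (d + 1)))
  | sub e f, d => .seq (e.compile d) (.seq (f.compile (d + 1)) (.sub d d (d + 1)))
  | arr A e, d => .seq (e.compile d) (.seq (address A d) (.load d d))
  | inp e, d => .seq (e.compile d) (.seq (.sub (d + 1) 0 d) (.ite (d + 1) (.load d d) (.const d 0)))
  | ite e f g, d => .seq (e.compile d) (.ite d (f.compile d) (g.compile d))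

namespace Cmd

/-- The effect of a command. -/
def run (I : List ℕ) : Cmd → St → St
  | skip, s => s
  | assign x e, s => s.setV x (e.eval I s)
  | store A e f, s => s.setA A (e.eval I s) (f.eval I s)
  | seq P Q, s => Q.run I (P.run I s)
  | ite e P Q, s => if e.eval I s ≠ 0 then P.run I s else Q.run I s
  | loop x b P, s => Nat.rec s (fun i s' => P.run I (s'.setV x i)) (s.v b)

/-- Variables written by a command. -/
def writesV (x : Var) : Cmd → Bool
  | skip => false
  | assign y _ => decide (y = x)
  | store _ _ _ => false
  | seq P Q => P.writesV x || Q.writesV x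
  | ite _ P Q => P.writesV x || Q.writesV x
  | loop y _ P => decide (y = x) || P.writesV x

/-- Arrays written by a command. -/
def writesA (A : Arr) : Cmd → Bool
  | skip => false
  | assign _ _ => false
  | store A' _ _ => decide (A' = A)
  | seq P Q => P.writesA A || Q.writesA A
  | ite _ P Q => P.writesA A || Q.writesA A
  | loop _ _ P => P.writesA A

/-- Variables that bound a loop. -/
def bounds (x : Var) : Cmd → Bool
  | skip => false
  | assign _ _ => false
  | store _ _ _ => false
  | seq P Q => P.bounds x || Q.bounds x
  | ite _ P Q => P.bounds x || Q.bounds x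
  | loop _ b P => decide (b = x) || P.bounds x

/-- Bound for the running time, in terms of the values of the loop bounds. -/
def cost (β : Var → ℕ) : Cmd → ℕ
  | skip => 1
  | assign _ e => e.cost + 2
  | store _ e f => e.cost + f.cost + 9
  | seq P Q => P.cost β + Q.cost β
  | ite e P Q => e.cost + P.cost β + Q.cost β + 1
  | loop _ b P => β b * (P.cost β + 6) + 4

/-- Compile a command, using registers from `d` on as temporaries. -/
def compile : Cmd → ℕ → RamProgram
  | skip, _ => .skip
  | assign x e, d => .seq (e.compile d) (.seq (.const x.reg 0) (.add x.reg x.reg d))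
  | store A e f, d =>
      .seq (e.compile d) (.seq (address A d) (.seq (f.compile (d + 1)) (.store d (d + 1))))
  | seq P Q, d => .seq (P.compile d) (Q.compile d)
  | ite e P Q, d => .seq (e.compile d) (.ite d (P.compile d) (Q.compile d))
  | loop x b P, d =>
      .seq (.const d 0) <| .seq (.add d d b.reg) <| .seq (.const (d + 1) 0) <|
      .loop d <| .seq (.const x.reg 0) <| .seq (.add x.reg x.reg (d + 1)) <|
      .seq (P.compile (d + 2)) <| .seq (.const (d + 2) 1) <|
      .seq (.add (d + 1) (d + 1) (d + 2)) (.sub d d (d + 2))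

/-- Frame rule. The set of written variables is computed from the syntax, so for concrete commands
the hypothesis is checked by `rfl` or `decide`; likewise for arrays in `run_a`. -/
theorem run_v (I : List ℕ) {x : Var} (P : Cmd) (s : St) (h : P.writesV x = false) :
    (P.run I s).v x = s.v x := by
  induction P generalizing s with
  | skip => rfl
  | assign y e =>
    have : x ≠ y := by rintro rfl; simp [writesV] at h
    simp [run, St.setV, this]
  | store A e f => rfl
  | seq P Q hP hQ =>
    simp only [writesV, Bool.or_eq_false_iff] at h
    simp [run, hQ _ h.2, hP _ h.1]
  | ite e P Q hP hQ =>
    simp only [writesV, Bool.or_eq_false_iff] at h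
    simp only [run]
    split_ifs
    exacts [hP _ h.1, hQ _ h.2]
  | loop y b P hP =>
    simp only [writesV, Bool.or_eq_false_iff, decide_eq_false_iff_not] at h
    simp only [run]
    generalize s.v b = n
    induction n with
    | zero => rfl
    | succ n ih =>
      change (P.run I (St.setV _ y n)).v x = _
      rw [hP _ h.2, ← ih]
      simp [St.setV, Ne.symm h.1]

theorem run_a (I : List ℕ) {A : Arr} (P : Cmd) (s : St) (h : P.writesA A = false) :
    (P.run I s).a A = s.a A := by
  induction P generalizing s with
  | skip => rfl
  | assign y e => rfl
  | store A' e f =>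
    have : A ≠ A' := by rintro rfl; simp [writesA] at h
    simp [run, St.setA, this]
  | seq P Q hP hQ =>
    simp only [writesA, Bool.or_eq_false_iff] at h
    simp [run, hQ _ h.2, hP _ h.1]
  | ite e P Q hP hQ =>
    simp only [writesA, Bool.or_eq_false_iff] at h
    simp only [run]
    split_ifs
    exacts [hP _ h.1, hQ _ h.2]
  | loop y b P hP =>
    simp only [writesA] at h
    simp only [run]
    generalize s.v b = n
    induction n with
    | zero => rfl
    | succ n ih =>
      change (P.run I (St.setV _ y n)).a A = _
      rw [hP _ h, ← ih]
      rfl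

/-- Induction over the rounds of a loop. -/
theorem run_loop_induction (I : List ℕ) {x b : Var} {P : Cmd} {s : St} (J : ℕ → St → Prop)
    (h0 : J 0 s) (hs : ∀ i < s.v b, ∀ s', J i s' → J (i + 1) (P.run I (s'.setV x i))) :
    J (s.v b) ((loop x b P).run I s) := by
  simp only [run]
  have : ∀ i ≤ s.v b, J i (Nat.rec s (fun i s' => P.run I (s'.setV x i)) i) := by
    intro i
    induction i with
    | zero => exact fun _ => h0
    | succ i ih => exact fun hi => hs i hi _ (ih (by omega))
  exact this _ le_rfl

end Cmd

theorem Expr.eval_congr (I : List ℕ) {s s' : St} (e : Expr)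
    (hv : ∀ x, e.readsV x = true → s.v x = s'.v x) (ha : ∀ A, e.reads A = true → s.a A = s'.a A) :
    e.eval I s = e.eval I s' := by
  induction e with
  | lit c => rfl
  | var x => simp [eval, hv x (by simp [readsV])]
  | add e f h1 h2 | sub e f h1 h2 =>
    simp only [reads, readsV, Bool.or_eq_true] at hv ha
    simp [eval, h1 (fun x h => hv x (.inl h)) (fun x h => ha x (.inl h)),
      h2 (fun x h => hv x (.inr h)) (fun x h => ha x (.inr h))]
  | arr A e h1 =>
    simp only [reads, readsV, Bool.or_eq_true, decide_eq_true_eq] at hv ha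
    simp [eval, h1 hv (fun x h => ha x (.inr h)), ha A (.inl rfl)]
  | inp e h1 => simp [eval, h1 hv ha]
  | ite e f g h1 h2 h3 =>
    simp only [reads, readsV, Bool.or_eq_true] at hv ha
    simp [eval, h1 (fun x h => hv x (.inl (.inl h))) (fun x h => ha x (.inl (.inl h))),
      h2 (fun x h => hv x (.inl (.inr h))) (fun x h => ha x (.inl (.inr h))),
      h3 (fun x h => hv x (.inr h)) (fun x h => ha x (.inr h))]

/-! ### Correctness and cost of the compilation -/

/-- The configuration `σ` represents the state `s`. -/
structure Rep (I : List ℕ) (σ : RamState) (s : St) : Prop where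
  base : σ.reg 0 = I.length
  var : ∀ x : Var, σ.reg x.reg = s.v x
  arr : ∀ A i, σ.mem (I.length + 32 * i + A.idx) = s.a A i
  inp : ∀ p < I.length, σ.mem p = I.getD p 0

open RamProgram

lemma Rep.congr {I : List ℕ} {σ σ' : RamState} {s : St} {d : ℕ} (h : Rep I σ s) (hd : 16 ≤ d)
    (hr : ∀ r < d, σ'.reg r = σ.reg r) (hm : σ'.mem = σ.mem) : Rep I σ' s where
  base := by rw [hr 0 (by omega), h.base]
  var x := by rw [hr _ (by have := x.reg_lt; omega), h.var]
  arr := by rw [hm]; exact h.arr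
  inp := by rw [hm]; exact h.inp

lemma exec_address (A : Arr) (d : ℕ) (hd : 0 < d) (σ : RamState) :
    ∃ σ', Exec (address A d) σ σ' 8 ∧ σ'.mem = σ.mem ∧ (∀ r < d, σ'.reg r = σ.reg r) ∧
      σ'.reg d = σ.reg 0 + 32 * σ.reg d + A.idx := by
  refine ⟨_, .seq (.add ..) <| .seq (.add ..) <| .seq (.add ..) <| .seq (.add ..) <|
    .seq (.add ..) <| .seq (.add ..) <| .seq (.const ..) (.add ..), rfl, ?_, ?_⟩
  · intro r hr
    have h1 : r ≠ d := by omega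
    have h2 : r ≠ d + 1 := by omega
    simp [RamState.setReg, h1, h2]
  · have h1 : (0 : ℕ) ≠ d := by omega
    simp [RamState.setReg, h1]
    ring

/-- The scratch registers behave like a stack: nothing below `d` is touched, so the first operand
survives in `d` while the second one is evaluated from `d + 1` on. -/
theorem Expr.exec_compile {I : List ℕ} {s : St} (e : Expr) {d : ℕ} (hd : 16 ≤ d) {σ : RamState}
    (h : Rep I σ s) : ∃ σ' t, Exec (e.compile d) σ σ' t ∧ t ≤ e.cost ∧ σ'.mem = σ.mem ∧
      (∀ r < d, σ'.reg r = σ.reg r) ∧ σ'.reg d = e.eval I s := by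
  induction e generalizing d σ with
  | lit c =>
    refine ⟨_, _, .const .., le_rfl, rfl, fun r hr => ?_, ?_⟩
    · simp [RamState.setReg, hr.ne]
    · simp [RamState.setReg, eval]
  | var x =>
    have h2 : x.reg ≠ d := by have := x.reg_lt; omega
    refine ⟨_, _, .seq (.const ..) (.add ..), le_rfl, rfl, fun r hr => ?_, ?_⟩
    · simp [RamState.setReg, hr.ne]
    · simp [RamState.setReg, eval, h2, h.var]
  | add e f h1 h2 =>
    obtain ⟨σ1, t1, e1, c1, m1, r1, v1⟩ := h1 hd h
    obtain ⟨σ2, t2, e2, c2, m2, r2, v2⟩ := h2 (by omega : 16 ≤ d + 1) (h.congr hd r1 m1)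
    refine ⟨_, _, .seq e1 (.seq e2 (.add ..)), by simp only [cost]; omega,
      by simp [RamState.setReg, m2, m1],
      fun r hr => ?_, ?_⟩
    · simp [RamState.setReg, hr.ne, r2 r (by omega), r1 r hr]
    · simp [RamState.setReg, eval, v2, r2 d (by omega), v1]
  | sub e f h1 h2 =>
    obtain ⟨σ1, t1, e1, c1, m1, r1, v1⟩ := h1 hd h
    obtain ⟨σ2, t2, e2, c2, m2, r2, v2⟩ := h2 (by omega : 16 ≤ d + 1) (h.congr hd r1 m1)
    refine ⟨_, _, .seq e1 (.seq e2 (.sub ..)), by simp only [cost]; omega,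
      by simp [RamState.setReg, m2, m1],
      fun r hr => ?_, ?_⟩
    · simp [RamState.setReg, hr.ne, r2 r (by omega), r1 r hr]
    · simp [RamState.setReg, eval, v2, r2 d (by omega), v1]
  | arr A e h1 =>
    obtain ⟨σ1, t1, e1, c1, m1, r1, v1⟩ := h1 hd h
    obtain ⟨σ2, e2, m2, r2, v2⟩ := exec_address A d (by omega) σ1
    refine ⟨_, _, .seq e1 (.seq e2 (.load ..)), by simp only [cost]; omega,
      by simp [RamState.setReg, m2, m1],
      fun r hr => ?_, ?_⟩
    · simp [RamState.setReg, hr.ne, r2 r (by omega), r1 r hr]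
    · simp [RamState.setReg, eval, v2, m2, m1, v1, r1 0 (by omega), h.base, h.arr]
  | inp e h1 =>
    obtain ⟨σ1, t1, e1, c1, m1, r1, v1⟩ := h1 hd h
    have h0 := r1 0 (by omega)
    -- Behind the input the memory holds the arrays, while `getD` returns `0` there; therefore the
    -- compiled code compares the position with the input length.
    by_cases hlt : e.eval I s < I.length
    · refine ⟨_, _, .seq e1 (.seq (.sub ..) (.ite_true ?_ (.load ..))), by simp only [cost]; omega,
        by simp [RamState.setReg, m1], fun r hr => ?_, ?_⟩
      · simp [RamState.setReg, v1, h0, h.base]; omega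
      · simp [RamState.setReg, hr.ne, show r ≠ d + 1 by omega, r1 r hr]
      · simp [RamState.setReg, eval, m1, v1, h.inp _ hlt]
    · refine ⟨_, _, .seq e1 (.seq (.sub ..) (.ite_false ?_ (.const ..))), by simp only [cost]; omega,
        by simp [RamState.setReg, m1], fun r hr => ?_, ?_⟩
      · simp [RamState.setReg, v1, h0, h.base]; omega
      · simp [RamState.setReg, hr.ne, show r ≠ d + 1 by omega, r1 r hr]
      · simp [RamState.setReg, eval, List.getElem?_eq_none (not_lt.mp hlt)]
  | ite e f g h1 h2 h3 =>
    obtain ⟨σ1, t1, e1, c1, m1, r1, v1⟩ := h1 hd h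
    by_cases hz : e.eval I s = 0
    · obtain ⟨σ2, t2, e2, c2, m2, r2, v2⟩ := h3 hd (h.congr hd r1 m1)
      refine ⟨_, _, .seq e1 (.ite_false (v1.trans hz) e2), by simp only [cost]; omega, m2.trans m1,
        fun r hr => (r2 r hr).trans (r1 r hr), by simp [v2, eval, hz]⟩
    · obtain ⟨σ2, t2, e2, c2, m2, r2, v2⟩ := h2 hd (h.congr hd r1 m1)
      refine ⟨_, _, .seq e1 (.ite_true (by rwa [v1]) e2), by simp only [cost]; omega, m2.trans m1,
        fun r hr => (r2 r hr).trans (r1 r hr), by simp [v2, eval, hz]⟩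

lemma Rep.setV {I : List ℕ} {σ σ' : RamState} {s : St} {x : Var} {w : ℕ} (h : Rep I σ s)
    (hr : ∀ r < 16, r ≠ x.reg → σ'.reg r = σ.reg r) (hx : σ'.reg x.reg = w)
    (hm : σ'.mem = σ.mem) : Rep I σ' (s.setV x w) where
  base := by rw [hr 0 (by omega) x.reg_pos.ne, h.base]
  var y := by
    by_cases hy : y = x
    · subst hy; simp [St.setV, hx]
    · rw [hr _ y.reg_lt (fun h' => hy (Var.reg_injective h')), h.var]
      simp [St.setV, hy]
  arr := by rw [hm]; exact h.arr
  inp := by rw [hm]; exact h.inp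

lemma Rep.setA {I : List ℕ} {σ σ' : RamState} {s : St} {A : Arr} {i w : ℕ} (h : Rep I σ s)
    (hr : ∀ r < 16, σ'.reg r = σ.reg r)
    (hm : σ'.mem = Function.update σ.mem (I.length + 32 * i + A.idx) w) :
    Rep I σ' (s.setA A i w) where
  base := by rw [hr 0 (by omega), h.base]
  var y := by rw [hr _ y.reg_lt, h.var]; rfl
  arr A' j := by
    have hA := A.idx_lt
    have hA' := A'.idx_lt
    rw [hm]
    by_cases hj : A' = A ∧ j = i
    · obtain ⟨rfl, rfl⟩ := hj
      simp [St.setA]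
    · have hne : I.length + 32 * j + A'.idx ≠ I.length + 32 * i + A.idx := by
        intro he
        have h1 : A'.idx = A.idx := by omega
        exact hj ⟨Arr.idx_injective h1, by omega⟩
      rw [Function.update_of_ne hne, h.arr]
      by_cases hA : A' = A
      · subst hA
        have : j ≠ i := fun h' => hj ⟨rfl, h'⟩
        simp [St.setA, this]
      · simp [St.setA, hA]
  inp p hp := by
    rw [hm, Function.update_of_ne (by omega), h.inp p hp]

/-- Bounds on the initial values suffice because no command writes a variable that limits one of its
loops. A round of a loop costs six steps besides its body, and setting up and leaving the loop costs
four. -/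
theorem Cmd.exec_compile {I : List ℕ} (β : Var → ℕ) (P : Cmd) {s : St} {d : ℕ} (hd : 16 ≤ d)
    {σ : RamState} (h : Rep I σ s) (hb : ∀ x, P.bounds x = true → s.v x ≤ β x)
    (hw : ∀ x, P.bounds x = true → P.writesV x = false) :
    ∃ σ' t, Exec (P.compile d) σ σ' t ∧ t ≤ P.cost β ∧ Rep I σ' (P.run I s) ∧
      ∀ r < d, 16 ≤ r → σ'.reg r = σ.reg r := by
  induction P generalizing d σ s with
  | skip => exact ⟨_, _, .skip _, le_rfl, h, fun _ _ _ => rfl⟩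
  | assign x e =>
    obtain ⟨σ1, t1, e1, c1, m1, r1, v1⟩ := e.exec_compile hd h
    have hx := x.reg_lt
    refine ⟨_, _, .seq e1 (.seq (.const ..) (.add ..)), by simp only [cost]; omega, ?_, ?_⟩
    · refine h.setV (fun r hr hne => ?_) ?_ ?_
      · simp [RamState.setReg, hne, r1 r (by omega)]
      · simp [RamState.setReg, show d ≠ x.reg by omega, v1]
      · simp [RamState.setReg, m1]
    · intro r hr hr'
      simp [RamState.setReg, show r ≠ x.reg by omega, r1 r hr]
  | store A e f =>
    obtain ⟨σ1, t1, e1, c1, m1, r1, v1⟩ := e.exec_compile hd h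
    obtain ⟨σ2, e2, m2, r2, v2⟩ := exec_address A d (by omega) σ1
    have h2 : Rep I σ2 s := (h.congr hd r1 m1).congr hd r2 m2
    obtain ⟨σ3, t3, e3, c3, m3, r3, v3⟩ := f.exec_compile (by omega : 16 ≤ d + 1) h2
    refine ⟨_, _, .seq e1 (.seq e2 (.seq e3 (.store ..))), by simp only [cost]; omega, ?_, ?_⟩
    · refine h.setA (fun r hr => ?_) ?_
      · simp [RamState.setMem, r3 r (by omega), r2 r (by omega), r1 r (by omega)]
      · simp [RamState.setMem, m3, m2, m1, r3 d (by omega), v2, v1, v3, r1 0 (by omega), h.base]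
    · intro r hr hr'
      simp [RamState.setMem, r3 r (by omega), r2 r (by omega), r1 r (by omega)]
  | seq P Q hP hQ =>
    simp only [bounds, writesV, Bool.or_eq_true, Bool.or_eq_false_iff] at hb hw
    obtain ⟨σ1, t1, e1, c1, R1, r1⟩ := hP hd h (fun x hx => hb x (.inl hx))
      (fun x hx => (hw x (.inl hx)).1)
    obtain ⟨σ2, t2, e2, c2, R2, r2⟩ := hQ hd R1
      (fun x hx => by rw [run_v I P s (hw x (.inr hx)).1]; exact hb x (.inr hx))
      (fun x hx => (hw x (.inr hx)).2)
    exact ⟨_, _, .seq e1 e2, by simp only [cost]; omega, R2,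
      fun r hr hr' => (r2 r hr hr').trans (r1 r hr hr')⟩
  | ite e P Q hP hQ =>
    simp only [bounds, writesV, Bool.or_eq_true, Bool.or_eq_false_iff] at hb hw
    obtain ⟨σ1, t1, e1, c1, m1, r1, v1⟩ := e.exec_compile hd h
    have h1 := h.congr hd r1 m1
    by_cases hz : e.eval I s = 0
    · obtain ⟨σ2, t2, e2, c2, R2, r2⟩ := hQ hd h1 (fun x hx => hb x (.inr hx))
        (fun x hx => (hw x (.inr hx)).2)
      exact ⟨_, _, .seq e1 (.ite_false (v1.trans hz) e2), by simp only [cost]; omega,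
        by simpa [run, hz] using R2, fun r hr hr' => (r2 r hr hr').trans (r1 r hr)⟩
    · obtain ⟨σ2, t2, e2, c2, R2, r2⟩ := hP hd h1 (fun x hx => hb x (.inl hx))
        (fun x hx => (hw x (.inl hx)).1)
      exact ⟨_, _, .seq e1 (.ite_true (by rwa [v1]) e2), by simp only [cost]; omega,
        by simpa [run, hz] using R2, fun r hr hr' => (r2 r hr hr').trans (r1 r hr)⟩
  | loop x b P hP =>
    simp only [bounds, writesV, Bool.or_eq_true, Bool.or_eq_false_iff, decide_eq_true_eq,
      decide_eq_false_iff_not] at hb hw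
    have hx := x.reg_lt
    have hbr := b.reg_lt
    -- The machine counts the remaining rounds down in `d` and the round number up in `d + 1`, and
    -- the body works from `d + 2` on. The start `i` is arbitrary because the machine splits off the
    -- first round, whereas the recursion in `run` splits off the last.
    have key : ∀ n i (σ₀ : RamState) (s₀ : St), Rep I σ₀ s₀ → σ₀.reg d = n → σ₀.reg (d + 1) = i →
        (∀ y, P.bounds y = true → s₀.v y ≤ β y) →
        ∃ σ' t, Exec (.loop d <| .seq (.const x.reg 0) <| .seq (.add x.reg x.reg (d + 1)) <|
          .seq (P.compile (d + 2)) <| .seq (.const (d + 2) 1) <|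
          .seq (.add (d + 1) (d + 1) (d + 2)) (.sub d d (d + 2))) σ₀ σ' t ∧
          t ≤ n * (P.cost β + 6) + 1 ∧
          Rep I σ' (Nat.rec s₀ (fun l s' => P.run I (s'.setV x (i + l))) n) ∧
          ∀ r < d, 16 ≤ r → σ'.reg r = σ₀.reg r := by
      intro n
      induction n with
      | zero =>
        intro i σ₀ s₀ h₀ hn hi _
        exact ⟨_, _, .loop_done hn, by omega, h₀, fun _ _ _ => rfl⟩
      | succ n ih =>
        intro i σ₀ s₀ h₀ hn hi hb₀
        have h1 : Rep I ((σ₀.setReg x.reg 0).setReg x.reg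
            ((σ₀.setReg x.reg 0).reg x.reg + (σ₀.setReg x.reg 0).reg (d + 1))) (s₀.setV x i) := by
          refine h₀.setV (fun r hr hne => ?_) ?_ rfl
          · simp [RamState.setReg, hne]
          · simp [RamState.setReg, show d + 1 ≠ x.reg by omega, hi]
        obtain ⟨σ2, t2, e2, c2, R2, r2⟩ := hP (by omega : 16 ≤ d + 2) h1
          (fun y hy => by
            have : y ≠ x := fun h' => (hw y (.inr hy)).1 h'.symm
            simpa [St.setV, this] using hb₀ y hy)
          (fun y hy => (hw y (.inr hy)).2)
        have R3 := R2.congr (σ' := ((σ2.setReg (d + 2) 1).setReg (d + 1)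
          ((σ2.setReg (d + 2) 1).reg (d + 1) + (σ2.setReg (d + 2) 1).reg (d + 2))).setReg d
          (((σ2.setReg (d + 2) 1).setReg (d + 1)
          ((σ2.setReg (d + 2) 1).reg (d + 1) + (σ2.setReg (d + 2) 1).reg (d + 2))).reg d -
          ((σ2.setReg (d + 2) 1).setReg (d + 1)
          ((σ2.setReg (d + 2) 1).reg (d + 1) + (σ2.setReg (d + 2) 1).reg (d + 2))).reg (d + 2)))
          hd (fun r hr => by
            simp [RamState.setReg, show r ≠ d by omega, show r ≠ d + 1 by omega,
              show r ≠ d + 2 by omega]) rfl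
        have hd0 : σ2.reg d = n + 1 := by
          rw [r2 d (by omega) hd]
          simp [RamState.setReg, show d ≠ x.reg by omega, hn]
        have hd1 : σ2.reg (d + 1) = i := by
          rw [r2 (d + 1) (by omega) (by omega)]
          simp [RamState.setReg, show d + 1 ≠ x.reg by omega, hi]
        obtain ⟨σ4, t4, e4, c4, R4, r4⟩ := ih (i + 1) _ _ R3
          (by simp [RamState.setReg, hd0]) (by simp [RamState.setReg, hd1])
          (fun y hy => by
            have : y ≠ x := fun h' => (hw y (.inr hy)).1 h'.symm
            rw [run_v I P _ (hw y (.inr hy)).2]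
            simpa [St.setV, this] using hb₀ y hy)
        refine ⟨_, _, .loop_step (by omega) (.seq (.const ..) <| .seq (.add ..) <| .seq e2 <|
          .seq (.const ..) <| .seq (.add ..) (.sub ..)) e4, ?_, ?_, ?_⟩
        · have : (n + 1) * (P.cost β + 6) = n * (P.cost β + 6) + (P.cost β + 6) := by ring
          omega
        · convert R4 using 1
          clear ih hn R4 c4 e4 R3 c2 R2 e2 hd0
          induction n with
          | zero => rfl
          | succ n ih =>
            change P.run I (St.setV _ x (i + (n + 1))) = P.run I (St.setV _ x (i + 1 + n))
            rw [ih]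
            congr 2
            omega
        · intro r hr hr'
          rw [r4 r hr hr']
          simp [RamState.setReg, show r ≠ d by omega, show r ≠ d + 1 by omega,
            show r ≠ d + 2 by omega, r2 r (by omega) hr', show r ≠ x.reg by omega]
    have h1 : Rep I (((σ.setReg d 0).setReg d ((σ.setReg d 0).reg d +
        (σ.setReg d 0).reg b.reg)).setReg (d + 1) 0) s :=
      h.congr hd (fun r hr => by
        simp [RamState.setReg, show r ≠ d by omega, show r ≠ d + 1 by omega]) rfl
    obtain ⟨σ4, t4, e4, c4, R4, r4⟩ := key (s.v b) 0 _ _ h1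
      (by simp [RamState.setReg, show b.reg ≠ d by omega, h.var]) (by simp [RamState.setReg])
      (fun y hy => hb y (.inr hy))
    refine ⟨_, _, .seq (.const ..) <| .seq (.add ..) <| .seq (.const ..) e4, ?_, ?_, ?_⟩
    · have : s.v b * (P.cost β + 6) ≤ β b * (P.cost β + 6) :=
        Nat.mul_le_mul_right _ (hb b (.inl rfl))
      simp only [cost]; omega
    · simpa [run] using R4
    · intro r hr hr'
      rw [r4 r hr hr']
      simp [RamState.setReg, show r ≠ d by omega, show r ≠ d + 1 by omega]

/-! ### Tests and updates of states -/

namespace Expr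

/-- Equality test. -/
def eq (e f : Expr) : Expr := ite (add (sub e f) (sub f e)) (lit 0) (lit 1)
/-- Strict inequality test. -/
def lt (e f : Expr) : Expr := sub f e
/-- Conjunction of tests. -/
def and (e f : Expr) : Expr := ite e f (lit 0)
/-- Negation of a test. -/
def not (e : Expr) : Expr := ite e (lit 0) (lit 1)

variable (I : List ℕ) (s : St) (e f : Expr)

@[simp] lemma eval_lit (c : ℕ) : (lit c).eval I s = c := rfl
@[simp] lemma eval_var (x : Var) : (var x).eval I s = s.v x := rfl
@[simp] lemma eval_add : (add e f).eval I s = e.eval I s + f.eval I s := rfl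
@[simp] lemma eval_sub : (sub e f).eval I s = e.eval I s - f.eval I s := rfl
@[simp] lemma eval_arr (A : Arr) : (arr A e).eval I s = s.a A (e.eval I s) := rfl
@[simp] lemma eval_inp : (inp e).eval I s = I.getD (e.eval I s) 0 := rfl
@[simp] lemma eval_ite (g : Expr) :
    (ite e f g).eval I s = if e.eval I s = 0 then g.eval I s else f.eval I s := rfl
@[simp] lemma eval_eq_ne : (eq e f).eval I s = 0 ↔ e.eval I s ≠ f.eval I s := by
  change (if e.eval I s - f.eval I s + (f.eval I s - e.eval I s) = 0 then 1 else 0) = 0 ↔ _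
  by_cases h : e.eval I s - f.eval I s + (f.eval I s - e.eval I s) = 0
  · rw [if_pos h]; omega
  · rw [if_neg h]; omega
@[simp] lemma eval_lt_ne : (lt e f).eval I s = 0 ↔ ¬ e.eval I s < f.eval I s := by
  simp only [lt, eval_sub]; omega
@[simp] lemma eval_and_ne :
    (and e f).eval I s = 0 ↔ e.eval I s = 0 ∨ f.eval I s = 0 := by
  simp only [and, eval_ite, eval_lit]; split_ifs with h <;> simp_all
@[simp] lemma eval_not_ne : (not e).eval I s = 0 ↔ e.eval I s ≠ 0 := by
  simp only [not, eval_ite, eval_lit]; split_ifs with h <;> simp_all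

end Expr

@[simp] lemma St.setV_v_self (s : St) (x : Var) (w : ℕ) : (s.setV x w).v x = w := by simp [setV]
lemma St.setV_v_of_ne (s : St) {x y : Var} (w : ℕ) (h : y ≠ x) : (s.setV x w).v y = s.v y := by
  simp [setV, h]
@[simp] lemma St.setV_a (s : St) (x : Var) (w : ℕ) : (s.setV x w).a = s.a := rfl
@[simp] lemma St.setA_v (s : St) (A : Arr) (i w : ℕ) : (s.setA A i w).v = s.v := rfl
@[simp] lemma St.setA_a_self (s : St) (A : Arr) (i w : ℕ) :
    (s.setA A i w).a A = Function.update (s.a A) i w := by simp [setA]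
lemma St.setA_a_of_ne (s : St) {A A' : Arr} (i w : ℕ) (h : A' ≠ A) :
    (s.setA A i w).a A' = s.a A' := by simp [setA, h]

/-- The state `s` with `c = i`. -/
def St.at (s : St) (i : ℕ) : St := s.setV .c i
/-- The state `s` with `c = i` and `d = j`. -/
def St.at₂ (s : St) (i j : ℕ) : St := (s.setV .c i).setV .d j

section
variable (s : St) (i j : ℕ)
@[simp] lemma St.at_a : (s.at i).a = s.a := rfl
@[simp] lemma St.at₂_a : (s.at₂ i j).a = s.a := rfl
@[simp] lemma St.at_c : (s.at i).v .c = i := by simp [St.at]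
@[simp] lemma St.at₂_c : (s.at₂ i j).v .c = i := by simp [St.at₂, St.setV]
@[simp] lemma St.at₂_d : (s.at₂ i j).v .d = j := by simp [St.at₂]
lemma St.at_v {x : Var} (h : x ≠ .c) : (s.at i).v x = s.v x := by simp [St.at, St.setV, h]
lemma St.at₂_v {x : Var} (h : x ≠ .c) (h' : x ≠ .d) : (s.at₂ i j).v x = s.v x := by
  simp [St.at₂, St.setV, h, h']
end

/-! ### Loops that compute sums, tables and choices -/

namespace Cmd

/-- `A[e] += f` for all `c < b₁` and `d < b₂` that pass the test. -/
def accum (b₁ b₂ : Var) (A : Arr) (test e f : Expr) : Cmd :=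
  loop .c b₁ (loop .d b₂ (ite test (store A e (.add (.arr A e) f)) skip))

/-- `A[c] := e` for all `c < b`. -/
def fill (b : Var) (A : Arr) (e : Expr) : Cmd := loop .c b (store A (.var .c) e)

/-- `A[c] := d` for all `c < b₁` and `d < b₂` that pass the test. -/
def select (b₁ b₂ : Var) (A : Arr) (test : Expr) : Cmd :=
  loop .c b₁ (loop .d b₂ (ite test (store A (.var .c) (.var .d)) skip))

/-- Equality of two states outside the array `A` and the variables `c` and `d`. -/
structure Agree (A : Arr) (s s' : St) : Prop where
  v : ∀ x, x ≠ .c → x ≠ .d → s'.v x = s.v x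
  a : ∀ A', A' ≠ A → s'.a A' = s.a A'

lemma Agree.setV_c {A : Arr} {s s' : St} (h : Agree A s s') (i : ℕ) : Agree A s (s'.setV .c i) :=
  ⟨fun x hc hd => by rw [St.setV_v_of_ne _ _ hc, h.v x hc hd], h.a⟩
lemma Agree.setV_d {A : Arr} {s s' : St} (h : Agree A s s') (i : ℕ) : Agree A s (s'.setV .d i) :=
  ⟨fun x hc hd => by rw [St.setV_v_of_ne _ _ hd, h.v x hc hd], h.a⟩
lemma Agree.setA {A : Arr} {s s' : St} (h : Agree A s s') (i w : ℕ) : Agree A s (s'.setA A i w) :=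
  ⟨h.v, fun A' hA => by rw [St.setA_a_of_ne _ _ _ hA, h.a A' hA]⟩

/-- Inside a loop that writes only `A`, an expression that does not read `A` can be evaluated in the
initial state, with the current values of `c` and `d`. -/
lemma Agree.eval {A : Arr} {s s' : St} (h : Agree A s s') (I : List ℕ) {e : Expr}
    (he : e.reads A = false) : e.eval I s' = e.eval I (s.at₂ (s'.v .c) (s'.v .d)) := by
  refine e.eval_congr I (fun x _ => ?_) (fun A' hA => h.a A' ?_)
  · by_cases hc : x = .c
    · subst hc; simp
    by_cases hd : x = .d
    · subst hd; simp
    rw [h.v x hc hd, St.at₂_v _ _ _ hc hd]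
  · rintro rfl; simp [he] at hA

/-- The address `e` may depend on the round, so a cell collects the contributions of all rounds that
hit it. This one loop serves for existence tests, matrix-vector products and, below, multiplication
and division. -/
theorem run_accum (I : List ℕ) (b₁ b₂ : Var) (A : Arr) (test e f : Expr) (s : St)
    (h₂ : b₂ ≠ .c ∧ b₂ ≠ .d) (ht : test.reads A = false)
    (he : e.reads A = false) (hf : f.reads A = false) (x : ℕ) :
    ((accum b₁ b₂ A test e f).run I s).a A x = s.a A x + ∑ i ∈ range (s.v b₁),
      ∑ j ∈ range (s.v b₂), if test.eval I (s.at₂ i j) ≠ 0 ∧ e.eval I (s.at₂ i j) = x then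
        f.eval I (s.at₂ i j) else 0 := by
  set g : ℕ → ℕ → ℕ → ℕ := fun i j x =>
    if test.eval I (s.at₂ i j) ≠ 0 ∧ e.eval I (s.at₂ i j) = x then f.eval I (s.at₂ i j) else 0
    with hg
  suffices H : Agree A s ((accum b₁ b₂ A test e f).run I s) ∧
      ∀ x, ((accum b₁ b₂ A test e f).run I s).a A x = s.a A x + ∑ i ∈ range (s.v b₁),
        ∑ j ∈ range (s.v b₂), g i j x from H.2 x
  refine run_loop_induction I (J := fun i s' => Agree A s s' ∧ ∀ x, s'.a A x = s.a A x +
    ∑ i ∈ range i, ∑ j ∈ range (s.v b₂), g i j x) ⟨⟨fun _ _ _ => rfl, fun _ _ => rfl⟩, by simp⟩ ?_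
  rintro i - s₁ ⟨h1, h1'⟩
  have hb : (s₁.setV .c i).v b₂ = s.v b₂ := by
    rw [St.setV_v_of_ne _ _ h₂.1, h1.v _ h₂.1 h₂.2]
  have key := run_loop_induction I (x := .d) (b := b₂)
    (P := ite test (store A e (.add (.arr A e) f)) skip) (s := s₁.setV .c i)
    (J := fun j s' => Agree A s s' ∧ s'.v .c = i ∧ ∀ x, s'.a A x = s.a A x +
      ∑ i ∈ range i, ∑ j ∈ range (s.v b₂), g i j x + ∑ j ∈ range j, g i j x)
    ⟨h1.setV_c i, by simp, by simpa using h1'⟩ (by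
      rintro j - s₂ ⟨h2, h2c, h2'⟩
      have h3 := h2.setV_d j
      have hc : (s₂.setV .d j).v .c = i := by rw [St.setV_v_of_ne _ _ (by decide), h2c]
      have e1 := h3.eval I ht
      have e2 := h3.eval I he
      have e3 := h3.eval I hf
      rw [hc, St.setV_v_self] at e1 e2 e3
      simp only [run]
      split_ifs with hz
      · refine ⟨h3.setA _ _, hc, fun x => ?_⟩
        rw [e1] at hz
        simp only [St.setA_a_self, Expr.eval_add, Expr.eval_arr, e2, e3, sum_range_succ, St.setV_a]
        by_cases hx : x = e.eval I (s.at₂ i j)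
        · subst hx
          simp [h2', hg, hz]
          ring
        · simp [hx, h2', hg, Ne.symm hx]
      · refine ⟨h3, hc, fun x => ?_⟩
        rw [e1] at hz
        simp only [St.setV_a, h2', sum_range_succ]
        simp [hg, hz])
  rw [hb] at key
  refine ⟨key.1, fun x => ?_⟩
  rw [key.2.2 x, sum_range_succ]
  ring

theorem run_fill (I : List ℕ) (b : Var) (A : Arr) (e : Expr) (s : St)
    (he : e.reads A = false) (x : ℕ) :
    ((fill b A e).run I s).a A x = if x < s.v b then e.eval I (s.at x) else s.a A x := by
  suffices H : Agree A s ((fill b A e).run I s) ∧ ((fill b A e).run I s).v .d = s.v .d ∧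
    ∀ x, ((fill b A e).run I s).a A x = if x < s.v b then e.eval I (s.at x) else s.a A x from
    H.2.2 x
  refine run_loop_induction I (J := fun i s' => Agree A s s' ∧ s'.v .d = s.v .d ∧ ∀ x, s'.a A x =
    if x < i then e.eval I (s.at x) else s.a A x) ⟨⟨fun _ _ _ => rfl, fun _ _ => rfl⟩, rfl, by simp⟩
    ?_
  rintro i - s₁ ⟨h1, h1d, h1'⟩
  have h3 := h1.setV_c i
  have hd : (s₁.setV .c i).v .d = s.v .d := by rw [St.setV_v_of_ne _ _ (by decide), h1d]
  have e1 : e.eval I (s₁.setV .c i) = e.eval I (s.at i) := by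
    rw [h3.eval I he, hd, St.setV_v_self]
    refine e.eval_congr I (fun x _ => ?_) (fun _ _ => rfl)
    by_cases hd : x = .d
    · subst hd; rw [St.at₂_d, St.at_v _ _ (by decide)]
    by_cases hc : x = .c
    · subst hc; simp
    rw [St.at₂_v _ _ _ hc hd, St.at_v _ _ hc]
  refine ⟨h3.setA _ _, hd, fun x => ?_⟩
  simp only [run, St.setA_a_self, e1, Expr.eval_var, St.setV_v_self, St.setV_a]
  by_cases hx : x = i
  · subst hx; simp
  · rw [Function.update_of_ne hx, h1']
    have : x < i ↔ x < i + 1 := by omega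
    simp [this]

/-- The last `j < n` with `p j`, or `w` if there is none. -/
def lastSat (p : ℕ → Prop) [DecidablePred p] (w : ℕ) : ℕ → ℕ
  | 0 => w
  | n + 1 => if p n then n else lastSat p w n

lemma lastSat_spec (p : ℕ → Prop) [DecidablePred p] (w n : ℕ) (h : ∃ j < n, p j) :
    lastSat p w n < n ∧ p (lastSat p w n) := by
  induction n with
  | zero => simp at h
  | succ n ih =>
    rw [lastSat]
    split_ifs with hn
    · exact ⟨by omega, hn⟩
    · obtain ⟨j, hj, hp⟩ := h
      have := ih ⟨j, lt_of_le_of_ne (by omega) (fun h => hn (h ▸ hp)), hp⟩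
      exact ⟨by omega, this.2⟩

/-- Later candidates overwrite earlier ones, and without a candidate the old entry stays; hence the
default value of `lastSat`. -/
theorem run_select (I : List ℕ) (b₁ b₂ : Var) (A : Arr) (test : Expr) (s : St)
    (h₂ : b₂ ≠ .c ∧ b₂ ≠ .d) (ht : test.reads A = false) (x : ℕ) :
    ((select b₁ b₂ A test).run I s).a A x = if x < s.v b₁ then
      lastSat (fun j => test.eval I (s.at₂ x j) ≠ 0) (s.a A x) (s.v b₂) else s.a A x := by
  suffices H : Agree A s ((select b₁ b₂ A test).run I s) ∧
    ∀ x, ((select b₁ b₂ A test).run I s).a A x = if x < s.v b₁ then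
      lastSat (fun j => test.eval I (s.at₂ x j) ≠ 0) (s.a A x) (s.v b₂) else s.a A x from H.2 x
  refine run_loop_induction I (J := fun i s' => Agree A s s' ∧ ∀ x, s'.a A x = if x < i then
      lastSat (fun j => test.eval I (s.at₂ x j) ≠ 0) (s.a A x) (s.v b₂) else s.a A x)
    ⟨⟨fun _ _ _ => rfl, fun _ _ => rfl⟩, by simp⟩ ?_
  rintro i - s₁ ⟨h1, h1'⟩
  have hb : (s₁.setV .c i).v b₂ = s.v b₂ := by
    rw [St.setV_v_of_ne _ _ h₂.1, h1.v _ h₂.1 h₂.2]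
  have key := run_loop_induction I (x := .d) (b := b₂)
    (P := ite test (store A (.var .c) (.var .d)) skip) (s := s₁.setV .c i)
    (J := fun j s' => Agree A s s' ∧ s'.v .c = i ∧ ∀ x, s'.a A x = if x = i then
      lastSat (fun j => test.eval I (s.at₂ x j) ≠ 0) (s.a A x) j else s₁.a A x)
    ⟨h1.setV_c i, by simp, fun x => by
      by_cases hx : x = i
      · subst hx; simp [h1', lastSat]
      · simp [hx]⟩ (by
      rintro j - s₂ ⟨h2, h2c, h2'⟩
      have h3 := h2.setV_d j
      have hc : (s₂.setV .d j).v .c = i := by rw [St.setV_v_of_ne _ _ (by decide), h2c]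
      have e1 := h3.eval I ht
      rw [hc, St.setV_v_self] at e1
      simp only [run]
      split_ifs with hz
      · refine ⟨h3.setA _ _, hc, fun x => ?_⟩
        rw [e1] at hz
        simp only [St.setA_a_self, Expr.eval_var, hc, St.setV_v_self, St.setV_a, lastSat]
        by_cases hx : x = i
        · subst hx; simp [hz]
        · simp [hx, h2']
      · refine ⟨h3, hc, fun x => ?_⟩
        rw [e1] at hz
        simp only [St.setV_a, h2', lastSat]
        by_cases hx : x = i
        · subst hx; simp [hz]
        · simp [hx])
  rw [hb] at key
  refine ⟨key.1, fun x => ?_⟩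
  rw [key.2.2 x, h1']
  by_cases hx : x = i
  · subst hx; simp
  · have : x < i ↔ x < i + 1 := by omega
    simp [hx, this]

/-- Keep in `R` the numbers below `sq` from which one can make arbitrarily many steps from `e c d` to
`f c d`, where `c, d` pass the test. -/
def prune (R : Arr) (test e f : Expr) : Cmd :=
  seq (fill .sq R (.lit 1)) <| loop .r .sq <| seq (fill .sq .tmp (.lit 0)) <|
    seq (accum .pw .pw .tmp (.and test (.arr R f)) e (.lit 1)) (fill .sq R (.arr .tmp (.var .c)))

end Cmd

/-! ### Infinite paths in finite graphs -/

/-- There is a path with `j` steps from `x`. -/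
def HasPath (E : ℕ → ℕ → Prop) : ℕ → ℕ → Prop
  | 0, _ => True
  | j + 1, x => ∃ y, E x y ∧ HasPath E j y

/-- There is an infinite path from `x`. -/
def HasInfPath (E : ℕ → ℕ → Prop) (x : ℕ) : Prop :=
  ∃ p : ℕ → ℕ, p 0 = x ∧ ∀ i, E (p i) (p (i + 1))

lemma HasInfPath.hasPath {E : ℕ → ℕ → Prop} {x : ℕ} (h : HasInfPath E x) (j : ℕ) :
    HasPath E j x := by
  induction j generalizing x with
  | zero => trivial
  | succ j ih =>
    obtain ⟨p, rfl, hp⟩ := h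
    exact ⟨p 1, hp 0, ih ⟨fun i => p (i + 1), rfl, fun i => hp (i + 1)⟩⟩

lemma HasPath.mono {E : ℕ → ℕ → Prop} {j : ℕ} {x : ℕ} (h : HasPath E (j + 1) x) :
    HasPath E j x := by
  induction j generalizing x with
  | zero => trivial
  | succ j ih =>
    obtain ⟨y, hy, h⟩ := h
    exact ⟨y, hy, ih h⟩

/-- A path that is long enough can be made infinite. -/
theorem hasPath_iff_hasInfPath {E : ℕ → ℕ → Prop} {V : ℕ} (hE : ∀ x y, E x y → y < V)
    {x : ℕ} (hx : x < V) : HasPath E V x ↔ HasInfPath E x := by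
  classical
  refine ⟨fun h => ?_, fun h => h.hasPath V⟩
  set Z : ℕ → Finset ℕ := fun j => (range V).filter (HasPath E j) with hZ
  have hanti : ∀ j, Z (j + 1) ⊆ Z j := fun j y hy => by
    simp only [hZ, mem_filter] at hy ⊢
    exact ⟨hy.1, hy.2.mono⟩
  -- Once two consecutive sets agree, the sequence is constant: a first step into `Z j` is a first
  -- step into `Z (j + 1)`.
  have hstab : ∀ j, Z (j + 1) = Z j → Z (j + 2) = Z (j + 1) := by
    intro j hj
    refine (hanti _).antisymm fun y hy => ?_
    simp only [hZ, mem_filter, mem_range] at hy ⊢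
    obtain ⟨hyV, z, hyz, hz⟩ := hy
    have : z ∈ Z j := by simp [hZ, hz, hE _ _ hyz]
    rw [← hj] at this
    exact ⟨hyV, z, hyz, (mem_filter.mp this).2⟩
  -- As long as the sets shrink, each round loses an element; this cannot happen `V + 1` times.
  have hcard : ∀ j, Z (j + 1) = Z j ∨ (Z (j + 1)).card + (j + 1) ≤ V := by
    intro j
    induction j with
    | zero =>
      by_cases h1 : Z 1 = Z 0
      · exact .inl h1
      · right
        have h2 := card_lt_card ((hanti 0).ssubset_of_ne h1)
        have h3 : (Z 0).card ≤ V := (card_filter_le _ _).trans (card_range V).le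
        omega
    | succ j ih =>
      rcases ih with ih | ih
      · exact .inl (hstab j ih)
      · by_cases h1 : Z (j + 2) = Z (j + 1)
        · exact .inl h1
        · right
          have h2 := card_lt_card ((hanti (j + 1)).ssubset_of_ne h1)
          omega
  have hV : Z (V + 1) = Z V := by
    rcases hcard V with h | h
    · exact h
    · omega
  -- Stability at `V` means that every vertex of `Z V` has a successor in `Z V`; iterating a choice
  -- gives the infinite path.
  have hstep : ∀ y : Z V, ∃ z : Z V, E y z := by
    rintro ⟨y, hy⟩
    rw [← hV] at hy
    obtain ⟨-, z, hyz, hz⟩ := mem_filter.mp hy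
    exact ⟨⟨z, by simp [hZ, hz, hE _ _ hyz]⟩, hyz⟩
  choose g hg using hstep
  refine ⟨fun i => (g^[i] ⟨x, by simp [hZ, hx, h]⟩ : Z V), rfl, fun i => ?_⟩
  simp only [Function.iterate_succ_apply']
  exact hg _

/-! ### Pruning finds the starts of infinite paths -/

namespace Cmd

/-- The steps followed by `prune`. -/
def Step (I : List ℕ) (s : St) (test e f : Expr) (x y : ℕ) : Prop :=
  ∃ i < s.v .pw, ∃ j < s.v .pw, test.eval I (s.at₂ i j) ≠ 0 ∧ e.eval I (s.at₂ i j) = x ∧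
    f.eval I (s.at₂ i j) = y

/-- After `i` rounds `R` marks the starts of paths with `i` steps: `tmp` counts the steps into
marked vertices, so it is nonzero exactly where such a step exists. The number of rounds is the
number of possible vertices, which is enough by `hasPath_iff_hasInfPath`. -/
theorem run_prune (I : List ℕ) (R : Arr) (test e f : Expr) (s : St) (hR : R ≠ .tmp)
    (ht : test.reads R = false ∧ test.reads .tmp = false ∧ test.readsV .r = false)
    (he : e.reads R = false ∧ e.reads .tmp = false ∧ e.readsV .r = false)
    (hf : f.reads R = false ∧ f.reads .tmp = false ∧ f.readsV .r = false)
    (hlt : ∀ x y, Step I s test e f x y → y < s.v .sq) {x : ℕ} (hx : x < s.v .sq) :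
    ((prune R test e f).run I s).a R x ≠ 0 ↔ HasInfPath (Step I s test e f) x := by
  rw [← hasPath_iff_hasInfPath hlt hx]
  set V := s.v .sq with hV
  have hev : ∀ (s' : St) (g : Expr),
      (g.reads R = false ∧ g.reads .tmp = false ∧ g.readsV .r = false) →
      (∀ x, x ≠ .c → x ≠ .d → x ≠ .r → s'.v x = s.v x) →
      (∀ A, A ≠ R → A ≠ .tmp → s'.a A = s.a A) →
      ∀ i j, g.eval I (s'.at₂ i j) = g.eval I (s.at₂ i j) := by
    intro s' g hg hv ha i j
    refine g.eval_congr I (fun x hx => ?_) (fun A hA => ha A ?_ ?_)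
    · by_cases hc : x = .c
      · subst hc; simp
      by_cases hd : x = .d
      · subst hd; simp
      rw [St.at₂_v _ _ _ hc hd, St.at₂_v _ _ _ hc hd, hv x hc hd]
      rintro rfl; simp [hg] at hx
    · rintro rfl; simp [hg] at hA
    · rintro rfl; simp [hg] at hA
  set s₁ := (fill .sq R (.lit 1)).run I s with hs₁
  have hs₁v : ∀ x, x ≠ .c → s₁.v x = s.v x := fun x hc =>
    run_v I _ _ (by simp [fill, writesV, hc.symm])
  have hs₁a : ∀ A, A ≠ R → s₁.a A = s.a A := fun A hA =>
    run_a I _ _ (by simp [fill, writesA, hA.symm])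
  suffices H : (∀ x, x ≠ .c → x ≠ .d → x ≠ .r → ((prune R test e f).run I s).v x = s.v x) ∧
      (∀ A, A ≠ R → A ≠ .tmp → ((prune R test e f).run I s).a A = s.a A) ∧
      ∀ x < V, ((prune R test e f).run I s).a R x ≠ 0 ↔ HasPath (Step I s test e f) V x from
    H.2.2 x hx
  have hb : s₁.v .sq = V := hs₁v _ (by decide)
  have key := run_loop_induction I (x := .r) (b := .sq) (P := seq (fill .sq .tmp (.lit 0)) <|
    seq (accum .pw .pw .tmp (.and test (.arr R f)) e (.lit 1)) (fill .sq R (.arr .tmp (.var .c))))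
    (s := s₁) (J := fun i s' => (∀ x, x ≠ .c → x ≠ .d → x ≠ .r → s'.v x = s.v x) ∧
      (∀ A, A ≠ R → A ≠ .tmp → s'.a A = s.a A) ∧
      ∀ x < V, s'.a R x ≠ 0 ↔ HasPath (Step I s test e f) i x)
    ⟨fun x hc _ _ => hs₁v x hc, fun A hA _ => hs₁a A hA, fun x hx => by
      rw [hs₁, run_fill I _ _ _ _ rfl, if_pos hx]
      simp [HasPath]⟩ (by
      rintro i - s₂ ⟨h2v, h2a, h2⟩
      set s₃ := (fill .sq .tmp (.lit 0)).run I (s₂.setV .r i) with hs₃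
      set s₄ := (accum .pw .pw .tmp (.and test (.arr R f)) e (.lit 1)).run I s₃ with hs₄
      have h3v : ∀ x, x ≠ .c → x ≠ .d → x ≠ .r → s₃.v x = s.v x := fun x hc hd hr => by
        rw [hs₃, run_v I _ _ (by simp [fill, writesV, hc.symm]), St.setV_v_of_ne _ _ hr,
          h2v x hc hd hr]
      have h3a : ∀ A, A ≠ .tmp → s₃.a A = s₂.a A := fun A hA =>
        run_a I _ _ (by simp [fill, writesA, hA.symm])
      have h4v : ∀ x, x ≠ .c → x ≠ .d → x ≠ .r → s₄.v x = s.v x := fun x hc hd hr => by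
        rw [hs₄, run_v I _ _ (by simp [accum, writesV, hc.symm, hd.symm]), h3v x hc hd hr]
      have h4a : ∀ A, A ≠ .tmp → s₄.a A = s₃.a A := fun A hA =>
        run_a I _ _ (by simp [accum, writesA, hA.symm])
      simp only [run]
      rw [← hs₃, ← hs₄]
      refine ⟨fun x hc hd hr => ?_, fun A hA hA' => ?_, fun x hx => ?_⟩
      · rw [run_v I _ _ (by simp [fill, writesV, hc.symm]), h4v x hc hd hr]
      · rw [run_a I _ _ (by simp [fill, writesA, hA.symm]), h4a A hA', h3a A hA', h2a A hA hA']
      · have h30 : s₃.a .tmp x = 0 := by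
          rw [hs₃, run_fill I _ _ _ _ rfl, if_pos, Expr.eval_lit]
          rw [St.setV_v_of_ne _ _ (by decide), h2v _ (by decide) (by decide) (by decide)]
          exact hx
        rw [run_fill I _ _ _ _ (by simp [Expr.reads, hR.symm]),
          h4v _ (by decide) (by decide) (by decide), if_pos (hV ▸ hx)]
        simp only [Expr.eval_arr, Expr.eval_var, St.at_c, St.at_a]
        rw [hs₄, run_accum I _ _ _ _ _ _ _ (by decide)
          (by simp [Expr.reads, Expr.and, ht, hf, hR]) he.2.1 rfl,
          h30, h3v _ (by decide) (by decide) (by decide)]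
        rw [zero_add, ne_eq, sum_eq_zero_iff]
        simp only [mem_range, sum_eq_zero_iff, not_forall]
        simp only [HasPath, Step, ite_eq_right_iff, ne_eq, Expr.eval_and_ne, Expr.eval_arr,
          Expr.eval_lit, not_or, not_forall, exists_prop, one_ne_zero, not_false_eq_true, and_true,
          St.at₂_a]
        -- The contents of `R` are known only below `V`; `hlt` puts the far end of every step there.
        have hp : ∀ i' < s.v .pw, ∀ j < s.v .pw, test.eval I (s.at₂ i' j) ≠ 0 →
            (s₃.a R (f.eval I (s.at₂ i' j)) ≠ 0 ↔
              HasPath (Step I s test e f) i (f.eval I (s.at₂ i' j))) := by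
          intro i' hi' j hj htest
          rw [h3a R hR]
          exact h2 _ (hlt _ _ ⟨i', hi', j, hj, htest, rfl, rfl⟩)
        constructor
        · rintro ⟨i', hi', j, hj, ⟨h5, h6⟩, h7⟩
          rw [hev s₃ _ ht h3v (fun A hA hA' => (h3a A hA').trans (h2a A hA hA'))] at h5
          rw [hev s₃ _ hf h3v (fun A hA hA' => (h3a A hA').trans (h2a A hA hA'))] at h6
          rw [hev s₃ _ he h3v (fun A hA hA' => (h3a A hA').trans (h2a A hA hA'))] at h7
          exact ⟨_, ⟨i', hi', j, hj, h5, h7, rfl⟩, (hp i' hi' j hj h5).mp h6⟩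
        · rintro ⟨_, ⟨i', hi', j, hj, h5, h7, rfl⟩, h6⟩
          refine ⟨i', hi', j, hj, ⟨?_, ?_⟩, ?_⟩
          · rwa [hev s₃ _ ht h3v (fun A hA hA' => (h3a A hA').trans (h2a A hA hA'))]
          · rw [hev s₃ _ hf h3v (fun A hA hA' => (h3a A hA').trans (h2a A hA hA'))]
            exact (hp i' hi' j hj h5).mpr h6
          · rwa [hev s₃ _ he h3v (fun A hA hA' => (h3a A hA').trans (h2a A hA hA'))])
  rw [hb] at key
  exact key

end Cmd
end LoopLang

/-! ### Walks coded by natural numbers -/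

/-- The bi-infinite walks along edges with `B`; `s` and `t` give the ends of the edges. -/
def walks (B : ℕ → Prop) (s t : ℕ → ℕ) : Set (ℤ → ℕ) :=
  {x | ∀ i, B (x i) ∧ t (x i) = s (x (i + 1))}

/-- Join a left infinite and a right infinite sequence. -/
def glue (p q : ℕ → ℕ) : ℤ → ℕ
  | Int.ofNat i => q i
  | Int.negSucc i => p i

@[simp] lemma glue_natCast (p q : ℕ → ℕ) (i : ℕ) : glue p q i = q i := rfl
@[simp] lemma glue_zero (p q : ℕ → ℕ) : glue p q 0 = q 0 := rfl
@[simp] lemma glue_negSucc (p q : ℕ → ℕ) (i : ℕ) : glue p q (Int.negSucc i) = p i := rfl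

lemma comp_glue (f p q : ℕ → ℕ) : f ∘ glue p q = glue (f ∘ p) (f ∘ q) := by
  funext i; cases i <;> rfl

section Walks

variable {B : ℕ → Prop} {s t : ℕ → ℕ}

/-- The left part is indexed away from the origin, `p 0` standing at position `-1`; so its edge
condition runs backwards and the seam is between `p 0` and `q 0`. -/
lemma glue_mem_walks {p q : ℕ → ℕ} (hp : ∀ i, B (p i) ∧ t (p (i + 1)) = s (p i))
    (hq : ∀ i, B (q i) ∧ t (q i) = s (q (i + 1))) (h : t (p 0) = s (q 0)) :
    glue p q ∈ walks B s t := by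
  rintro (i | i)
  · exact hq i
  · cases i with
    | zero => exact ⟨(hp 0).1, h⟩
    | succ i => exact ⟨(hp (i + 1)).1, (hp i).2⟩

lemma shift_mem_walks {x : ℤ → ℕ} (hx : x ∈ walks B s t) (a : ℤ) :
    (fun i => x (i + a)) ∈ walks B s t := by
  intro i
  have := hx (i + a)
  rw [add_right_comm] at this
  exact this

/-- `pred` and `succ` choose an edge before and an edge after each edge. -/
def HasRays (B : ℕ → Prop) (s t pred succ : ℕ → ℕ) : Prop :=
  ∀ c, B c → (B (pred c) ∧ t (pred c) = s c) ∧ (B (succ c) ∧ t c = s (succ c))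

variable {pred succ : ℕ → ℕ}

lemma HasRays.left (h : HasRays B s t pred succ) {c : ℕ} (hc : B c) (i : ℕ) :
    B (pred^[i] c) ∧ t (pred^[i + 1] c) = s (pred^[i] c) := by
  have : B (pred^[i] c) := by
    induction i with
    | zero => exact hc
    | succ i ih => rw [Function.iterate_succ_apply']; exact (h _ ih).1.1
  exact ⟨this, by rw [Function.iterate_succ_apply']; exact (h _ this).1.2⟩

lemma HasRays.right (h : HasRays B s t pred succ) {c : ℕ} (hc : B c) (i : ℕ) :
    B (succ^[i] c) ∧ t (succ^[i] c) = s (succ^[i + 1] c) := by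
  have : B (succ^[i] c) := by
    induction i with
    | zero => exact hc
    | succ i ih => rw [Function.iterate_succ_apply']; exact (h _ ih).2.1
  exact ⟨this, by rw [Function.iterate_succ_apply']; exact (h _ this).2.2⟩

/-- Compactness: a sequence is the label sequence of a walk as soon as all its finite segments
are. -/
lemma exists_walk_of_segments {N : ℕ} (hB : ∀ c, B c → c < N) (lab : ℕ → ℕ) (y : ℤ → ℕ)
    (h : ∀ r : ℕ, ∃ x ∈ walks B s t, ∀ i : ℤ, |i| ≤ r → lab (x i) = y i) :
    ∃ x ∈ walks B s t, lab ∘ x = y := by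
  have hcl : ∀ (i j : ℤ) (P : ℕ → ℕ → Prop), IsClosed {x : ℤ → ℕ | P (x i) (x j)} := by
    intro i j P
    have hc : Continuous fun x : ℤ → ℕ => (x i, x j) := by fun_prop
    exact (isClosed_discrete {p : ℕ × ℕ | P p.1 p.2}).preimage hc
  set K : ℕ → Set (ℤ → ℕ) := fun r => walks B s t ∩ {x | ∀ i : ℤ, |i| ≤ r → lab (x i) = y i}
    with hK
  have hclosed : ∀ r, IsClosed (K r) := by
    intro r
    refine IsClosed.inter ?_ ?_
    · have : walks B s t = ⋂ i : ℤ, {x | B (x i) ∧ t (x i) = s (x (i + 1))} := by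
        ext x; simp [walks]
      rw [this]
      exact isClosed_iInter fun i => hcl i (i + 1) fun a b => B a ∧ t a = s b
    · have : {x : ℤ → ℕ | ∀ i : ℤ, |i| ≤ r → lab (x i) = y i} =
          ⋂ i : ℤ, {x | |i| ≤ r → lab (x i) = y i} := by ext x; simp
      rw [this]
      exact isClosed_iInter fun i => hcl i i fun a _ => |i| ≤ r → lab a = y i
  -- The alphabet is finite, so all the nested closed sets lie in one compact product and have a
  -- common point.
  have hcomp : IsCompact (Set.pi Set.univ fun _ : ℤ => Set.Iio N) :=
    isCompact_univ_pi fun _ => (Set.finite_Iio N).isCompact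
  have hsub : ∀ r, K r ⊆ Set.pi Set.univ fun _ : ℤ => Set.Iio N := fun r x hx i _ =>
    hB _ (hx.1 i).1
  obtain ⟨x, hx⟩ := IsCompact.nonempty_iInter_of_sequence_nonempty_isCompact_isClosed K
    (fun r x hx => ⟨hx.1, fun i hi => hx.2 i (hi.trans (by push_cast; linarith))⟩)
    (fun r => by obtain ⟨x, h1, h2⟩ := h r; exact ⟨x, h1, h2⟩)
    (hcomp.of_isClosed_subset (hclosed 0) (hsub 0)) hclosed
  rw [Set.mem_iInter] at hx
  refine ⟨x, (hx 0).1, funext fun i => (hx i.natAbs).2 i ?_⟩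
  rw [Int.abs_eq_natAbs]

end Walks

/-! ### Pairs of paths -/

/-- There are paths `c`, `d`, edge by edge related by `K`, that start at `a` and `b`. An edge `e` of
`c` leads from `X e` to `X' e`, an edge `e` of `d` leads from `Y e` to `Y' e`. -/
def PairPath (K : ℕ → ℕ → Prop) (X Y X' Y' : ℕ → ℕ) (a b : ℕ) : Prop :=
  ∃ c d : ℕ → ℕ, X (c 0) = a ∧ Y (d 0) = b ∧
    ∀ i, K (c i) (d i) ∧ X' (c i) = X (c (i + 1)) ∧ Y' (d i) = Y (d (i + 1))

lemma pairCode_inj {N a b a' b' : ℕ} (hb : b < N) (hb' : b' < N)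
    (h : a * N + b = a' * N + b') : a = a' ∧ b = b' := by
  have h0 : 0 < N := by omega
  have h1 := congrArg (· / N) h
  have h2 := congrArg (· % N) h
  simp only [mul_comm _ N, Nat.mul_add_div h0, Nat.mul_add_mod, Nat.div_eq_of_lt hb,
    Nat.div_eq_of_lt hb', Nat.mod_eq_of_lt hb, Nat.mod_eq_of_lt hb', add_zero] at h1 h2
  exact ⟨h1, h2⟩

open LoopLang in
-- The code `a * N + b` determines both coordinates as soon as the second one is below `N`. Hence
-- consecutive steps in the coded graph match in each coordinate separately, and an infinite path
-- splits into two.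
lemma hasInfPath_iff_pairPath {N : ℕ} {K : ℕ → ℕ → Prop} {X Y X' Y' : ℕ → ℕ} {E : ℕ → ℕ → Prop}
    (hK : ∀ i j, K i j → Y j < N ∧ Y' j < N)
    (hE : ∀ x y, E x y ↔ ∃ i j, K i j ∧ X i * N + Y j = x ∧ X' i * N + Y' j = y)
    {a b : ℕ} (hb : b < N) : HasInfPath E (a * N + b) ↔ PairPath K X Y X' Y' a b := by
  constructor
  · rintro ⟨p, hp0, hp⟩
    simp only [hE] at hp
    choose c d hcd h1 h2 using hp
    have h0 := pairCode_inj (hK _ _ (hcd 0)).1 hb ((h1 0).trans hp0)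
    refine ⟨c, d, h0.1, h0.2, fun i => ⟨hcd i, ?_⟩⟩
    exact pairCode_inj (hK _ _ (hcd i)).2 (hK _ _ (hcd (i + 1))).1 ((h2 i).trans (h1 (i + 1)).symm)
  · rintro ⟨c, d, h1, h2, h3⟩
    refine ⟨fun i => X (c i) * N + Y (d i), by simp [h1, h2], fun i => ?_⟩
    rw [hE]
    exact ⟨c i, d i, (h3 i).1, rfl, by rw [(h3 i).2.1, (h3 i).2.2]⟩

section Pairs

variable (ok : ℕ → Prop) (s t lab : ℕ → ℕ)

/-- Two edges with the same label. -/
def SameLabel (c d : ℕ) : Prop := ok c ∧ ok d ∧ lab c = lab d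

/-- Two infinite paths with the same labels end at `a` and `b`. -/
def PastPair : ℕ → ℕ → Prop := PairPath (SameLabel ok lab) t t s s

/-- Two infinite paths with the same labels start at `a` and `b`. -/
def FuturePair : ℕ → ℕ → Prop := PairPath (SameLabel ok lab) s s t t

/-- The edges that lie on bi-infinite walks. -/
def Essential (c : ℕ) : Prop :=
  ok c ∧ PastPair ok s t lab (s c) (s c) ∧ FuturePair ok s t lab (t c) (t c)

variable {ok s t lab}

/-- The infinite path `c` with one more edge in front. -/
def consSeq (a : ℕ) (w : ℕ → ℕ) : ℕ → ℕ
  | 0 => a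
  | i + 1 => w i

@[simp] lemma consSeq_zero (a : ℕ) (w : ℕ → ℕ) : consSeq a w 0 = a := rfl
@[simp] lemma consSeq_succ (a : ℕ) (w : ℕ → ℕ) (i : ℕ) : consSeq a w (i + 1) = w i := rfl

lemma pastPair_of_walks {x y : ℤ → ℕ} (hx : x ∈ walks ok s t) (hy : y ∈ walks ok s t)
    (h : lab ∘ x = lab ∘ y) (a : ℤ) : PastPair ok s t lab (s (x a)) (s (y a)) := by
  refine ⟨fun i => x (a - 1 - i), fun i => y (a - 1 - i), ?_, ?_, fun i => ⟨⟨(hx _).1, (hy _).1,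
    congrFun h _⟩, ?_, ?_⟩⟩
  · have := (hx (a - 1)).2; simpa using this
  · have := (hy (a - 1)).2; simpa using this
  · have := (hx (a - 1 - (i + 1))).2
    rw [show a - 1 - ((i : ℤ) + 1) + 1 = a - 1 - i by ring] at this
    simpa using this.symm
  · have := (hy (a - 1 - (i + 1))).2
    rw [show a - 1 - ((i : ℤ) + 1) + 1 = a - 1 - i by ring] at this
    simpa using this.symm

lemma futurePair_of_walks {x y : ℤ → ℕ} (hx : x ∈ walks ok s t) (hy : y ∈ walks ok s t)
    (h : lab ∘ x = lab ∘ y) (a : ℤ) : FuturePair ok s t lab (t (x a)) (t (y a)) := by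
  refine ⟨fun i => x (a + 1 + i), fun i => y (a + 1 + i), ?_, ?_, fun i => ⟨⟨(hx _).1, (hy _).1,
    congrFun h _⟩, ?_, ?_⟩⟩
  · simpa using (hx a).2.symm
  · simpa using (hy a).2.symm
  · have := (hx (a + 1 + i)).2
    rw [add_assoc (a + 1)] at this
    simpa using this
  · have := (hy (a + 1 + i)).2
    rw [add_assoc (a + 1)] at this
    simpa using this

/-- Past, edge and future can be spliced freely, because equality of labels is tested edge by edge
and the seams involve only vertices. -/
lemma exists_walks_of_pairs {c d : ℕ} (hc : ok c) (hd : ok d) (h : lab c = lab d)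
    (hp : PastPair ok s t lab (s c) (s d)) (hf : FuturePair ok s t lab (t c) (t d)) :
    ∃ x ∈ walks ok s t, ∃ y ∈ walks ok s t, x 0 = c ∧ y 0 = d ∧ lab ∘ x = lab ∘ y := by
  obtain ⟨p, p', hp0, hp0', hp⟩ := hp
  obtain ⟨q, q', hq0, hq0', hq⟩ := hf
  refine ⟨glue p (consSeq c q), glue_mem_walks (fun i => ⟨(hp i).1.1, (hp i).2.1.symm⟩) ?_ hp0,
    glue p' (consSeq d q'), glue_mem_walks (fun i => ⟨(hp i).1.2.1, (hp i).2.2.symm⟩) ?_ hp0',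
    rfl, rfl, ?_⟩
  · rintro (_ | i)
    · exact ⟨hc, hq0.symm⟩
    · exact ⟨(hq i).1.1, (hq i).2.1⟩
  · rintro (_ | i)
    · exact ⟨hd, hq0'.symm⟩
    · exact ⟨(hq i).1.2.1, (hq i).2.2⟩
  · funext i
    rcases i with (_ | i) | i
    · exact h
    · exact (hq i).1.2.2
    · exact (hp i).1.2.2

lemma essential_of_mem {x : ℤ → ℕ} (hx : x ∈ walks ok s t) (a : ℤ) :
    Essential ok s t lab (x a) :=
  ⟨(hx a).1, pastPair_of_walks hx hx rfl a, futurePair_of_walks hx hx rfl a⟩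

/-- The two paths of a diagonal pair may differ, but either of them serves as a past or a future.
This is why the pair tables also detect the edges on walks. -/
lemma Essential.exists_walk {c : ℕ} (h : Essential ok s t lab c) :
    ∃ x ∈ walks ok s t, x 0 = c := by
  obtain ⟨x, hx, -, -, h0, -⟩ := exists_walks_of_pairs h.1 h.1 rfl h.2.1 h.2.2
  exact ⟨x, hx, h0⟩

lemma walks_essential : walks (Essential ok s t lab) s t = walks ok s t := by
  ext x
  exact ⟨fun h i => ⟨(h i).1.1, (h i).2⟩, fun h i => ⟨essential_of_mem h i, (h i).2⟩⟩

lemma Essential.exists_pred {c : ℕ} (h : Essential ok s t lab c) :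
    ∃ d, Essential ok s t lab d ∧ t d = s c := by
  obtain ⟨x, hx, rfl⟩ := h.exists_walk
  exact ⟨x (-1), essential_of_mem hx _, (hx (-1)).2⟩

lemma Essential.exists_succ {c : ℕ} (h : Essential ok s t lab c) :
    ∃ d, Essential ok s t lab d ∧ t c = s d := by
  obtain ⟨x, hx, rfl⟩ := h.exists_walk
  exact ⟨x 1, essential_of_mem hx _, (hx 0).2⟩

/-- Two different walks with the same labels differ at some position, and there they exhibit a bad
pair of edges; conversely a bad pair is spliced into two walks that differ at `0`. -/
lemma injOn_walks_iff : Set.InjOn (lab ∘ ·) (walks ok s t) ↔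
    ¬ ∃ c d, c ≠ d ∧ Essential ok s t lab c ∧ Essential ok s t lab d ∧ lab c = lab d ∧
      PastPair ok s t lab (s c) (s d) ∧ FuturePair ok s t lab (t c) (t d) := by
  constructor
  · rintro h ⟨c, d, hne, hc, hd, hl, hp, hf⟩
    obtain ⟨x, hx, y, hy, rfl, rfl, hxy⟩ := exists_walks_of_pairs hc.1 hd.1 hl hp hf
    exact hne (congrFun (h hx hy hxy) 0)
  · intro h x hx y hy hxy
    by_contra hne
    obtain ⟨i, hi⟩ := Function.ne_iff.mp hne
    exact h ⟨x i, y i, hi, essential_of_mem hx i, essential_of_mem hy i, congrFun hxy i,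
      pastPair_of_walks hx hy hxy i, futurePair_of_walks hx hy hxy i⟩

/-- Being a walk concerns consecutive letters only, and with rays at every edge each pair of
consecutive edges does occur in a walk. -/
lemma mapsTo_walks_iff {B : ℕ → Prop} {pred succ : ℕ → ℕ} (hB : HasRays B s t pred succ) {n : ℕ}
    (hlab : ∀ c, B c → lab c < n) (s' t' : ℕ → ℕ) :
    Set.MapsTo (lab ∘ ·) (walks B s t) (walks (· < n) s' t') ↔
      ¬ ∃ c d, B c ∧ B d ∧ t c = s d ∧ t' (lab c) ≠ s' (lab d) := by
  constructor
  · rintro h ⟨c, d, hc, hd, hcd, hne⟩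
    have hx : glue (fun i => pred^[i] c) (fun i => succ^[i] d) ∈ walks B s t :=
      glue_mem_walks (hB.left hc) (hB.right hd) hcd
    exact hne (h hx (Int.negSucc 0)).2
  · intro h x hx i
    refine ⟨hlab _ (hx i).1, ?_⟩
    by_contra hne
    exact h ⟨_, _, (hx i).1, (hx (i + 1)).1, (hx i).2, hne⟩

end Pairs

/-! ### Counting words -/

section Counting

open scoped Classical in
/-- One step of counting paths: `v` counts paths by their last edge. -/
noncomputable def stepVec (N : ℕ) (adj : ℕ → ℕ → Prop) (v : ℕ → ℕ) (d : ℕ) : ℕ :=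
  ∑ c ∈ range N, if adj c d then v c else 0

open scoped Classical in
/-- The paths with `j` steps that start at `c` and end in `O`, padded with zeros. -/
noncomputable def paths (N : ℕ) (adj : ℕ → ℕ → Prop) (O : ℕ → Prop) : ℕ → ℕ → Finset (ℕ → ℕ)
  | 0, c => if O c then {consSeq c 0} else ∅
  | j + 1, c => ((range N).filter (adj c)).biUnion fun d => (paths N adj O j d).image (consSeq c)

variable {N : ℕ} {adj : ℕ → ℕ → Prop} {O : ℕ → Prop}

lemma consSeq_injective (c : ℕ) : Function.Injective (consSeq c) := by
  intro v w h
  funext i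
  exact congrFun h (i + 1)

/-- The zero tail makes a finite word correspond to exactly one function, so that counting functions
counts words. -/
lemma mem_paths (hadj : ∀ c d, adj c d → d < N) {j c : ℕ} {w : ℕ → ℕ} :
    w ∈ paths N adj O j c ↔
      w 0 = c ∧ (∀ i < j, adj (w i) (w (i + 1))) ∧ O (w j) ∧ ∀ i > j, w i = 0 := by
  induction j generalizing c w with
  | zero =>
    simp only [paths]
    constructor
    · intro h
      split_ifs at h with hO
      · rw [mem_singleton] at h
        subst h
        refine ⟨rfl, by simp, hO, fun i hi => ?_⟩
        obtain ⟨i, rfl⟩ := Nat.exists_eq_succ_of_ne_zero hi.ne'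
        rfl
      · simp at h
    · rintro ⟨rfl, -, h1, h2⟩
      rw [if_pos h1, mem_singleton]
      funext i
      cases i with
      | zero => rfl
      | succ i => exact h2 _ (Nat.succ_pos i)
  | succ j ih =>
    simp only [paths, mem_biUnion, mem_filter, mem_range, mem_image, ih]
    constructor
    · rintro ⟨d, ⟨hd, hcd⟩, w', ⟨rfl, h1, h2, h3⟩, rfl⟩
      refine ⟨rfl, ?_, h2, ?_⟩
      · rintro (_ | i) hi
        · exact hcd
        · exact h1 i (by omega)
      · rintro (_ | i) hi
        · omega
        · exact h3 i (by omega)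
    · rintro ⟨rfl, h1, h2, h3⟩
      refine ⟨w 1, ⟨hadj _ _ (h1 0 (by omega)), h1 0 (by omega)⟩, fun i => w (i + 1),
        ⟨rfl, fun i hi => h1 (i + 1) (by omega), h2, fun i hi => h3 _ (by omega)⟩, ?_⟩
      funext i
      cases i <;> rfl

open scoped Classical in
lemma card_paths_succ (hadj : ∀ c d, adj c d → d < N) (j c : ℕ) :
    (paths N adj O (j + 1) c).card =
      ∑ d ∈ range N, if adj c d then (paths N adj O j d).card else 0 := by
  rw [paths, card_biUnion, sum_filter]
  · refine sum_congr rfl fun d _ => ?_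
    rw [card_image_of_injective _ (consSeq_injective c)]
  · intro d _ d' _ hne
    rw [Function.onFun, disjoint_left]
    intro w hw hw'
    obtain ⟨v, hv, rfl⟩ := mem_image.mp hw
    obtain ⟨v', hv', h⟩ := mem_image.mp hw'
    rw [consSeq_injective c h] at hv'
    exact hne (((mem_paths hadj).mp hv).1.symm.trans ((mem_paths hadj).mp hv').1)

open scoped Classical in
-- Duality: the left side pushes weights forward along the edges, while `paths` splits off the first
-- edge. The induction moves one application of the matrix from the vector to the functional.
lemma sum_iterate_stepVec (hadj : ∀ c d, adj c d → d < N) (j : ℕ) (v : ℕ → ℕ) :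
    (∑ d ∈ range N, if O d then (stepVec N adj)^[j] v d else 0) =
      ∑ c ∈ range N, v c * (paths N adj O j c).card := by
  induction j generalizing v with
  | zero =>
    refine sum_congr rfl fun d _ => ?_
    simp only [paths, Function.iterate_zero, id_eq]
    split_ifs <;> simp
  | succ j ih =>
    rw [Function.iterate_succ, Function.comp_apply]
    rw [ih]
    simp only [stepVec, card_paths_succ hadj, sum_mul, mul_sum]
    rw [sum_comm]
    refine sum_congr rfl fun c _ => sum_congr rfl fun d _ => ?_
    split_ifs <;> simp

end Counting

/-! ### Surjectivity as an equality of path counts -/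

section Surjectivity

variable (N : ℕ) (B : ℕ → Prop) (s t lab pred succ : ℕ → ℕ) (n : ℕ) (s' t' : ℕ → ℕ)

/-- Consecutive edges. -/
def Follows (B : ℕ → Prop) (s t : ℕ → ℕ) (c d : ℕ) : Prop := B c ∧ B d ∧ t c = s d

/-- `v` ends a left infinite path with the labels of the chosen path to `u`. -/
def LeftMate (u v : ℕ) : Prop :=
  SameLabel B lab u v ∧ PairPath (SameLabel B lab) id t pred s (pred u) (s v)

/-- `v` starts a right infinite path with the labels of the chosen path from `u`. -/
def RightMate (u v : ℕ) : Prop :=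
  SameLabel B lab u v ∧ PairPath (SameLabel B lab) id s succ t (succ u) (t v)

open scoped Classical in
/-- The number of paths from left mates to right mates with `j` steps, given the vector of the numbers
of paths by last edge. -/
noncomputable def mateCount (v : ℕ → ℕ) : ℕ :=
  ∑ u ∈ range N, ∑ d ∈ range N, if RightMate B s t lab succ u d then v d else 0

open scoped Classical in
/-- The number of left mates. -/
noncomputable def mateVec (d : ℕ) : ℕ :=
  ∑ u ∈ range N, ∑ v ∈ range N, if LeftMate B s t lab pred u v ∧ v = d then 1 else 0

open scoped Classical in
/-- The number of paths to labels, given the vector of the numbers of paths by last edge. -/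
noncomputable def labelCount (v : ℕ → ℕ) : ℕ :=
  ∑ u ∈ range N, ∑ d ∈ range N, if B u ∧ lab u = d then v d else 0

open scoped Classical in
/-- The numbers of edges with given labels. -/
noncomputable def labelVec (d : ℕ) : ℕ :=
  ∑ u ∈ range N, ∑ v ∈ range N, if (B u ∧ lab u = v) ∧ v = d then 1 else 0

open scoped Classical in
/-- Paths with `j` steps from a left mate of `u` to a right mate of `u'`. -/
noncomputable def matePaths (j u u' : ℕ) : Finset (ℕ → ℕ) :=
  ((range N).filter (LeftMate B s t lab pred u)).biUnion
    (paths N (Follows B s t) (RightMate B s t lab succ u') j)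

/-- Paths with `j` steps from the label of `u` to the label of `u'`. -/
noncomputable def labelPaths (j u u' : ℕ) : Finset (ℕ → ℕ) :=
  paths N (Follows (· < n) s' t') (· = lab u') j (lab u)

variable {N B s t lab pred succ n s' t'}

lemma mem_matePaths (hN : ∀ c, B c → c < N) {j u u' : ℕ} {w : ℕ → ℕ} :
    w ∈ matePaths N B s t lab pred succ j u u' ↔ LeftMate B s t lab pred u (w 0) ∧
      (∀ i < j, Follows B s t (w i) (w (i + 1))) ∧ RightMate B s t lab succ u' (w j) ∧
      ∀ i > j, w i = 0 := by
  simp only [matePaths, mem_biUnion, mem_filter, mem_range,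
    mem_paths (N := N) (adj := Follows B s t) (fun c d h => hN _ h.2.1)]
  constructor
  · rintro ⟨v, ⟨-, h1⟩, rfl, h2⟩
    exact ⟨h1, h2⟩
  · rintro ⟨h1, h2⟩
    exact ⟨w 0, ⟨hN _ h1.1.2.1, h1⟩, rfl, h2⟩

lemma mem_labelPaths (hn : n ≤ N) {j u u' : ℕ} {w : ℕ → ℕ} :
    w ∈ labelPaths N lab n s' t' j u u' ↔ w 0 = lab u ∧
      (∀ i < j, Follows (· < n) s' t' (w i) (w (i + 1))) ∧ w j = lab u' ∧ ∀ i > j, w i = 0 := by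
  rw [labelPaths, mem_paths (fun c d h => lt_of_lt_of_le h.2.1 hn)]

open scoped Classical in
-- By linearity one start vector handles all `u` and one final sum handles all `u'`. An edge enters
-- the start vector once for every `u` of which it is a left mate; for fixed `u` the paths from
-- different mates are disjoint by their first letters.
lemma mateCount_eq (hN : ∀ c, B c → c < N) (j : ℕ) :
    mateCount N B s t lab succ ((stepVec N (Follows B s t))^[j] (mateVec N B s t lab pred)) =
      ∑ u' ∈ range N, ∑ u ∈ range N, (matePaths N B s t lab pred succ j u u').card := by
  have hadj : ∀ c d, Follows B s t c d → d < N := fun c d h => hN _ h.2.1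
  rw [mateCount]
  refine sum_congr rfl fun u' _ => ?_
  rw [sum_iterate_stepVec hadj]
  simp only [mateVec, sum_mul]
  rw [sum_comm]
  refine sum_congr rfl fun u _ => ?_
  rw [matePaths, card_biUnion, sum_filter, sum_comm]
  · refine sum_congr rfl fun v hv => ?_
    rw [sum_eq_single v]
    · simp
    · intro d _ hd
      simp [hd.symm]
    · simp [hv]
  · intro d _ d' _ hne
    rw [Function.onFun, disjoint_left]
    intro w hw hw'
    exact hne (((mem_paths hadj).mp hw).1.symm.trans ((mem_paths hadj).mp hw').1)

open scoped Classical in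
-- The multiplicities match those in `mateCount_eq`: a word is counted once for every pair of edges
-- in `B` that carry its first and its last letter.
lemma labelCount_eq (hn : n ≤ N) (hlab : ∀ c, B c → lab c < n) (j : ℕ) :
    labelCount N B lab ((stepVec N (Follows (· < n) s' t'))^[j] (labelVec N B lab)) =
      ∑ u' ∈ range N, ∑ u ∈ range N,
        if B u ∧ B u' then (labelPaths N lab n s' t' j u u').card else 0 := by
  have hadj : ∀ c d, Follows (· < n) s' t' c d → d < N := fun c d h => h.2.1.trans_le hn
  rw [labelCount]
  refine sum_congr rfl fun u' _ => ?_
  by_cases hu' : B u'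
  · simp only [hu', true_and, and_true]
    refine Eq.trans (Eq.trans (sum_congr rfl fun d _ => ?_)
      (sum_iterate_stepVec (O := (· = lab u')) hadj j (labelVec N B lab))) ?_
    · simp only [eq_comm (a := lab u')]; congr
    simp only [labelVec, sum_mul]
    rw [sum_comm]
    refine sum_congr rfl fun u _ => ?_
    split_ifs with hu
    · have hl := (hlab u hu).trans_le hn
      rw [sum_eq_single (lab u)]
      · rw [sum_eq_single (lab u)]
        · simp [hu, labelPaths]
        · intro v _ hv
          simp [hv]
        · simp [hl]
      · intro d _ hd
        rw [sum_eq_zero]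
        intro v _
        rw [if_neg, zero_mul]
        rintro ⟨⟨-, rfl⟩, h⟩
        exact hd h.symm
      · simp [hl]
    · simp [hu]
  · simp [hu']

/-- Continue a word by a right infinite path that starts with its last letter. -/
def extend (j : ℕ) (w r : ℕ → ℕ) (i : ℕ) : ℕ := if i ≤ j then w i else r (i - j)

lemma extend_of_le {j : ℕ} {w r : ℕ → ℕ} {i : ℕ} (h : i ≤ j) : extend j w r i = w i := if_pos h

lemma extend_add {j : ℕ} {w r : ℕ → ℕ} (h0 : r 0 = w j) (i : ℕ) : extend j w r (j + i) = r i := by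
  rw [extend]
  split_ifs with h
  · obtain rfl : i = 0 := by omega
    simp [h0]
  · congr 1; omega

lemma extend_walk {B : ℕ → Prop} {s t : ℕ → ℕ} {j : ℕ} {w r : ℕ → ℕ} (h0 : r 0 = w j)
    (hw : ∀ i < j, Follows B s t (w i) (w (i + 1)))
    (hr : ∀ i, B (r i) ∧ t (r i) = s (r (i + 1))) (i : ℕ) :
    B (extend j w r i) ∧ t (extend j w r i) = s (extend j w r (i + 1)) := by
  rcases lt_or_ge i j with h | h
  · rw [extend_of_le h.le, extend_of_le h]
    exact ⟨(hw i h).1, (hw i h).2.2⟩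
  · obtain ⟨i, rfl⟩ := Nat.exists_eq_add_of_le h
    rw [add_assoc, extend_add h0, extend_add h0]
    exact hr i

/-- In the pair graphs for mates the first coordinate is an edge whose only continuation is the
chosen neighbour, so the first path is forced to be the chosen ray. -/
lemma iterate_of_step {f c : ℕ → ℕ} {u : ℕ} (h0 : c 0 = f u) (h : ∀ i, f (c i) = c (i + 1))
    (i : ℕ) : c i = f^[i + 1] u := by
  induction i with
  | zero => exact h0
  | succ i ih => rw [Function.iterate_succ_apply', ← ih, h]

lemma LeftMate.exists_path {u v : ℕ} (h : LeftMate B s t lab pred u v) : ∃ p : ℕ → ℕ,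
    t (p 0) = s v ∧ ∀ i, B (p i) ∧ t (p (i + 1)) = s (p i) ∧ lab (p i) = lab (pred^[i + 1] u) := by
  obtain ⟨-, c, d, h0, h0', hcd⟩ := h
  have hc := iterate_of_step h0 fun i => (hcd i).2.1
  exact ⟨d, h0', fun i => ⟨(hcd i).1.2.1, (hcd i).2.2.symm, by rw [← hc, (hcd i).1.2.2]⟩⟩

lemma RightMate.exists_path {u v : ℕ} (h : RightMate B s t lab succ u v) : ∃ r : ℕ → ℕ,
    r 0 = v ∧ ∀ i, B (r i) ∧ t (r i) = s (r (i + 1)) ∧ lab (r i) = lab (succ^[i] u) := by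
  obtain ⟨h, c, d, h0, h0', hcd⟩ := h
  have hc := iterate_of_step h0 fun i => (hcd i).2.1
  refine ⟨consSeq v d, rfl, ?_⟩
  rintro (_ | i)
  · exact ⟨h.2.1, h0'.symm, h.2.2.symm⟩
  · exact ⟨(hcd i).1.2.1, (hcd i).2.2, by rw [← hc, (hcd i).1.2.2]; rfl⟩

/-- A path between mates is a segment of a walk whose labels are prescribed elsewhere. -/
lemma exists_walk_of_mem_matePaths (hN : ∀ c, B c → c < N) {j u u' : ℕ} {w : ℕ → ℕ}
    (h : w ∈ matePaths N B s t lab pred succ j u u') : ∃ x ∈ walks B s t,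
      (∀ i : ℕ, i ≤ j → x i = w i) ∧
      lab ∘ x = glue (fun i => lab (pred^[i + 1] u))
        (extend j (lab ∘ w) fun i => lab (succ^[i] u')) := by
  rw [mem_matePaths hN] at h
  obtain ⟨hl, hw, hr, -⟩ := h
  obtain ⟨p, hp0, hp⟩ := hl.exists_path
  obtain ⟨r, hr0, hr⟩ := hr.exists_path
  refine ⟨glue p (extend j w r), glue_mem_walks (fun i => ⟨(hp i).1, (hp i).2.1⟩)
    (extend_walk hr0 hw fun i => ⟨(hr i).1, (hr i).2.1⟩) ?_, fun i hi => extend_of_le hi, ?_⟩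
  · rw [extend_of_le (Nat.zero_le j), hp0]
  · rw [comp_glue]
    congr 1
    · exact funext fun i => (hp i).2.2
    · funext i
      simp only [extend, Function.comp_apply]
      split_ifs
      · rfl
      · exact (hr _).2.2

/-- A segment of a walk is a path between mates, if the labels elsewhere are the prescribed
ones. -/
lemma mem_matePaths_of_walk (hN : ∀ c, B c → c < N) (hB : HasRays B s t pred succ) {j u u' : ℕ}
    {f : ℕ → ℕ} (hu : B u) (hu' : B u') (hf0 : f 0 = lab u) (hfj : f j = lab u')
    {x : ℤ → ℕ} (hx : x ∈ walks B s t)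
    (h : lab ∘ x = glue (fun i => lab (pred^[i + 1] u)) (extend j f fun i => lab (succ^[i] u'))) :
    (fun i => if i ≤ j then x (i : ℕ) else 0) ∈ matePaths N B s t lab pred succ j u u' := by
  rw [mem_matePaths hN]
  have hnat : ∀ i : ℕ, lab (x i) = extend j f (fun i => lab (succ^[i] u')) i := fun i =>
    congrFun h i
  have hneg : ∀ i : ℕ, lab (x (Int.negSucc i)) = lab (pred^[i + 1] u) := fun i =>
    congrFun h (Int.negSucc i)
  have hright : ∀ i : ℕ, lab (x ((j + i : ℕ) : ℤ)) = lab (succ^[i] u') := fun i => by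
    rw [hnat, extend_add hfj.symm]
  simp only [le_refl, Nat.zero_le, if_true]
  refine ⟨⟨⟨hu, (hx _).1, ?_⟩, fun i => pred^[i + 1] u, fun i => x (Int.negSucc i), rfl,
    (hx (Int.negSucc 0)).2, fun i => ⟨⟨(hB.left hu _).1, (hx _).1, (hneg i).symm⟩, ?_,
    ((hx (Int.negSucc (i + 1))).2).symm⟩⟩, ?_,
    ⟨⟨hu', (hx _).1, ?_⟩, fun i => succ^[i + 1] u', fun i => x ((j + (i + 1) : ℕ) : ℤ), rfl, ?_,
      fun i => ⟨⟨(hB.right hu' _).1, (hx _).1, (hright _).symm⟩, ?_, ?_⟩⟩, ?_⟩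
  · have := hnat 0
    rw [extend_of_le (Nat.zero_le j), hf0] at this
    simpa using this.symm
  · rw [id, ← Function.iterate_succ_apply' pred]
  · intro i hi
    simp only [hi.le, if_true, Nat.succ_le_of_lt hi]
    exact ⟨(hx _).1, (hx _).1, by have := (hx i).2; push_cast; exact this⟩
  · have := hright 0
    simpa using this.symm
  · have := (hx (j : ℕ)).2
    simpa using this.symm
  · rw [id, ← Function.iterate_succ_apply' succ]
  · have := (hx ((j + (i + 1) : ℕ) : ℤ)).2
    rw [this]
    congr 2
  · intro i hi
    rw [if_neg (by omega)]

lemma labelWord_mem (hN : ∀ c, B c → c < N) (hn : n ≤ N)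
    (hmap : Set.MapsTo (lab ∘ ·) (walks B s t) (walks (· < n) s' t')) {j u u' : ℕ} {w : ℕ → ℕ}
    (h : w ∈ matePaths N B s t lab pred succ j u u') :
    (fun i => if i ≤ j then lab (w i) else 0) ∈ labelPaths N lab n s' t' j u u' := by
  obtain ⟨x, hx, hxw, -⟩ := exists_walk_of_mem_matePaths hN h
  rw [mem_matePaths hN] at h
  rw [mem_labelPaths hn]
  refine ⟨by simpa using h.1.1.2.2.symm, fun i hi => ?_, by simpa using h.2.2.1.1.2.2.symm,
    fun i hi => if_neg (by omega)⟩
  simp only [hi.le, if_true, Nat.succ_le_of_lt hi]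
  rw [← hxw i hi.le, ← hxw (i + 1) hi]
  refine ⟨(hmap hx i).1, (hmap hx _).1, ?_⟩
  have := (hmap hx i).2
  push_cast
  exact this

/-- This is what the fixed rays are for: two mate paths with the same label word extend to walks
whose labels agree everywhere, since the outer labels depend only on `u` and `u'`. Injectivity on
walks then identifies them. -/
lemma labelWord_injOn (hN : ∀ c, B c → c < N) (hinj : Set.InjOn (lab ∘ ·) (walks B s t))
    (j u u' : ℕ) : Set.InjOn (fun (w : ℕ → ℕ) i => if i ≤ j then lab (w i) else 0)
      (matePaths N B s t lab pred succ j u u') := by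
  intro w hw w' hw' heq
  obtain ⟨x, hx, hxw, hl⟩ := exists_walk_of_mem_matePaths hN hw
  obtain ⟨x', hx', hxw', hl'⟩ := exists_walk_of_mem_matePaths hN hw'
  have hxx : x = x' := by
    refine hinj hx hx' (hl.trans (Eq.trans ?_ hl'.symm))
    congr 1
    funext i
    simp only [extend, Function.comp_apply]
    split_ifs with hi
    · have := congrFun heq i
      simpa [hi] using this
    · rfl
  funext i
  rcases le_or_gt i j with hi | hi
  · rw [← hxw i hi, ← hxw' i hi, hxx]
  · rw [((mem_matePaths hN).mp hw).2.2.2 i hi, ((mem_matePaths hN).mp hw').2.2.2 i hi]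

open scoped Classical in
lemma card_matePaths_le (hN : ∀ c, B c → c < N) (hn : n ≤ N)
    (hmap : Set.MapsTo (lab ∘ ·) (walks B s t) (walks (· < n) s' t'))
    (hinj : Set.InjOn (lab ∘ ·) (walks B s t)) (j u u' : ℕ) :
    (matePaths N B s t lab pred succ j u u').card ≤
      if B u ∧ B u' then (labelPaths N lab n s' t' j u u').card else 0 := by
  split_ifs with h
  · exact card_le_card_of_injOn _ (fun w hw => labelWord_mem hN hn hmap hw)
      (labelWord_injOn hN hinj j u u')
  · rw [Nat.le_zero, card_eq_zero, eq_empty_iff_forall_notMem]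
    intro w hw
    rw [mem_matePaths hN] at hw
    exact h ⟨hw.1.1.1, hw.2.2.1.1.1⟩

/-- If the map is onto, a label path continued by the labels of the rays has a preimage, whose
middle segment is a mate path. Conversely, equal counts make every label path the label word of a
mate path; so every window of a point of the target is the label word of a segment of a walk, and
compactness concludes. -/
theorem surjOn_walks_iff (hN : ∀ c, B c → c < N) (hn : n ≤ N) (hB : HasRays B s t pred succ)
    (hlab : ∀ c, B c → lab c < n)
    (hmap : Set.MapsTo (lab ∘ ·) (walks B s t) (walks (· < n) s' t'))
    (hinj : Set.InjOn (lab ∘ ·) (walks B s t)) :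
    Set.SurjOn (lab ∘ ·) (walks B s t) (walks (· < n) s' t') ↔
      (∀ y ∈ walks (· < n) s' t', ∃ u, B u ∧ lab u = y 0) ∧
      ∀ j, mateCount N B s t lab succ
          ((stepVec N (Follows B s t))^[j] (mateVec N B s t lab pred)) =
        labelCount N B lab ((stepVec N (Follows (· < n) s' t'))^[j] (labelVec N B lab)) := by
  classical
  have hle := card_matePaths_le (pred := pred) (succ := succ) hN hn hmap hinj
  simp only [mateCount_eq hN, labelCount_eq hn hlab]
  constructor
  · intro hs
    refine ⟨fun y hy => ?_, fun j => sum_congr rfl fun u' _ => sum_congr rfl fun u _ =>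
      (hle j u u').antisymm ?_⟩
    · obtain ⟨x, hx, rfl⟩ := hs hy
      exact ⟨x 0, (hx 0).1, rfl⟩
    split_ifs with h
    · obtain ⟨hu, hu'⟩ := h
      refine card_le_card_of_surjOn (fun (w : ℕ → ℕ) i => if i ≤ j then lab (w i) else 0) ?_
      intro f hf
      rw [mem_coe, mem_labelPaths hn] at hf
      obtain ⟨hf0, hf, hfj, hfz⟩ := hf
      -- The images of the walks along the chosen rays of `u` and `u'` show that the labels of these
      -- rays are walks in the target graph.
      have hux := hmap (glue_mem_walks (p := fun i => pred^[i + 1] u) (q := fun i => succ^[i] u)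
        (fun i => ⟨(hB.left hu _).1, (hB.left hu _).2⟩) (hB.right hu) (hB.left hu 0).2)
      have hux' := hmap (glue_mem_walks (p := fun i => pred^[i + 1] u')
        (q := fun i => succ^[i] u')
        (fun i => ⟨(hB.left hu' _).1, (hB.left hu' _).2⟩) (hB.right hu') (hB.left hu' 0).2)
      have hy : glue (fun i => lab (pred^[i + 1] u)) (extend j f fun i => lab (succ^[i] u')) ∈
          walks (· < n) s' t' := by
        refine glue_mem_walks (fun i => ⟨(hux (Int.negSucc i)).1, (hux (Int.negSucc (i + 1))).2⟩)
          (extend_walk hfj.symm hf fun i => ?_) ?_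
        · have := hux' i
          exact this
        · rw [extend_of_le (Nat.zero_le j), hf0]
          exact (hux (Int.negSucc 0)).2
      obtain ⟨x, hx, hxy⟩ := hs hy
      refine ⟨_, mem_matePaths_of_walk hN hB hu hu' hf0 hfj hx hxy, ?_⟩
      funext i
      rcases le_or_gt i j with hi | hi
      · have := congrFun hxy i
        simp only [Function.comp_apply, glue_natCast, extend_of_le hi] at this
        simp [hi, this]
      · simp [hi.not_ge, hfz i hi]
    · exact Nat.zero_le _
  · rintro ⟨h1, h2⟩ y hy
    refine exists_walk_of_segments hN lab y fun r => ?_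
    -- The letters at both ends of the window from `-r` to `r` are labels, so the window is a label
    -- path with `2 * r` steps, indexed from its left end.
    obtain ⟨u, hu, hu0⟩ := h1 _ (shift_mem_walks hy (-r))
    obtain ⟨u', hu', hu0'⟩ := h1 _ (shift_mem_walks hy r)
    set f : ℕ → ℕ := fun i => if i ≤ 2 * r then y (-r + i) else 0 with hf
    have hmem : f ∈ labelPaths N lab n s' t' (2 * r) u u' := by
      rw [mem_labelPaths hn]
      refine ⟨by simp [hf, hu0], fun i hi => ?_, ?_, fun i hi => by simp [hf, hi.not_ge]⟩
      · simp only [hf, hi.le, if_true, Nat.succ_le_of_lt hi]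
        have h3 := hy (-r + i)
        have h4 := hy (-r + (i + 1 : ℕ))
        refine ⟨h3.1, h4.1, ?_⟩
        rw [h3.2]
        push_cast
        rw [add_assoc]
      · simp only [hf, le_refl, if_true, hu0']
        congr 1
        push_cast
        ring
    have heq : (matePaths N B s t lab pred succ (2 * r) u u').card =
        (labelPaths N lab n s' t' (2 * r) u u').card := by
      -- Termwise inequalities with equal sums are equalities, first over `u'`, then over `u`.
      have h3 := (sum_eq_sum_iff_of_le fun u' _ => sum_le_sum fun u _ => hle (2 * r) u u').mp
        (h2 (2 * r)) u' (mem_range.mpr (hN _ hu'))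
      have h4 := (sum_eq_sum_iff_of_le fun u _ => hle (2 * r) u u').mp h3 u
        (mem_range.mpr (hN _ hu))
      simpa [hu, hu'] using h4
    -- An injection between finite sets of equal size is onto, so the window is the label word of a
    -- mate path.
    obtain ⟨w, hw, hwf⟩ := surjOn_of_injOn_of_card_le _
      (fun w hw => labelWord_mem hN hn hmap hw) (labelWord_injOn hN hinj (2 * r) u u') heq.ge hmem
    obtain ⟨x, hx, hxw, -⟩ := exists_walk_of_mem_matePaths hN hw
    refine ⟨_, shift_mem_walks hx r, fun i hi => ?_⟩
    rw [abs_le] at hi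
    obtain ⟨a, ha⟩ : ∃ a : ℕ, i + r = a := ⟨(i + r).toNat, by omega⟩
    have ha' : a ≤ 2 * r := by omega
    have h5 := congrFun hwf a
    simp only [hf, ha', if_true] at h5
    change lab (x (i + r)) = y i
    rw [ha, hxw a ha', h5]
    congr 1
    omega

end Surjectivity

/-! ### Finitely many lengths suffice -/

section Recurrence

/-- By Cayley-Hamilton every power of `T` is a combination of the powers with exponent below the
dimension. -/
lemma forall_pow_eq_zero {V : Type*} [AddCommGroup V] [Module ℚ V] [Module.Finite ℚ V]
    (T : V →ₗ[ℚ] V) (φ : V →ₗ[ℚ] ℚ) (z : V)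
    (h : ∀ j < Module.finrank ℚ V, φ ((T ^ j) z) = 0) (j : ℕ) : φ ((T ^ j) z) = 0 := by
  nontriviality V
  have hpos : 0 < Module.finrank ℚ V := Module.finrank_pos
  rw [LinearMap.pow_eq_aeval_mod_charpoly, Polynomial.aeval_eq_sum_range' (n := Module.finrank ℚ V)]
  · rw [LinearMap.sum_apply, map_sum]
    refine sum_eq_zero fun i hi => ?_
    rw [LinearMap.smul_apply, map_smul, h i (mem_range.mp hi), smul_zero]
  · have h1 := T.charpoly_monic
    -- The remainder has smaller degree only modulo a nonconstant polynomial; this uses positive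
    -- dimension.
    have h2 : T.charpoly ≠ 1 := by
      intro h2
      have := T.charpoly_natDegree
      rw [h2, Polynomial.natDegree_one] at this
      omega
    simpa [LinearMap.charpoly_natDegree] using Polynomial.natDegree_modByMonic_lt (Polynomial.X ^ j) h1 h2

open scoped Classical in
/-- Two sequences of path counts that agree at the beginning agree everywhere. -/
lemma sum_iterate_stepVec_eq {N : ℕ} {adj₁ adj₂ : ℕ → ℕ → Prop} {a₁ a₂ v₁ v₂ : ℕ → ℕ}
    (h : ∀ j < N + N, ∑ d ∈ range N, a₁ d * (stepVec N adj₁)^[j] v₁ d =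
      ∑ d ∈ range N, a₂ d * (stepVec N adj₂)^[j] v₂ d) (j : ℕ) :
    ∑ d ∈ range N, a₁ d * (stepVec N adj₁)^[j] v₁ d =
      ∑ d ∈ range N, a₂ d * (stepVec N adj₂)^[j] v₂ d := by
  set M : (ℕ → ℕ → Prop) → Matrix (Fin N) (Fin N) ℚ := fun adj =>
    Matrix.of fun d c => if adj c d then 1 else 0 with hM
  set emb : (ℕ → ℕ) → Fin N → ℚ := fun v d => v d with hemb
  have hstep : ∀ adj v, emb (stepVec N adj v) = (M adj).mulVecLin (emb v) := by
    intro adj v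
    funext d
    simp only [hemb, stepVec, hM, Matrix.mulVecLin_apply, Matrix.mulVec, dotProduct,
      Matrix.of_apply, ite_mul, one_mul, zero_mul]
    rw [← Fin.sum_univ_eq_sum_range (fun c => if adj c d then v c else 0)]
    push_cast
    rfl
  -- Both matrices act together on a space of dimension `N + N`, and the difference of the two
  -- counts is one linear functional on it.
  set T := (M adj₁).mulVecLin.prodMap (M adj₂).mulVecLin with hT
  have hTpow : ∀ j, (T ^ j) (emb v₁, emb v₂) =
      (emb ((stepVec N adj₁)^[j] v₁), emb ((stepVec N adj₂)^[j] v₂)) := by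
    intro j
    induction j with
    | zero => rfl
    | succ j ih =>
      rw [pow_succ', Module.End.mul_apply, ih, Function.iterate_succ_apply',
        Function.iterate_succ_apply', hstep, hstep]
      rfl
  set φ : (Fin N → ℚ) × (Fin N → ℚ) →ₗ[ℚ] ℚ :=
    (∑ d : Fin N, (a₁ d : ℚ) • (LinearMap.proj d : (Fin N → ℚ) →ₗ[ℚ] ℚ)).comp
        (LinearMap.fst ℚ _ _) -
      (∑ d : Fin N, (a₂ d : ℚ) • (LinearMap.proj d : (Fin N → ℚ) →ₗ[ℚ] ℚ)).comp
        (LinearMap.snd ℚ _ _) with hφ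
  have key : ∀ j, φ ((T ^ j) (emb v₁, emb v₂)) = 0 ↔
      ∑ d ∈ range N, a₁ d * (stepVec N adj₁)^[j] v₁ d =
        ∑ d ∈ range N, a₂ d * (stepVec N adj₂)^[j] v₂ d := by
    intro j
    rw [hTpow, ← Nat.cast_inj (R := ℚ)]
    simp only [hφ, hemb, LinearMap.sub_apply, LinearMap.comp_apply, LinearMap.fst_apply,
      LinearMap.snd_apply, LinearMap.sum_apply, LinearMap.smul_apply, LinearMap.proj_apply,
      smul_eq_mul, sub_eq_zero, Nat.cast_sum, Nat.cast_mul, Finset.sum_range]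
  rw [← key]
  refine forall_pow_eq_zero T φ _ (fun i hi => (key i).mpr (h i ?_)) j
  simpa using hi

variable {N : ℕ} {B : ℕ → Prop} {s t lab pred succ : ℕ → ℕ} {n : ℕ} {s' t' : ℕ → ℕ}

/-- Both counts are fixed linear functionals of the current vector, whose coefficients are the
numbers of edges `u` that a final edge or letter serves. -/
lemma forall_mateCount_iff :
    (∀ j, mateCount N B s t lab succ
          ((stepVec N (Follows B s t))^[j] (mateVec N B s t lab pred)) =
        labelCount N B lab ((stepVec N (Follows (· < n) s' t'))^[j] (labelVec N B lab))) ↔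
      ∀ j < N + N, mateCount N B s t lab succ
          ((stepVec N (Follows B s t))^[j] (mateVec N B s t lab pred)) =
        labelCount N B lab ((stepVec N (Follows (· < n) s' t'))^[j] (labelVec N B lab)) := by
  classical
  refine ⟨fun h j _ => h j, ?_⟩
  have h1 : ∀ v, mateCount N B s t lab succ v =
      ∑ d ∈ range N, (∑ u ∈ range N, if RightMate B s t lab succ u d then 1 else 0) * v d := by
    intro v
    rw [mateCount, sum_comm]
    refine sum_congr rfl fun d _ => ?_
    rw [sum_mul]
    refine sum_congr rfl fun u _ => ?_
    split_ifs <;> simp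
  have h2 : ∀ v, labelCount N B lab v =
      ∑ d ∈ range N, (∑ u ∈ range N, if B u ∧ lab u = d then 1 else 0) * v d := by
    intro v
    rw [labelCount, sum_comm]
    refine sum_congr rfl fun d _ => ?_
    rw [sum_mul]
    refine sum_congr rfl fun u _ => ?_
    split_ifs <;> simp
  simp only [h1, h2]
  exact sum_iterate_stepVec_eq

end Recurrence

/-! ### The complete criterion for bijectivity -/

section Criterion

variable {N : ℕ} {ok : ℕ → Prop} {s t lab pred succ : ℕ → ℕ} {n : ℕ} {s' t' : ℕ → ℕ}

open LoopLang in
lemma exists_mem_walks_iff {f : ℕ} : (∃ y ∈ walks (· < n) s' t', y 0 = f) ↔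
    f < n ∧ HasInfPath (Follows (· < n) s' t') f ∧
      HasInfPath (fun c d => Follows (· < n) s' t' d c) f := by
  constructor
  · rintro ⟨y, hy, rfl⟩
    refine ⟨(hy 0).1, ⟨fun i => y i, rfl, fun i => ⟨(hy _).1, (hy _).1, ?_⟩⟩,
      ⟨fun i => y (-i), by simp, fun i => ⟨(hy _).1, (hy _).1, ?_⟩⟩⟩
    · have := (hy i).2
      push_cast
      exact this
    · rw [(hy _).2]
      congr 2
      push_cast
      ring
  · rintro ⟨-, ⟨q, rfl, hq⟩, ⟨p, hp0, hp⟩⟩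
    exact ⟨glue (fun i => p (i + 1)) q, glue_mem_walks
      (fun i => ⟨(hp i).1, (hp (i + 1)).2.2⟩) (fun i => ⟨(hq i).1, (hq i).2.2⟩)
      (by rw [(hp 0).2.2, hp0]), rfl⟩

open LoopLang in
/-- The criterion that the program checks. -/
theorem bijOn_walks_iff (hN : ∀ c, ok c → c < N) (hn : n ≤ N)
    (hB : HasRays (Essential ok s t lab) s t pred succ) (hlab : ∀ c, ok c → lab c < n) :
    Set.BijOn (lab ∘ ·) (walks ok s t) (walks (· < n) s' t') ↔
      (¬ ∃ c d, c ≠ d ∧ Essential ok s t lab c ∧ Essential ok s t lab d ∧ lab c = lab d ∧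
        PastPair ok s t lab (s c) (s d) ∧ FuturePair ok s t lab (t c) (t d)) ∧
      (¬ ∃ c d, Essential ok s t lab c ∧ Essential ok s t lab d ∧ t c = s d ∧
        t' (lab c) ≠ s' (lab d)) ∧
      (¬ ∃ f < n, HasInfPath (Follows (· < n) s' t') f ∧
        HasInfPath (fun c d => Follows (· < n) s' t' d c) f ∧
        ¬ ∃ u, Essential ok s t lab u ∧ lab u = f) ∧
      ∀ j < N + N, mateCount N (Essential ok s t lab) s t lab succ
          ((stepVec N (Follows (Essential ok s t lab) s t))^[j]
            (mateVec N (Essential ok s t lab) s t lab pred)) =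
        labelCount N (Essential ok s t lab) lab
          ((stepVec N (Follows (· < n) s' t'))^[j] (labelVec N (Essential ok s t lab) lab)) := by
  have hlab' : ∀ c, Essential ok s t lab c → lab c < n := fun c hc => hlab c hc.1
  have hN' : ∀ c, Essential ok s t lab c → c < N := fun c hc => hN c hc.1
  rw [← injOn_walks_iff, ← mapsTo_walks_iff hB hlab', walks_essential, ← forall_mateCount_iff]
  have hhit : (¬ ∃ f < n, HasInfPath (Follows (· < n) s' t') f ∧
        HasInfPath (fun c d => Follows (· < n) s' t' d c) f ∧
        ¬ ∃ u, Essential ok s t lab u ∧ lab u = f) ↔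
      ∀ y ∈ walks (· < n) s' t', ∃ u, Essential ok s t lab u ∧ lab u = y 0 := by
    constructor
    · intro h y hy
      by_contra hu
      obtain ⟨h1, h2, h3⟩ := exists_mem_walks_iff.mp ⟨y, hy, rfl⟩
      exact h ⟨y 0, h1, h2, h3, hu⟩
    · rintro h ⟨f, h1, h2, h3, h4⟩
      obtain ⟨y, hy, rfl⟩ := exists_mem_walks_iff.mpr ⟨h1, h2, h3⟩
      exact h4 (h y hy)
  rw [hhit]
  constructor
  · rintro ⟨hm, hi, hs⟩
    refine ⟨hi, hm, ?_⟩
    -- The surjectivity criterion needs rays at every edge, so it is applied to the essential edges,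
    -- which carry the same walks.
    rw [← walks_essential (lab := lab)] at hm hi hs
    exact (surjOn_walks_iff hN' hn hB hlab' hm hi).mp hs
  · rintro ⟨hi, hm, hs⟩
    refine ⟨hm, hi, ?_⟩
    rw [← walks_essential (lab := lab)] at hm hi ⊢
    exact (surjOn_walks_iff hN' hn hB hlab' hm hi).mpr hs

end Criterion

/-! ### Existence tests and pair graphs in the loop language -/

namespace LoopLang

namespace Cmd

/-- Run commands one after the other. -/
def block : List Cmd → Cmd
  | [] => skip
  | P :: Ps => seq P (block Ps)

@[simp] lemma run_block_nil (I : List ℕ) (s : St) : (block []).run I s = s := rfl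
@[simp] lemma run_block_cons (I : List ℕ) (P : Cmd) (Ps : List Cmd) (s : St) :
    (block (P :: Ps)).run I s = (block Ps).run I (P.run I s) := rfl

/-- `A[x] := ∑ f` over all `c, d < pw` that pass the test and have `e = x`. -/
def total (A : Arr) (test e f : Expr) : Cmd :=
  seq (fill .pw A (.lit 0)) (accum .pw .pw A test e f)

lemma run_total (I : List ℕ) (A : Arr) (test e f : Expr) (s : St) (ht : test.reads A = false)
    (he : e.reads A = false) (hf : f.reads A = false) {x : ℕ} (hx : x < s.v .pw) :
    ((total A test e f).run I s).a A x = ∑ i ∈ range (s.v .pw), ∑ j ∈ range (s.v .pw),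
      if test.eval I (s.at₂ i j) ≠ 0 ∧ e.eval I (s.at₂ i j) = x then
        f.eval I (s.at₂ i j) else 0 := by
  set s₁ := (fill .pw A (.lit 0)).run I s with hs₁
  have h1v : ∀ x, x ≠ .c → s₁.v x = s.v x := fun x hc =>
    run_v I _ _ (by simp [fill, writesV, hc.symm])
  have h1a : ∀ A', A' ≠ A → s₁.a A' = s.a A' := fun A' hA =>
    run_a I _ _ (by simp [fill, writesA, hA.symm])
  have hev : ∀ g : Expr, g.reads A = false → ∀ i j,
      g.eval I (s₁.at₂ i j) = g.eval I (s.at₂ i j) := by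
    intro g hg i j
    refine g.eval_congr I (fun x _ => ?_) (fun A' hA => h1a A' ?_)
    · by_cases hc : x = .c
      · subst hc; simp
      by_cases hd : x = .d
      · subst hd; simp
      rw [St.at₂_v _ _ _ hc hd, St.at₂_v _ _ _ hc hd, h1v x hc]
    · rintro rfl; simp [hg] at hA
  simp only [total, run]
  rw [← hs₁, run_accum I _ _ _ _ _ _ _ (by decide) ht he hf, h1v _ (by decide), hs₁,
    run_fill I _ _ _ _ rfl, if_pos hx, ← hs₁, Expr.eval_lit, zero_add]
  simp only [hev _ ht, hev _ he, hev _ hf]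

lemma run_tally (I : List ℕ) (A : Arr) (test : Expr) (s : St) (ht : test.reads A = false)
    (hpos : 0 < s.v .pw) : ((total A test (.lit 0) (.lit 1)).run I s).a A 0 = 0 ↔
      ¬ ∃ i < s.v .pw, ∃ j < s.v .pw, test.eval I (s.at₂ i j) ≠ 0 := by
  rw [run_total I _ _ _ _ _ ht rfl rfl hpos]
  simp

/-- The code of a pair. -/
def pairE (e f : Expr) : Expr := .add (.arr .mulP e) f

/-- Pair codes are formed with the table `mulP`, which is correct only below `pw`; hence the bounds
on the ends of related edges in `hK`. -/
lemma run_prune_pair (I : List ℕ) (R : Arr) (test : Expr) (X Y X' Y' : Expr) (s : St)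
    {K : ℕ → ℕ → Prop} {fX fY fX' fY' : ℕ → ℕ} (hR : R ≠ .tmp)
    (ht : test.reads R = false ∧ test.reads .tmp = false ∧ test.readsV .r = false)
    (he : (pairE X Y).reads R = false ∧ (pairE X Y).reads .tmp = false ∧
      (pairE X Y).readsV .r = false)
    (hf : (pairE X' Y').reads R = false ∧ (pairE X' Y').reads .tmp = false ∧
      (pairE X' Y').readsV .r = false)
    (hsq : s.v .sq = s.v .pw * s.v .pw) (hmul : ∀ a < s.v .pw, s.a .mulP a = a * s.v .pw)
    (htest : ∀ i < s.v .pw, ∀ j < s.v .pw, test.eval I (s.at₂ i j) ≠ 0 ↔ K i j)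
    (hK : ∀ i j, K i j → (i < s.v .pw ∧ j < s.v .pw) ∧ (fX i < s.v .pw ∧ fY j < s.v .pw) ∧
      fX' i < s.v .pw ∧ fY' j < s.v .pw)
    (hX : ∀ i j, X.eval I (s.at₂ i j) = fX i) (hY : ∀ i j, Y.eval I (s.at₂ i j) = fY j)
    (hX' : ∀ i j, X'.eval I (s.at₂ i j) = fX' i) (hY' : ∀ i j, Y'.eval I (s.at₂ i j) = fY' j)
    {a b : ℕ} (ha : a < s.v .pw) (hb : b < s.v .pw) :
    ((prune R test (pairE X Y) (pairE X' Y')).run I s).a R (a * s.v .pw + b) ≠ 0 ↔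
      PairPath K fX fY fX' fY' a b := by
  have hcode : ∀ a < s.v .pw, ∀ b < s.v .pw, a * s.v .pw + b < s.v .sq := by
    intro a ha b hb
    rw [hsq]
    nlinarith
  have hstep : ∀ x y, Step I s test (pairE X Y) (pairE X' Y') x y ↔ ∃ i j, K i j ∧
      fX i * s.v .pw + fY j = x ∧ fX' i * s.v .pw + fY' j = y := by
    intro x y
    constructor
    · rintro ⟨i, hi, j, hj, h, h1, h2⟩
      rw [htest i hi j hj] at h
      refine ⟨i, j, h, ?_, ?_⟩
      · rw [← h1, pairE, Expr.eval_add, Expr.eval_arr, hX, hY, St.at₂_a, hmul _ (hK i j h).2.1.1]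
      · rw [← h2, pairE, Expr.eval_add, Expr.eval_arr, hX', hY', St.at₂_a, hmul _ (hK i j h).2.2.1]
    · rintro ⟨i, j, h, h1, h2⟩
      have hij := (hK i j h).1
      refine ⟨i, hij.1, j, hij.2, (htest i hij.1 j hij.2).mpr h, ?_, ?_⟩
      · rw [← h1, pairE, Expr.eval_add, Expr.eval_arr, hX, hY, St.at₂_a, hmul _ (hK i j h).2.1.1]
      · rw [← h2, pairE, Expr.eval_add, Expr.eval_arr, hX', hY', St.at₂_a, hmul _ (hK i j h).2.2.1]
  rw [run_prune I R test _ _ s hR ht he hf ?_ (hcode a ha b hb)]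
  · exact hasInfPath_iff_pairPath (fun i j h => ⟨(hK i j h).2.1.2, (hK i j h).2.2.2⟩) hstep hb
  · intro x y h
    obtain ⟨i, j, hij, -, rfl⟩ := (hstep x y).mp h
    exact hcode _ (hK i j hij).2.2.1 _ (hK i j hij).2.2.2

end Cmd

/-! ### The decision program for labelled graphs -/

namespace Core

open LoopLang.Expr LoopLang.Cmd

/-- The variable `c`. -/
abbrev c : Expr := .var .c
/-- The variable `d`. -/
abbrev d : Expr := .var .d

/-- Initial vertices in the target graph. -/
def srcH (e : Expr) : Expr := .inp (.add (.add (.add (.lit 5) (.var .m)) (.var .m)) e)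
/-- Terminal vertices in the target graph. -/
def tgtH (e : Expr) : Expr :=
  .inp (.add (.add (.add (.add (.lit 5) (.var .m)) (.var .m)) (.var .n)) e)

/-- `c` and `d` belong to `A` and have the same label. -/
def same (A : Arr) : Expr := and (arr A c) (and (arr A d) (eq (arr .lab c) (arr .lab d)))
/-- `d` can follow `c`. -/
def follows : Expr := and (arr .ess c) (and (arr .ess d) (eq (arr .tgt c) (arr .src d)))
/-- `d` can follow `c` in the target graph. -/
def followsH : Expr := and (lt c (.var .n)) (and (lt d (.var .n)) (eq (tgtH c) (srcH d)))
/-- `d` is the label of `c`. -/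
def labelTest : Expr := and (arr .ess c) (eq (arr .lab c) d)
/-- `d` is a left mate of `c`. -/
def leftTest : Expr := and (same .ess) (arr .left (pairE (arr .pred c) (arr .src d)))
/-- `d` is a right mate of `c`. -/
def rightTest : Expr := and (same .ess) (arr .right (pairE (arr .succ c) (arr .tgt d)))

/-- Compute `past`. -/
def pastCmd : Cmd := prune .past (same .ok) (pairE (arr .tgt c) (arr .tgt d))
  (pairE (arr .src c) (arr .src d))
/-- Compute `fut`. -/
def futCmd : Cmd := prune .fut (same .ok) (pairE (arr .src c) (arr .src d))
  (pairE (arr .tgt c) (arr .tgt d))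
/-- Compute `ess`. -/
def essCmd : Cmd := fill .pw .ess (and (arr .ok c)
  (and (arr .past (pairE (arr .src c) (arr .src c))) (arr .fut (pairE (arr .tgt c) (arr .tgt c)))))
/-- Compute `pred`. -/
def predCmd : Cmd := select .pw .pw .pred
  (and (arr .ess c) (and (arr .ess d) (eq (arr .tgt d) (arr .src c))))
/-- Compute `succ`. -/
def succCmd : Cmd := select .pw .pw .succ follows
/-- Test injectivity. -/
def injCmd : Cmd := total .badInj (and (not (eq c d)) (and (same .ess)
  (and (arr .past (pairE (arr .src c) (arr .src d))) (arr .fut (pairE (arr .tgt c) (arr .tgt d))))))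
  (.lit 0) (.lit 1)
/-- Test whether walks are mapped to walks. -/
def mapCmd : Cmd := total .badMap
  (and follows (not (eq (tgtH (arr .lab c)) (srcH (arr .lab d))))) (.lit 0) (.lit 1)
/-- Compute `left`. -/
def leftCmd : Cmd := prune .left (same .ess) (pairE c (arr .tgt d)) (pairE (arr .pred c) (arr .src d))
/-- Compute `right`. -/
def rightCmd : Cmd :=
  prune .right (same .ess) (pairE c (arr .src d)) (pairE (arr .succ c) (arr .tgt d))
/-- Compute `hfut`. -/
def hfutCmd : Cmd := prune .hfut followsH c d
/-- Compute `hpast`. -/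
def hpastCmd : Cmd := prune .hpast followsH d c
/-- Compute `hit`. -/
def hitCmd : Cmd := total .hit labelTest d (.lit 1)
/-- Test whether the essential edges of the target graph are labels. -/
def badHitCmd : Cmd := total .badHit
  (and (lt c (.var .n)) (and (arr .hfut c) (and (arr .hpast c) (not (arr .hit c)))))
  (.lit 0) (.lit 1)
/-- One round of the comparison of path counts. -/
def roundCmd : Cmd := block
  [total .accG rightTest (.lit 0) (arr .vecG d), total .accH labelTest (.lit 0) (arr .vecH d),
    store .badCnt (.lit 0)
      (.add (arr .badCnt (.lit 0)) (not (eq (arr .accG (.lit 0)) (arr .accH (.lit 0))))),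
    total .tmp follows d (arr .vecG c), fill .pw .vecG (arr .tmp c),
    total .tmp followsH d (arr .vecH c), fill .pw .vecH (arr .tmp c)]
/-- Compare path counts. -/
def countCmd : Cmd := block
  [store .badCnt (.lit 0) (.lit 0), total .vecG leftTest d (.lit 1), total .vecH labelTest d (.lit 1),
    loop .r .dbl roundCmd]
/-- Combine the results of the tests. -/
def resCmd : Cmd := assign .res (not (.add (.add (arr .badInj (.lit 0)) (arr .badMap (.lit 0)))
  (.add (arr .badHit (.lit 0)) (arr .badCnt (.lit 0)))))

/-- The decision program for labelled graphs. -/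
def coreCmd : Cmd := block [pastCmd, futCmd, essCmd, predCmd, succCmd, injCmd, mapCmd, leftCmd,
  rightCmd, hfutCmd, hpastCmd, hitCmd, badHitCmd, countCmd, resCmd]

section Spec

variable (I : List ℕ) (s : St)

/-- The allowed edges. -/
def okS (A : Arr) (i : ℕ) : Prop := i < s.v .pw ∧ s.a A i ≠ 0
/-- The initial vertices of the target graph, as read from the input. -/
def srcHS (f : ℕ) : ℕ := I.getD (5 + s.v .m + s.v .m + f) 0
/-- The terminal vertices of the target graph, as read from the input. -/
def tgtHS (f : ℕ) : ℕ := I.getD (5 + s.v .m + s.v .m + s.v .n + f) 0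

/-- What the decision program expects. -/
structure Ready : Prop where
  pos : 0 < s.v .pw
  sq : s.v .sq = s.v .pw * s.v .pw
  dbl : s.v .dbl = s.v .pw + s.v .pw
  le : s.v .n ≤ s.v .pw
  mul : ∀ a < s.v .pw, s.a .mulP a = a * s.v .pw
  ok : ∀ i, okS s .ok i → s.a .src i < s.v .pw ∧ s.a .tgt i < s.v .pw ∧ s.a .lab i < s.v .n

variable {s}

lemma eval_same (A : Arr) {i j : ℕ} (hi : i < s.v .pw) (hj : j < s.v .pw) :
    (same A).eval I (s.at₂ i j) ≠ 0 ↔ SameLabel (okS s A) (s.a .lab) i j := by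
  simp [same, SameLabel, okS, hi, hj]

lemma eval_follows {i j : ℕ} (hi : i < s.v .pw) (hj : j < s.v .pw) :
    follows.eval I (s.at₂ i j) ≠ 0 ↔ Follows (okS s .ess) (s.a .src) (s.a .tgt) i j := by
  simp [follows, Follows, okS, hi, hj]

lemma eval_srcH (e : Expr) (i j : ℕ) :
    (srcH e).eval I (s.at₂ i j) = srcHS I s (e.eval I (s.at₂ i j)) := by
  simp [srcH, srcHS, St.at₂_v]

lemma eval_tgtH (e : Expr) (i j : ℕ) :
    (tgtH e).eval I (s.at₂ i j) = tgtHS I s (e.eval I (s.at₂ i j)) := by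
  simp [tgtH, tgtHS, St.at₂_v]

lemma eval_followsH (i j : ℕ) :
    followsH.eval I (s.at₂ i j) ≠ 0 ↔ Follows (· < s.v .n) (srcHS I s) (tgtHS I s) i j := by
  simp [followsH, Follows, eval_srcH, eval_tgtH, St.at₂_v]

lemma eval_labelTest {i : ℕ} (hi : i < s.v .pw) (j : ℕ) :
    labelTest.eval I (s.at₂ i j) ≠ 0 ↔ okS s .ess i ∧ s.a .lab i = j := by
  simp [labelTest, okS, hi]

end Spec

end Core

lemma Expr.eval_frame (I : List ℕ) {s s' : St} (L : List Arr)
    (hv : ∀ x, x ≠ .c → x ≠ .d → x ≠ .r → s'.v x = s.v x) (ha : ∀ A, A ∉ L → s'.a A = s.a A)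
    (g : Expr) (hr : g.readsV .r = false) (hL : ∀ A ∈ L, g.reads A = false) (i j : ℕ) :
    g.eval I (s'.at₂ i j) = g.eval I (s.at₂ i j) := by
  refine g.eval_congr I (fun x hx => ?_) (fun A hA => ha A fun h => ?_)
  · by_cases hc : x = .c
    · subst hc; simp
    by_cases hd : x = .d
    · subst hd; simp
    rw [St.at₂_v _ _ _ hc hd, St.at₂_v _ _ _ hc hd, hv x hc hd]
    rintro rfl; simp [hr] at hx
  · simp [hL A h] at hA

/-! ### Comparison of the path counts by the program -/

namespace Core

open LoopLang.Expr LoopLang.Cmd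

variable {I : List ℕ} {s : St}

/-- The arrays are specified only below `N`, and the step looks at nothing else. -/
lemma stepVec_congr {N : ℕ} {adj : ℕ → ℕ → Prop} {v w : ℕ → ℕ} (h : ∀ x < N, v x = w x) :
    stepVec N adj v = stepVec N adj w := by
  classical
  funext d
  refine sum_congr rfl fun c hc => ?_
  rw [h c (mem_range.mp hc)]

/-- The product is collected in `tmp` because the old vector is needed until the whole sum is
complete. -/
lemma run_stepVec (A : Arr) (test : Expr) (htest : test.reads .tmp = false)
    {adj : ℕ → ℕ → Prop} (hadj : ∀ i < s.v .pw, ∀ j < s.v .pw,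
      test.eval I (s.at₂ i j) ≠ 0 ↔ adj i j) (hA : A ≠ .tmp) {x : ℕ} (hx : x < s.v .pw) :
    ((fill .pw A (arr .tmp c)).run I ((total .tmp test d (arr A c)).run I s)).a A x =
      stepVec (s.v .pw) adj (s.a A) x := by
  classical
  have hpw : ((total .tmp test d (arr A c)).run I s).v .pw = s.v .pw := run_v I _ _ rfl
  rw [run_fill I _ _ _ _ (by simp [reads, hA.symm]), hpw, if_pos hx]
  simp only [eval_arr, eval_var, St.at_c, St.at_a]
  rw [run_total I _ _ _ _ _ htest rfl (by simp [reads, hA]) hx, stepVec]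
  refine sum_congr rfl fun i hi => ?_
  rw [sum_eq_single x]
  · simp only [eval_var, St.at₂_d, and_true, eval_arr, St.at₂_a, St.at₂_c]
    exact if_congr (hadj i (mem_range.mp hi) x hx) rfl rfl
  · intro j _ hj
    simp [hj]
  · simp [hx]

section Count

variable (hs : Ready s)
  (hleft : ∀ i < s.v .pw, ∀ j < s.v .pw, leftTest.eval I (s.at₂ i j) ≠ 0 ↔
    LeftMate (okS s .ess) (s.a .src) (s.a .tgt) (s.a .lab) (s.a .pred) i j)
  (hright : ∀ i < s.v .pw, ∀ j < s.v .pw, rightTest.eval I (s.at₂ i j) ≠ 0 ↔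
    RightMate (okS s .ess) (s.a .src) (s.a .tgt) (s.a .lab) (s.a .succ) i j)

/-- The arrays that change while paths are counted. -/
def work : List Arr := [.accG, .accH, .badCnt, .tmp, .vecG, .vecH]

/-- The state `s'` differs from `s` only in what changes while paths are counted. -/
structure Near (s s' : St) : Prop where
  v : ∀ x, x ≠ .c → x ≠ .d → x ≠ .r → s'.v x = s.v x
  a : ∀ A, A ∉ work → s'.a A = s.a A

lemma Near.refl (s : St) : Near s s := ⟨fun _ _ _ _ => rfl, fun _ _ => rfl⟩

lemma Near.run {s s' : St} (h : Near s s') (P : Cmd)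
    (hv : ∀ x, x ≠ .c → x ≠ .d → x ≠ .r → P.writesV x = false)
    (ha : ∀ A, A ∉ work → P.writesA A = false) : Near s (P.run I s') :=
  ⟨fun x hc hd hr => by rw [run_v I P s' (hv x hc hd hr), h.v x hc hd hr],
    fun A hA => by rw [run_a I P s' (ha A hA), h.a A hA]⟩

lemma Near.eval {s s' : St} (h : Near s s') (g : Expr) (hr : g.readsV .r = false)
    (hL : ∀ A ∈ work, g.reads A = false) (i j : ℕ) :
    g.eval I (s'.at₂ i j) = g.eval I (s.at₂ i j) := g.eval_frame I work h.v h.a hr hL i j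

/-- The path counts after `j` rounds in the labelled graph. -/
noncomputable def vecGS (s : St) (j : ℕ) : ℕ → ℕ :=
  (stepVec (s.v .pw) (Follows (okS s .ess) (s.a .src) (s.a .tgt)))^[j]
    (mateVec (s.v .pw) (okS s .ess) (s.a .src) (s.a .tgt) (s.a .lab) (s.a .pred))

/-- The path counts after `j` rounds in the target graph. -/
noncomputable def vecHS (I : List ℕ) (s : St) (j : ℕ) : ℕ → ℕ :=
  (stepVec (s.v .pw) (Follows (· < s.v .n) (srcHS I s) (tgtHS I s)))^[j]
    (labelVec (s.v .pw) (okS s .ess) (s.a .lab))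

/-- The path counts of both graphs agree after `j` rounds. -/
def CountEq (I : List ℕ) (s : St) (j : ℕ) : Prop :=
  mateCount (s.v .pw) (okS s .ess) (s.a .src) (s.a .tgt) (s.a .lab) (s.a .succ) (vecGS s j) =
    labelCount (s.v .pw) (okS s .ess) (s.a .lab) (vecHS I s j)

-- The comparison precedes the two matrix products, so round `j` tests paths with `j` steps.
-- Mismatches are added up and never reset during the rounds; zero at the end means that all
-- comparisons succeeded.
include hs hright in
lemma run_round {s' : St} (h : Near s s') {j : ℕ} (hG : ∀ x < s.v .pw, s'.a .vecG x = vecGS s j x)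
    (hH : ∀ x < s.v .pw, s'.a .vecH x = vecHS I s j x) :
    Near s (roundCmd.run I s') ∧
      (∀ x < s.v .pw, (roundCmd.run I s').a .vecG x = vecGS s (j + 1) x) ∧
      (∀ x < s.v .pw, (roundCmd.run I s').a .vecH x = vecHS I s (j + 1) x) ∧
      ((roundCmd.run I s').a .badCnt 0 = 0 ↔ s'.a .badCnt 0 = 0 ∧ CountEq I s j) := by
  classical
  have hpw' : s'.v .pw = s.v .pw := h.v _ (by decide) (by decide) (by decide)
  simp only [roundCmd, run_block_cons, run_block_nil]
  set s₁ := (total .accG rightTest (.lit 0) (arr .vecG d)).run I s' with hs₁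
  set s₂ := (total .accH labelTest (.lit 0) (arr .vecH d)).run I s₁ with hs₂
  set s₃ := (store .badCnt (.lit 0) (.add (arr .badCnt (.lit 0))
    (not (eq (arr .accG (.lit 0)) (arr .accH (.lit 0)))))).run I s₂ with hs₃
  set s₄ := (fill .pw .vecG (arr .tmp c)).run I ((total .tmp follows d (arr .vecG c)).run I s₃)
    with hs₄
  set s₅ := (fill .pw .vecH (arr .tmp c)).run I ((total .tmp followsH d (arr .vecH c)).run I s₄)
    with hs₅
  have n₁ : Near s s₁ := h.run _ (by intro x; cases x <;> decide) (by intro x; cases x <;> decide)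
  have n₂ : Near s s₂ := n₁.run _ (by intro x; cases x <;> decide) (by intro x; cases x <;> decide)
  have n₃ : Near s s₃ := n₂.run _ (by intro x; cases x <;> decide) (by intro x; cases x <;> decide)
  have n₄ : Near s s₄ := (n₃.run _ (by intro x; cases x <;> decide)
    (by intro x; cases x <;> decide)).run _ (by intro x; cases x <;> decide)
      (by intro x; cases x <;> decide)
  have n₅ : Near s s₅ := (n₄.run _ (by intro x; cases x <;> decide)
    (by intro x; cases x <;> decide)).run _ (by intro x; cases x <;> decide)
      (by intro x; cases x <;> decide)
  have hG₃ : s₃.a .vecG = s'.a .vecG := by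
    rw [hs₃, run_a I _ _ rfl, hs₂, run_a I _ _ rfl, hs₁, run_a I _ _ rfl]
  have hH₁ : s₁.a .vecH = s'.a .vecH := by rw [hs₁, run_a I _ _ rfl]
  have hH₄ : s₄.a .vecH = s'.a .vecH := by
    rw [hs₄, run_a I _ _ rfl, run_a I _ _ rfl, hs₃, run_a I _ _ rfl, hs₂, run_a I _ _ rfl, hH₁]
  have pw₁ : s₁.v .pw = s.v .pw := n₁.v _ (by decide) (by decide) (by decide)
  have pw₃ : s₃.v .pw = s.v .pw := n₃.v _ (by decide) (by decide) (by decide)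
  have pw₄ : s₄.v .pw = s.v .pw := n₄.v _ (by decide) (by decide) (by decide)
  refine ⟨n₅, fun x hx => ?_, fun x hx => ?_, ?_⟩
  · rw [hs₅, run_a I _ _ rfl, run_a I _ _ rfl, hs₄,
      run_stepVec .vecG follows rfl (adj := Follows (okS s .ess) (s.a .src) (s.a .tgt)) ?_
        (by decide) (pw₃ ▸ hx), pw₃, vecGS, Function.iterate_succ_apply', hG₃]
    · exact congrFun (stepVec_congr hG) x
    · intro i hi j hj
      rw [n₃.eval _ rfl (by decide)]
      rw [pw₃] at hi hj
      exact eval_follows I hi hj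
  · rw [hs₅, run_stepVec .vecH followsH rfl
        (adj := Follows (· < s.v .n) (srcHS I s) (tgtHS I s)) ?_
        (by decide) (pw₄ ▸ hx), pw₄, vecHS, Function.iterate_succ_apply', hH₄]
    · exact congrFun (stepVec_congr hH) x
    · intro i hi j hj
      rw [n₄.eval _ rfl (by decide)]
      exact eval_followsH I i j
  · have b5 : s₅.a .badCnt = s₃.a .badCnt := by
      rw [hs₅, run_a I _ _ rfl, run_a I _ _ rfl, hs₄, run_a I _ _ rfl, run_a I _ _ rfl]
    have b2 : s₂.a .badCnt = s'.a .badCnt := by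
      rw [hs₂, run_a I _ _ rfl, hs₁, run_a I _ _ rfl]
    have hg : s₂.a .accG 0 = mateCount (s.v .pw) (okS s .ess) (s.a .src) (s.a .tgt) (s.a .lab)
        (s.a .succ) (vecGS s j) := by
      rw [hs₂, run_a I _ _ rfl, hs₁, run_total I _ _ _ _ _ rfl rfl rfl (hpw' ▸ hs.pos), hpw',
        mateCount]
      refine sum_congr rfl fun u hu => sum_congr rfl fun v hv => ?_
      simp only [eval_lit, and_true, eval_arr, St.at₂_a, eval_var, St.at₂_d]
      rw [h.eval _ rfl (by decide)]
      rw [hG v (mem_range.mp hv)]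
      exact if_congr (hright u (mem_range.mp hu) v (mem_range.mp hv)) rfl rfl
    have hh : s₂.a .accH 0 = labelCount (s.v .pw) (okS s .ess) (s.a .lab) (vecHS I s j) := by
      rw [hs₂, run_total I _ _ _ _ _ rfl rfl rfl (pw₁ ▸ hs.pos), pw₁, labelCount]
      refine sum_congr rfl fun u hu => sum_congr rfl fun v hv => ?_
      simp only [eval_lit, and_true, eval_arr, St.at₂_a, eval_var, St.at₂_d]
      rw [n₁.eval _ rfl (by decide)]
      rw [hH₁, hH v (mem_range.mp hv)]
      exact if_congr (eval_labelTest I (mem_range.mp hu) v) rfl rfl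
    rw [b5, hs₃]
    simp only [run, St.setA_a_self, eval_lit, Function.update_self, eval_add, eval_arr,
      Nat.add_eq_zero_iff, eval_not_ne, b2, CountEq, ne_eq, eval_eq_ne, hg, hh, not_not]

include hs hleft hright in
lemma run_count : (countCmd.run I s).a .badCnt 0 = 0 ↔ ∀ j < s.v .pw + s.v .pw, CountEq I s j := by
  classical
  rw [← hs.dbl]
  simp only [countCmd, run_block_cons, run_block_nil]
  set s₁ := (store .badCnt (.lit 0) (.lit 0)).run I s with hs₁
  set s₂ := (total .vecG leftTest d (.lit 1)).run I s₁ with hs₂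
  set s₃ := (total .vecH labelTest d (.lit 1)).run I s₂ with hs₃
  have n₁ : Near s s₁ := (Near.refl s).run _ (by intro x; cases x <;> decide)
    (by intro x; cases x <;> decide)
  have n₂ : Near s s₂ := n₁.run _ (by intro x; cases x <;> decide) (by intro x; cases x <;> decide)
  have n₃ : Near s s₃ := n₂.run _ (by intro x; cases x <;> decide) (by intro x; cases x <;> decide)
  have pw₁ : s₁.v .pw = s.v .pw := rfl
  have pw₂ : s₂.v .pw = s.v .pw := n₂.v _ (by decide) (by decide) (by decide)
  have dbl₃ : s₃.v .dbl = s.v .dbl := n₃.v _ (by decide) (by decide) (by decide)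
  have key := run_loop_induction I (x := .r) (b := .dbl) (P := roundCmd) (s := s₃)
    (J := fun j s' => Near s s' ∧ (∀ x < s.v .pw, s'.a .vecG x = vecGS s j x) ∧
      (∀ x < s.v .pw, s'.a .vecH x = vecHS I s j x) ∧
      (s'.a .badCnt 0 = 0 ↔ ∀ i < j, CountEq I s i)) ⟨n₃, ?_, ?_, ?_⟩ ?_
  · rw [dbl₃] at key
    exact key.2.2.2
  · intro x hx
    rw [hs₃, run_a I _ _ rfl, hs₂, run_total I _ _ _ _ _ rfl rfl rfl (pw₁ ▸ hx), pw₁, vecGS,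
      Function.iterate_zero, id, mateVec]
    refine sum_congr rfl fun u hu => sum_congr rfl fun v hv => ?_
    rw [n₁.eval _ rfl (by decide)]
    simp only [eval_lit, eval_var, St.at₂_d]
    exact if_congr (and_congr_left' (hleft u (mem_range.mp hu) v (mem_range.mp hv))) rfl rfl
  · intro x hx
    rw [hs₃, run_total I _ _ _ _ _ rfl rfl rfl (pw₂ ▸ hx), pw₂, vecHS,
      Function.iterate_zero, id, labelVec]
    refine sum_congr rfl fun u hu => sum_congr rfl fun v hv => ?_
    rw [n₂.eval _ rfl (by decide)]
    simp only [eval_lit, eval_var, St.at₂_d]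
    exact if_congr (and_congr_left' (eval_labelTest I (mem_range.mp hu) v)) rfl rfl
  · rw [hs₃, run_a I _ _ rfl, hs₂, run_a I _ _ rfl, hs₁]
    simp [run]
  · rintro j - s' ⟨h1, h2, h3, h4⟩
    have n' : Near s (s'.setV .r j) :=
      ⟨fun x hc hd hr => by rw [St.setV_v_of_ne _ _ hr, h1.v x hc hd hr], h1.a⟩
    obtain ⟨h5, h6, h7, h8⟩ := run_round hs hright n' h2 h3
    refine ⟨h5, h6, h7, ?_⟩
    rw [h8, St.setV_a, h4, Nat.forall_lt_succ_right]

end Count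

end Core

/-! ### Correctness of the stages of the decision program -/

namespace Core

open LoopLang.Expr LoopLang.Cmd

variable {I : List ℕ}

/-- The arrays that the decision program expects. -/
def given : List Arr := [.mulP, .src, .tgt, .lab, .ok]

/-- The state `s'` agrees with `s` in the given arrays and all variables that matter. -/
structure Keeps (s s' : St) : Prop where
  v : ∀ x, x ≠ .c → x ≠ .d → x ≠ .r → s'.v x = s.v x
  a : ∀ A, A ∈ given → s'.a A = s.a A

lemma Keeps.refl (s : St) : Keeps s s := ⟨fun _ _ _ _ => rfl, fun _ _ => rfl⟩

lemma Keeps.run {s s' : St} (h : Keeps s s') (P : Cmd)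
    (hv : ∀ x, x ≠ .c → x ≠ .d → x ≠ .r → P.writesV x = false)
    (ha : ∀ A, A ∈ given → P.writesA A = false) : Keeps s (P.run I s') :=
  ⟨fun x hc hd hr => by rw [run_v I P s' (hv x hc hd hr), h.v x hc hd hr],
    fun A hA => by rw [run_a I P s' (ha A hA), h.a A hA]⟩

section

variable {s : St}

/-- Pasts are followed backwards: a step of the pair graph leads from the terminal vertices to the
initial ones. -/
lemma run_past (hs : Ready s) {a b : ℕ} (ha : a < s.v .pw) (hb : b < s.v .pw) :
    (pastCmd.run I s).a .past (a * s.v .pw + b) ≠ 0 ↔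
      PastPair (okS s .ok) (s.a .src) (s.a .tgt) (s.a .lab) a b :=
  run_prune_pair I _ _ _ _ _ _ s (by decide) (by decide) (by decide) (by decide) hs.sq hs.mul
    (fun _ hi _ hj => eval_same I .ok hi hj)
    (fun i j h => ⟨⟨h.1.1, h.2.1.1⟩, ⟨(hs.ok i h.1).2.1, (hs.ok j h.2.1).2.1⟩,
      (hs.ok i h.1).1, (hs.ok j h.2.1).1⟩)
    (by simp) (by simp) (by simp) (by simp) ha hb

lemma run_fut (hs : Ready s) {a b : ℕ} (ha : a < s.v .pw) (hb : b < s.v .pw) :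
    (futCmd.run I s).a .fut (a * s.v .pw + b) ≠ 0 ↔
      FuturePair (okS s .ok) (s.a .src) (s.a .tgt) (s.a .lab) a b :=
  run_prune_pair I _ _ _ _ _ _ s (by decide) (by decide) (by decide) (by decide) hs.sq hs.mul
    (fun _ hi _ hj => eval_same I .ok hi hj)
    (fun i j h => ⟨⟨h.1.1, h.2.1.1⟩, ⟨(hs.ok i h.1).1, (hs.ok j h.2.1).1⟩,
      (hs.ok i h.1).2.1, (hs.ok j h.2.1).2.1⟩)
    (by simp) (by simp) (by simp) (by simp) ha hb

/-- The vertices here are pairs of an edge and a vertex. The edge follows its chosen left ray, while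
the second path is free among those with the same labels. -/
lemma run_left (hs : Ready s)
    (hess : ∀ i, okS s .ess i → okS s .ok i) (hpred : ∀ i, okS s .ess i → s.a .pred i < s.v .pw)
    {a b : ℕ} (ha : a < s.v .pw) (hb : b < s.v .pw) :
    (leftCmd.run I s).a .left (a * s.v .pw + b) ≠ 0 ↔
      PairPath (SameLabel (okS s .ess) (s.a .lab)) id (s.a .tgt) (s.a .pred) (s.a .src) a b :=
  run_prune_pair I _ _ _ _ _ _ s (by decide) (by decide) (by decide) (by decide) hs.sq hs.mul
    (fun _ hi _ hj => eval_same I .ess hi hj)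
    (fun i j h => ⟨⟨h.1.1, h.2.1.1⟩, ⟨h.1.1, (hs.ok j (hess j h.2.1)).2.1⟩,
      hpred i h.1, (hs.ok j (hess j h.2.1)).1⟩)
    (by simp) (by simp) (by simp) (by simp) ha hb

lemma run_right (hs : Ready s)
    (hess : ∀ i, okS s .ess i → okS s .ok i) (hsucc : ∀ i, okS s .ess i → s.a .succ i < s.v .pw)
    {a b : ℕ} (ha : a < s.v .pw) (hb : b < s.v .pw) :
    (rightCmd.run I s).a .right (a * s.v .pw + b) ≠ 0 ↔
      PairPath (SameLabel (okS s .ess) (s.a .lab)) id (s.a .src) (s.a .succ) (s.a .tgt) a b :=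
  run_prune_pair I _ _ _ _ _ _ s (by decide) (by decide) (by decide) (by decide) hs.sq hs.mul
    (fun _ hi _ hj => eval_same I .ess hi hj)
    (fun i j h => ⟨⟨h.1.1, h.2.1.1⟩, ⟨h.1.1, (hs.ok j (hess j h.2.1)).1⟩,
      hsucc i h.1, (hs.ok j (hess j h.2.1)).2.1⟩)
    (by simp) (by simp) (by simp) (by simp) ha hb

lemma run_ess (hs : Ready s)
    (hp : ∀ a < s.v .pw, ∀ b < s.v .pw, s.a .past (a * s.v .pw + b) ≠ 0 ↔
      PastPair (okS s .ok) (s.a .src) (s.a .tgt) (s.a .lab) a b)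
    (hf : ∀ a < s.v .pw, ∀ b < s.v .pw, s.a .fut (a * s.v .pw + b) ≠ 0 ↔
      FuturePair (okS s .ok) (s.a .src) (s.a .tgt) (s.a .lab) a b)
    (i : ℕ) : okS (essCmd.run I s) .ess i ↔
      Essential (okS s .ok) (s.a .src) (s.a .tgt) (s.a .lab) i := by
  have hpw : (essCmd.run I s).v .pw = s.v .pw := run_v I _ _ rfl
  rw [okS, hpw]
  by_cases hi : i < s.v .pw
  · rw [essCmd, run_fill I _ _ _ _ rfl, if_pos hi]
    by_cases hok : s.a .ok i = 0
    · simp [hok, Essential, okS]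
    · have h := hs.ok i ⟨hi, hok⟩
      have h1 := hp _ h.1 _ h.1
      have h2 := hf _ h.2.1 _ h.2.1
      simp [Essential, okS, hok, hi, pairE, hs.mul _ h.1, hs.mul _ h.2.1, ← h1, ← h2]
  · simp [hi, Essential, okS]

lemma run_pred (hess : ∀ i, okS s .ess i ↔
      Essential (okS s .ok) (s.a .src) (s.a .tgt) (s.a .lab) i) {i : ℕ} (hi : okS s .ess i) :
    okS s .ess ((predCmd.run I s).a .pred i) ∧
      s.a .tgt ((predCmd.run I s).a .pred i) = s.a .src i := by
  obtain ⟨e, he, het⟩ := ((hess i).mp hi).exists_pred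
  rw [← hess] at he
  rw [predCmd, run_select I _ _ _ _ _ (by decide) rfl, if_pos hi.1]
  have h := lastSat_spec (fun j => (and (arr .ess c) (and (arr .ess d)
    (eq (arr .tgt d) (arr .src c)))).eval I (s.at₂ i j) ≠ 0) (s.a .pred i) (s.v .pw)
    ⟨e, he.1, by simp [hi.2, he.2, het]⟩
  obtain ⟨h1, h2⟩ := h
  simp only [ne_eq, eval_and_ne, eval_arr, eval_var, eval_eq_ne, St.at₂_a, St.at₂_c, St.at₂_d,
    not_or, not_not] at h2 h1 ⊢
  exact ⟨⟨h1, h2.2.1⟩, h2.2.2⟩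

lemma run_succ (hess : ∀ i, okS s .ess i ↔
      Essential (okS s .ok) (s.a .src) (s.a .tgt) (s.a .lab) i) {i : ℕ} (hi : okS s .ess i) :
    okS s .ess ((succCmd.run I s).a .succ i) ∧
      s.a .tgt i = s.a .src ((succCmd.run I s).a .succ i) := by
  obtain ⟨e, he, het⟩ := ((hess i).mp hi).exists_succ
  rw [← hess] at he
  rw [succCmd, run_select I _ _ _ _ _ (by decide) rfl, if_pos hi.1]
  have h := lastSat_spec (fun j => follows.eval I (s.at₂ i j) ≠ 0) (s.a .succ i) (s.v .pw)
    ⟨e, he.1, by rw [eval_follows I hi.1 he.1]; exact ⟨hi, he, het⟩⟩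
  rw [eval_follows I hi.1 h.1] at h
  exact ⟨h.2.2.1, h.2.2.2⟩

lemma run_inj (hs : Ready s)
    (hess : ∀ i, okS s .ess i ↔ Essential (okS s .ok) (s.a .src) (s.a .tgt) (s.a .lab) i)
    (hp : ∀ a < s.v .pw, ∀ b < s.v .pw, s.a .past (a * s.v .pw + b) ≠ 0 ↔
      PastPair (okS s .ok) (s.a .src) (s.a .tgt) (s.a .lab) a b)
    (hf : ∀ a < s.v .pw, ∀ b < s.v .pw, s.a .fut (a * s.v .pw + b) ≠ 0 ↔
      FuturePair (okS s .ok) (s.a .src) (s.a .tgt) (s.a .lab) a b) :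
    (injCmd.run I s).a .badInj 0 = 0 ↔ ¬ ∃ c d, c ≠ d ∧ okS s .ess c ∧ okS s .ess d ∧
      s.a .lab c = s.a .lab d ∧
      PastPair (okS s .ok) (s.a .src) (s.a .tgt) (s.a .lab) (s.a .src c) (s.a .src d) ∧
      FuturePair (okS s .ok) (s.a .src) (s.a .tgt) (s.a .lab) (s.a .tgt c) (s.a .tgt d) := by
  rw [injCmd, run_tally I _ _ _ rfl hs.pos, not_iff_not]
  have key : ∀ i < s.v .pw, ∀ j < s.v .pw, (and (not (eq c d)) (and (same .ess)
      (and (arr .past (pairE (arr .src c) (arr .src d)))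
        (arr .fut (pairE (arr .tgt c) (arr .tgt d)))))).eval I (s.at₂ i j) ≠ 0 ↔
      i ≠ j ∧ SameLabel (okS s .ess) (s.a .lab) i j ∧
      PastPair (okS s .ok) (s.a .src) (s.a .tgt) (s.a .lab) (s.a .src i) (s.a .src j) ∧
      FuturePair (okS s .ok) (s.a .src) (s.a .tgt) (s.a .lab) (s.a .tgt i) (s.a .tgt j) := by
    intro i hi j hj
    have e1 := eval_same I .ess (s := s) hi hj
    -- The bounds on vertices, and with them the multiplication table, are available only for
    -- admissible edges. If the first part of the conjunction fails, the table lookups are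
    -- irrelevant.
    by_cases hsl : SameLabel (okS s .ess) (s.a .lab) i j
    · have h1 := hs.ok i ((hess i).mp hsl.1).1
      have h2 := hs.ok j ((hess j).mp hsl.2.1).1
      rw [← hp _ h1.1 _ h2.1, ← hf _ h1.2.1 _ h2.2.1]
      have e2 := e1.mpr hsl
      simp [e2, hsl, pairE, hs.mul _ h1.1, hs.mul _ h1.2.1]
    · have e2 : (same .ess).eval I (s.at₂ i j) = 0 := by
        by_contra h; exact hsl (e1.mp h)
      simp [e2, hsl]
  constructor
  · rintro ⟨i, hi, j, hj, h⟩
    rw [key i hi j hj] at h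
    exact ⟨i, j, h.1, h.2.1.1, h.2.1.2.1, h.2.1.2.2, h.2.2⟩
  · rintro ⟨i, j, h1, h2, h3, h4, h5⟩
    exact ⟨i, h2.1, j, h3.1, (key i h2.1 j h3.1).mpr ⟨h1, ⟨h2, h3, h4⟩, h5⟩⟩

lemma run_map (hpos : 0 < s.v .pw) : (mapCmd.run I s).a .badMap 0 = 0 ↔
    ¬ ∃ c d, okS s .ess c ∧ okS s .ess d ∧ s.a .tgt c = s.a .src d ∧
      tgtHS I s (s.a .lab c) ≠ srcHS I s (s.a .lab d) := by
  rw [mapCmd, run_tally I _ _ _ rfl hpos, not_iff_not]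
  have key : ∀ i < s.v .pw, ∀ j < s.v .pw,
      (and follows (not (eq (tgtH (arr .lab c)) (srcH (arr .lab d))))).eval I (s.at₂ i j) ≠ 0 ↔
      Follows (okS s .ess) (s.a .src) (s.a .tgt) i j ∧
        tgtHS I s (s.a .lab i) ≠ srcHS I s (s.a .lab j) := by
    intro i hi j hj
    rw [← eval_follows I hi hj]
    simp [eval_tgtH, eval_srcH]
  constructor
  · rintro ⟨i, hi, j, hj, h⟩
    rw [key i hi j hj] at h
    exact ⟨i, j, h.1.1, h.1.2.1, h.1.2.2, h.2⟩
  · rintro ⟨i, j, h1, h2, h3, h4⟩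
    exact ⟨i, h1.1, j, h2.1, (key i h1.1 j h2.1).mpr ⟨⟨h1, h2, h3⟩, h4⟩⟩

lemma step_followsH (hle : s.v .n ≤ s.v .pw) (x y : ℕ) :
    Step I s followsH c d x y ↔ Follows (· < s.v .n) (srcHS I s) (tgtHS I s) x y := by
  constructor
  · rintro ⟨i, -, j, -, h, rfl, rfl⟩
    simpa [eval_followsH] using h
  · intro h
    exact ⟨x, h.1.trans_le hle, y, h.2.1.trans_le hle, by rwa [eval_followsH], by simp, by simp⟩

lemma step_followsH' (hle : s.v .n ≤ s.v .pw) (x y : ℕ) :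
    Step I s followsH d c x y ↔ Follows (· < s.v .n) (srcHS I s) (tgtHS I s) y x := by
  constructor
  · rintro ⟨i, -, j, -, h, rfl, rfl⟩
    simpa [eval_followsH] using h
  · intro h
    exact ⟨y, h.1.trans_le hle, x, h.2.1.trans_le hle, by rwa [eval_followsH], by simp, by simp⟩

lemma le_sq (hs : Ready s) : s.v .n ≤ s.v .sq := by
  have := hs.le
  have := hs.pos
  rw [hs.sq]
  nlinarith

/-- Here the vertices of the pruned graph are the edges of the target graph. There are only `n ≤ sq`
of them, so the same routine applies, with more rounds than necessary. -/
lemma run_hfut (hs : Ready s) {f : ℕ} (hf : f < s.v .n) : (hfutCmd.run I s).a .hfut f ≠ 0 ↔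
    HasInfPath (Follows (· < s.v .n) (srcHS I s) (tgtHS I s)) f := by
  rw [hfutCmd, run_prune I _ _ _ _ s (by decide) (by decide) (by decide) (by decide) ?_
    (hf.trans_le (le_sq hs))]
  · rw [show Step I s followsH c d = _ from
      funext fun x => funext fun y => propext (step_followsH hs.le x y)]
  · intro x y h
    exact ((step_followsH hs.le x y).mp h).2.1.trans_le (le_sq hs)

lemma run_hpast (hs : Ready s) {f : ℕ} (hf : f < s.v .n) : (hpastCmd.run I s).a .hpast f ≠ 0 ↔
    HasInfPath (fun c d => Follows (· < s.v .n) (srcHS I s) (tgtHS I s) d c) f := by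
  rw [hpastCmd, run_prune I _ _ _ _ s (by decide) (by decide) (by decide) (by decide) ?_
    (hf.trans_le (le_sq hs))]
  · rw [show Step I s followsH d c = _ from
      funext fun x => funext fun y => propext (step_followsH' hs.le x y)]
  · intro x y h
    exact ((step_followsH' hs.le x y).mp h).1.trans_le (le_sq hs)

lemma run_hit {f : ℕ} (hf : f < s.v .pw) : (hitCmd.run I s).a .hit f ≠ 0 ↔
    ∃ u, okS s .ess u ∧ s.a .lab u = f := by
  rw [hitCmd, run_total I _ _ _ _ _ rfl rfl rfl hf]
  simp only [ne_eq, sum_eq_zero_iff, mem_range, not_forall]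
  constructor
  · rintro ⟨i, hi, j, hj, h⟩
    have h' : labelTest.eval I (s.at₂ i j) ≠ 0 ∧ d.eval I (s.at₂ i j) = f := by
      by_contra h'; exact h (if_neg h')
    rw [eval_labelTest I hi] at h'
    exact ⟨i, h'.1.1, h'.1.2.trans (by simpa using h'.2)⟩
  · rintro ⟨u, hu, rfl⟩
    refine ⟨u, hu.1, s.a .lab u, hf, ?_⟩
    have h' := (eval_labelTest I hu.1 (s.a .lab u)).mpr ⟨hu, rfl⟩
    simp only [ne_eq] at h'
    simp [h']

lemma run_badHit (hs : Ready s) : (badHitCmd.run I s).a .badHit 0 = 0 ↔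
    ¬ ∃ f < s.v .n, s.a .hfut f ≠ 0 ∧ s.a .hpast f ≠ 0 ∧ s.a .hit f = 0 := by
  rw [badHitCmd, run_tally I _ _ _ rfl hs.pos, not_iff_not]
  constructor
  · rintro ⟨i, hi, j, hj, h⟩
    simp [St.at₂_v] at h
    exact ⟨i, h⟩
  · rintro ⟨f, hf, h⟩
    refine ⟨f, hf.trans_le hs.le, 0, hs.pos, ?_⟩
    simpa [St.at₂_v, hf] using h

lemma eval_leftTest (hs : Ready s)
    (hess : ∀ i, okS s .ess i → okS s .ok i) (hpred : ∀ i, okS s .ess i → s.a .pred i < s.v .pw)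
    (hl : ∀ a < s.v .pw, ∀ b < s.v .pw, s.a .left (a * s.v .pw + b) ≠ 0 ↔
      PairPath (SameLabel (okS s .ess) (s.a .lab)) id (s.a .tgt) (s.a .pred) (s.a .src) a b)
    {i j : ℕ} (hi : i < s.v .pw) (hj : j < s.v .pw) : leftTest.eval I (s.at₂ i j) ≠ 0 ↔
      LeftMate (okS s .ess) (s.a .src) (s.a .tgt) (s.a .lab) (s.a .pred) i j := by
  have e1 := eval_same I .ess (s := s) hi hj
  rw [LeftMate]
  by_cases hsl : SameLabel (okS s .ess) (s.a .lab) i j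
  · rw [← hl _ (hpred i hsl.1) _ (hs.ok j (hess j hsl.2.1)).1]
    have e2 := e1.mpr hsl
    simp [leftTest, e2, hsl, pairE, hs.mul _ (hpred i hsl.1)]
  · have e2 : (same .ess).eval I (s.at₂ i j) = 0 := by
      by_contra h; exact hsl (e1.mp h)
    simp [leftTest, e2, hsl]

lemma eval_rightTest (hs : Ready s)
    (hess : ∀ i, okS s .ess i → okS s .ok i) (hsucc : ∀ i, okS s .ess i → s.a .succ i < s.v .pw)
    (hl : ∀ a < s.v .pw, ∀ b < s.v .pw, s.a .right (a * s.v .pw + b) ≠ 0 ↔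
      PairPath (SameLabel (okS s .ess) (s.a .lab)) id (s.a .src) (s.a .succ) (s.a .tgt) a b)
    {i j : ℕ} (hi : i < s.v .pw) (hj : j < s.v .pw) : rightTest.eval I (s.at₂ i j) ≠ 0 ↔
      RightMate (okS s .ess) (s.a .src) (s.a .tgt) (s.a .lab) (s.a .succ) i j := by
  have e1 := eval_same I .ess (s := s) hi hj
  rw [RightMate]
  by_cases hsl : SameLabel (okS s .ess) (s.a .lab) i j
  · rw [← hl _ (hsucc i hsl.1) _ (hs.ok j (hess j hsl.2.1)).2.1]
    have e2 := e1.mpr hsl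
    simp [rightTest, e2, hsl, pairE, hs.mul _ (hsucc i hsl.1)]
  · have e2 : (same .ess).eval I (s.at₂ i j) = 0 := by
      by_contra h; exact hsl (e1.mp h)
    simp [rightTest, e2, hsl]

end

lemma Ready.of_keeps {s s' : St} (hs : Ready s) (h : Keeps s s') : Ready s' where
  pos := by rw [h.v _ (by decide) (by decide) (by decide)]; exact hs.pos
  sq := by
    rw [h.v _ (by decide) (by decide) (by decide), h.v _ (by decide) (by decide) (by decide)]
    exact hs.sq
  dbl := by
    rw [h.v _ (by decide) (by decide) (by decide), h.v _ (by decide) (by decide) (by decide)]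
    exact hs.dbl
  le := by
    rw [h.v _ (by decide) (by decide) (by decide), h.v _ (by decide) (by decide) (by decide)]
    exact hs.le
  mul := by
    rw [h.v _ (by decide) (by decide) (by decide), h.a _ (by decide)]
    exact hs.mul
  ok := by
    simp only [okS]
    rw [h.v .pw (by decide) (by decide) (by decide), h.v .n (by decide) (by decide) (by decide),
      h.a _ (by decide), h.a _ (by decide), h.a _ (by decide), h.a _ (by decide)]
    exact hs.ok

/-- What the decision program computes. -/
theorem run_core {s : St} (hs : Ready s) :
    (Set.BijOn (s.a .lab ∘ ·) (walks (okS s .ok) (s.a .src) (s.a .tgt))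
      (walks (· < s.v .n) (srcHS I s) (tgtHS I s)) → (coreCmd.run I s).v .res = 1) ∧
    (¬ Set.BijOn (s.a .lab ∘ ·) (walks (okS s .ok) (s.a .src) (s.a .tgt))
      (walks (· < s.v .n) (srcHS I s) (tgtHS I s)) → (coreCmd.run I s).v .res = 0) := by
  simp only [coreCmd, run_block_cons, run_block_nil]
  set s₁ := pastCmd.run I s with e₁
  set s₂ := futCmd.run I s₁ with e₂
  set s₃ := essCmd.run I s₂ with e₃
  set s₄ := predCmd.run I s₃ with e₄
  set s₅ := succCmd.run I s₄ with e₅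
  set s₆ := injCmd.run I s₅ with e₆
  set s₇ := mapCmd.run I s₆ with e₇
  set s₈ := leftCmd.run I s₇ with e₈
  set s₉ := rightCmd.run I s₈ with e₉
  set t₀ := hfutCmd.run I s₉ with f₀
  set t₁ := hpastCmd.run I t₀ with f₁
  set t₂ := hitCmd.run I t₁ with f₂
  set t₃ := badHitCmd.run I t₂ with f₃
  set t₄ := countCmd.run I t₃ with f₄
  have k₁ : Keeps s s₁ := (Keeps.refl s).run _ (by intro x; cases x <;> decide)
    (by intro A; cases A <;> decide)
  have k₂ : Keeps s s₂ := k₁.run _ (by intro x; cases x <;> decide)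
    (by intro A; cases A <;> decide)
  have k₃ : Keeps s s₃ := k₂.run _ (by intro x; cases x <;> decide)
    (by intro A; cases A <;> decide)
  have k₄ : Keeps s s₄ := k₃.run _ (by intro x; cases x <;> decide)
    (by intro A; cases A <;> decide)
  have k₅ : Keeps s s₅ := k₄.run _ (by intro x; cases x <;> decide)
    (by intro A; cases A <;> decide)
  have k₆ : Keeps s s₆ := k₅.run _ (by intro x; cases x <;> decide)
    (by intro A; cases A <;> decide)
  have k₇ : Keeps s s₇ := k₆.run _ (by intro x; cases x <;> decide)
    (by intro A; cases A <;> decide)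
  have k₈ : Keeps s s₈ := k₇.run _ (by intro x; cases x <;> decide)
    (by intro A; cases A <;> decide)
  have k₉ : Keeps s s₉ := k₈.run _ (by intro x; cases x <;> decide)
    (by intro A; cases A <;> decide)
  have l₀ : Keeps s t₀ := k₉.run _ (by intro x; cases x <;> decide)
    (by intro A; cases A <;> decide)
  have l₁ : Keeps s t₁ := l₀.run _ (by intro x; cases x <;> decide)
    (by intro A; cases A <;> decide)
  have l₂ : Keeps s t₂ := l₁.run _ (by intro x; cases x <;> decide)
    (by intro A; cases A <;> decide)
  have l₃ : Keeps s t₃ := l₂.run _ (by intro x; cases x <;> decide)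
    (by intro A; cases A <;> decide)
  -- Each stage is specified relative to the state in which it starts. As sizes and given arrays
  -- never change, all these specifications are transported back to `s`.
  have hpw : ∀ {s'}, Keeps s s' → s'.v .pw = s.v .pw := fun h =>
    h.v _ (by decide) (by decide) (by decide)
  have hn : ∀ {s'}, Keeps s s' → s'.v .n = s.v .n := fun h =>
    h.v _ (by decide) (by decide) (by decide)
  have hm : ∀ {s'}, Keeps s s' → s'.v .m = s.v .m := fun h =>
    h.v _ (by decide) (by decide) (by decide)
  have hsrc : ∀ {s'}, Keeps s s' → s'.a .src = s.a .src := fun h => h.a _ (by decide)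
  have htgt : ∀ {s'}, Keeps s s' → s'.a .tgt = s.a .tgt := fun h => h.a _ (by decide)
  have hlab : ∀ {s'}, Keeps s s' → s'.a .lab = s.a .lab := fun h => h.a _ (by decide)
  have hok : ∀ {s'}, Keeps s s' → okS s' .ok = okS s .ok := fun h => by
    funext i
    rw [okS, okS, hpw h, h.a _ (by decide)]
  have hsH : ∀ {s'}, Keeps s s' → srcHS I s' = srcHS I s := fun h => by
    funext i
    rw [srcHS, srcHS, hm h]
  have htH : ∀ {s'}, Keeps s s' → tgtHS I s' = tgtHS I s := fun h => by
    funext i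
    rw [tgtHS, tgtHS, hm h, hn h]
  set ok := okS s .ok with dok
  set src := s.a .src
  set tgt := s.a .tgt
  set lab := s.a .lab
  set N := s.v .pw
  set B := Essential ok src tgt lab with dB
  have hp : ∀ a < N, ∀ b < N, s₁.a .past (a * N + b) ≠ 0 ↔ PastPair ok src tgt lab a b :=
    fun a ha b hb => run_past hs ha hb
  have hf : ∀ a < N, ∀ b < N, s₂.a .fut (a * N + b) ≠ 0 ↔ FuturePair ok src tgt lab a b := by
    have h := @run_fut I s₁ (hs.of_keeps k₁)
    rw [hpw k₁, hok k₁, hsrc k₁, htgt k₁, hlab k₁] at h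
    exact fun a ha b hb => h ha hb
  have p2 : s₂.a .past = s₁.a .past := run_a I _ _ rfl
  have hess₃ : okS s₃ .ess = B := by
    have h := @run_ess I s₂ (hs.of_keeps k₂)
    rw [hpw k₂, hok k₂, hsrc k₂, htgt k₂, hlab k₂, p2] at h
    exact funext fun i => propext (h hp hf i)
  have hess : ∀ {s'}, Keeps s s' → s'.a .ess = s₃.a .ess → okS s' .ess = B := fun h h' => by
    rw [← hess₃]
    funext i
    rw [okS, okS, h', hpw h, hpw k₃]
  have hess₄ : okS s₄ .ess = B := hess k₄ (run_a I _ _ rfl)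
  have q₅ : s₅.a .ess = s₃.a .ess := (run_a I _ _ rfl).trans (run_a I _ _ rfl)
  have q₆ : s₆.a .ess = s₃.a .ess := (run_a I _ _ rfl).trans q₅
  have q₇ : s₇.a .ess = s₃.a .ess := (run_a I _ _ rfl).trans q₆
  have q₈ : s₈.a .ess = s₃.a .ess := (run_a I _ _ rfl).trans q₇
  have q₉ : s₉.a .ess = s₃.a .ess := (run_a I _ _ rfl).trans q₈
  have r₀ : t₀.a .ess = s₃.a .ess := (run_a I _ _ rfl).trans q₉
  have r₁ : t₁.a .ess = s₃.a .ess := (run_a I _ _ rfl).trans r₀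
  have r₂ : t₂.a .ess = s₃.a .ess := (run_a I _ _ rfl).trans r₁
  have r₃ : t₃.a .ess = s₃.a .ess := (run_a I _ _ rfl).trans r₂
  set pred := s₄.a .pred with dpred
  set succ := s₅.a .succ with dsucc
  have hpred : ∀ i, B i → B (pred i) ∧ tgt (pred i) = src i := by
    have h := @run_pred I s₃
    rw [hess₃, hok k₃, hsrc k₃, htgt k₃, hlab k₃] at h
    exact fun i hi => h (fun _ => Iff.rfl) hi
  have hsucc : ∀ i, B i → B (succ i) ∧ tgt i = src (succ i) := by
    have h := @run_succ I s₄
    rw [hess₄, hok k₄, hsrc k₄, htgt k₄, hlab k₄] at h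
    exact fun i hi => h (fun _ => Iff.rfl) hi
  have hBok : ∀ i, B i → ok i := fun i hi => hi.1
  have hBN : ∀ i, B i → i < N := fun i hi => hi.1.1
  have hrays : HasRays B src tgt pred succ := fun i hi => ⟨hpred i hi, hsucc i hi⟩
  have c1 : s₆.a .badInj 0 = 0 ↔ ¬ ∃ c d, c ≠ d ∧ B c ∧ B d ∧ lab c = lab d ∧
      PastPair ok src tgt lab (src c) (src d) ∧ FuturePair ok src tgt lab (tgt c) (tgt d) := by
    have h := @run_inj I s₅ (hs.of_keeps k₅)
    rw [hess k₅ q₅, hpw k₅, hok k₅, hsrc k₅, htgt k₅, hlab k₅,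
      show s₅.a .past = s₁.a .past from
        (run_a I _ _ rfl).trans ((run_a I _ _ rfl).trans ((run_a I _ _ rfl).trans p2)),
      show s₅.a .fut = s₂.a .fut from
        (run_a I _ _ rfl).trans ((run_a I _ _ rfl).trans (run_a I _ _ rfl))] at h
    exact h (fun _ => Iff.rfl) hp hf
  have c2 : s₇.a .badMap 0 = 0 ↔ ¬ ∃ c d, B c ∧ B d ∧ tgt c = src d ∧
      tgtHS I s (lab c) ≠ srcHS I s (lab d) := by
    have h := @run_map I s₆ (hs.of_keeps k₆).pos
    rwa [hess k₆ q₆, hsrc k₆, htgt k₆, hlab k₆, hsH k₆, htH k₆] at h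
  have u₇ : s₇.a .pred = pred :=
    (run_a I _ _ rfl).trans ((run_a I _ _ rfl).trans (run_a I _ _ rfl))
  have v₇ : s₇.a .succ = succ := (run_a I _ _ rfl).trans (run_a I _ _ rfl)
  have v₈ : s₈.a .succ = succ := (run_a I _ _ rfl).trans v₇
  have hl : ∀ a < N, ∀ b < N, s₈.a .left (a * N + b) ≠ 0 ↔
      PairPath (SameLabel B lab) id tgt pred src a b := by
    have h := @run_left I s₇ (hs.of_keeps k₇)
    rw [hess k₇ q₇, hok k₇, hpw k₇, hsrc k₇, htgt k₇, hlab k₇, u₇] at h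
    exact fun a ha b hb => h hBok (fun i hi => hBN _ (hpred i hi).1) ha hb
  have hr : ∀ a < N, ∀ b < N, s₉.a .right (a * N + b) ≠ 0 ↔
      PairPath (SameLabel B lab) id src succ tgt a b := by
    have h := @run_right I s₈ (hs.of_keeps k₈)
    rw [hess k₈ q₈, hok k₈, hpw k₈, hsrc k₈, htgt k₈, hlab k₈, v₈] at h
    exact fun a ha b hb => h hBok (fun i hi => hBN _ (hsucc i hi).1) ha hb
  have hhf : ∀ f < s.v .n, t₀.a .hfut f ≠ 0 ↔
      HasInfPath (Follows (· < s.v .n) (srcHS I s) (tgtHS I s)) f := by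
    have h := @run_hfut I s₉ (hs.of_keeps k₉)
    rw [hn k₉, hsH k₉, htH k₉] at h
    exact fun f hf => h hf
  have hhp : ∀ f < s.v .n, t₁.a .hpast f ≠ 0 ↔
      HasInfPath (fun c d => Follows (· < s.v .n) (srcHS I s) (tgtHS I s) d c) f := by
    have h := @run_hpast I t₀ (hs.of_keeps l₀)
    rw [hn l₀, hsH l₀, htH l₀] at h
    exact fun f hf => h hf
  have hhit : ∀ f < N, t₂.a .hit f ≠ 0 ↔ ∃ u, B u ∧ lab u = f := by
    have h := @run_hit I t₁
    rw [hess l₁ r₁, hpw l₁, hlab l₁] at h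
    exact fun f hf => h hf
  have c3 : t₃.a .badHit 0 = 0 ↔ ¬ ∃ f < s.v .n,
      HasInfPath (Follows (· < s.v .n) (srcHS I s) (tgtHS I s)) f ∧
      HasInfPath (fun c d => Follows (· < s.v .n) (srcHS I s) (tgtHS I s) d c) f ∧
      ¬ ∃ u, B u ∧ lab u = f := by
    have h := @run_badHit I t₂ (hs.of_keeps l₂)
    rw [hn l₂, show t₂.a .hfut = t₀.a .hfut from (run_a I _ _ rfl).trans (run_a I _ _ rfl),
      show t₂.a .hpast = t₁.a .hpast from run_a I _ _ rfl] at h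
    rw [h, not_iff_not]
    refine exists_congr fun f => and_congr_right fun hfn => ?_
    rw [hhf f hfn, hhp f hfn, ← hhit f (hfn.trans_le hs.le), ne_eq, not_not]
  have c4 : t₄.a .badCnt 0 = 0 ↔ ∀ j < N + N, mateCount N B src tgt lab succ
      ((stepVec N (Follows B src tgt))^[j] (mateVec N B src tgt lab pred)) =
      labelCount N B lab ((stepVec N (Follows (· < s.v .n) (srcHS I s) (tgtHS I s)))^[j]
        (labelVec N B lab)) := by
    have u₃ : t₃.a .pred = pred := (run_a I _ _ rfl).trans ((run_a I _ _ rfl).trans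
      ((run_a I _ _ rfl).trans ((run_a I _ _ rfl).trans ((run_a I _ _ rfl).trans
        ((run_a I _ _ rfl).trans u₇)))))
    have v₃ : t₃.a .succ = succ := (run_a I _ _ rfl).trans ((run_a I _ _ rfl).trans
      ((run_a I _ _ rfl).trans ((run_a I _ _ rfl).trans ((run_a I _ _ rfl).trans v₈))))
    have w₃ : t₃.a .left = s₈.a .left := (run_a I _ _ rfl).trans ((run_a I _ _ rfl).trans
      ((run_a I _ _ rfl).trans ((run_a I _ _ rfl).trans (run_a I _ _ rfl))))
    have x₃ : t₃.a .right = s₉.a .right := (run_a I _ _ rfl).trans ((run_a I _ _ rfl).trans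
      ((run_a I _ _ rfl).trans (run_a I _ _ rfl)))
    have hR₃ := hs.of_keeps l₃
    have hL := @eval_leftTest I t₃ hR₃
    have hR := @eval_rightTest I t₃ hR₃
    have h := @run_count I t₃ hR₃
    simp only [CountEq, vecGS, vecHS] at h
    rw [hess l₃ r₃, hok l₃, hpw l₃, hsrc l₃, htgt l₃, hlab l₃, u₃, w₃] at hL
    rw [hess l₃ r₃, hok l₃, hpw l₃, hsrc l₃, htgt l₃, hlab l₃, v₃, x₃] at hR
    rw [hess l₃ r₃, hpw l₃, hn l₃, hsH l₃, htH l₃, hsrc l₃, htgt l₃, hlab l₃, u₃, v₃] at h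
    exact h (fun i hi j hj => hL hBok (fun i hi => hBN _ (hpred i hi).1) hl hi hj)
      (fun i hi j hj => hR hBok (fun i hi => hBN _ (hsucc i hi).1) hr hi hj)
  rw [bijOn_walks_iff (pred := pred) (succ := succ) (fun i (hi : ok i) => hi.1) hs.le hrays
    (fun i hi => (hs.ok i hi).2.2), ← dB, ← c1, ← c2, ← c3, ← c4]
  have d1 : t₄.a .badInj = s₆.a .badInj := (run_a I _ _ rfl).trans ((run_a I _ _ rfl).trans
    ((run_a I _ _ rfl).trans ((run_a I _ _ rfl).trans ((run_a I _ _ rfl).trans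
      ((run_a I _ _ rfl).trans ((run_a I _ _ rfl).trans (run_a I _ _ rfl)))))))
  have d2 : t₄.a .badMap = s₇.a .badMap := (run_a I _ _ rfl).trans ((run_a I _ _ rfl).trans
    ((run_a I _ _ rfl).trans ((run_a I _ _ rfl).trans ((run_a I _ _ rfl).trans
      ((run_a I _ _ rfl).trans (run_a I _ _ rfl))))))
  have d3 : t₄.a .badHit = t₃.a .badHit := run_a I _ _ rfl
  rw [← d1, ← d2, ← d3]
  have hres : (resCmd.run I t₄).v .res = if (t₄.a .badInj 0 + t₄.a .badMap 0) +
      (t₄.a .badHit 0 + t₄.a .badCnt 0) = 0 then 1 else 0 := by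
    simp only [resCmd, Cmd.run, St.setV_v_self]
    rfl
  rw [hres]
  constructor
  · rintro ⟨h1, h2, h3, h4⟩
    simp [h1, h2, h3, h4]
  · intro h
    rw [if_neg]
    intro h0
    exact h ⟨by omega, by omega, by omega, by omega⟩

end Core
end LoopLang

/-! ### Conjugacies are bijections -/

section Conjugacy

variable {V E W F : Type*} (G : DirMultigraph V E) (H : DirMultigraph W F) {k : ℕ}

lemma shift_mem_edgeShift {x : ℤ → E} (hx : x ∈ G.edgeShift) (a : ℤ) :
    (fun i => x (i + a)) ∈ G.edgeShift := by
  intro i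
  have := hx (i + a)
  rw [add_right_comm] at this
  exact this

variable {G H} (Φ : shiftBlocks G.edgeShift k → F)

lemma slidingBlockCode_eq (mem : ℤ) (x : G.edgeShift) (i : ℤ) :
    slidingBlockCode G.edgeShift mem Φ x i = slidingBlockCode G.edgeShift 0 Φ x (i - mem) := by
  simp only [slidingBlockCode, sub_zero]

lemma slidingBlockCode_shift (x : G.edgeShift) (a i : ℤ) :
    slidingBlockCode G.edgeShift 0 Φ ⟨_, shift_mem_edgeShift G x.2 a⟩ i =
      slidingBlockCode G.edgeShift 0 Φ x (i + a) := by
  simp only [slidingBlockCode, sub_zero]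
  congr 2
  funext j
  exact congrArg x.1 (by ring)

/-- Compactness: the symbol at `0` is determined by a finite part of the image. -/
lemma exists_window [Finite E] (hinj : Function.Injective (slidingBlockCode G.edgeShift 0 Φ)) :
    ∃ r : ℕ, ∀ x x' : G.edgeShift, (∀ i : ℤ, |i| ≤ r → slidingBlockCode G.edgeShift 0 Φ x i =
      slidingBlockCode G.edgeShift 0 Φ x' i) → x.1 0 = x'.1 0 := by
  classical
  by_contra! hcon
  let : TopologicalSpace E := ⊥
  have : DiscreteTopology E := ⟨rfl⟩
  -- The block map is extended to all words with the value `none`, so that equality of images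
  -- becomes a closed condition on arbitrary pairs of sequences.
  set T : (Fin k → E) → Option F := fun w =>
    if h : w ∈ shiftBlocks G.edgeShift k then some (Φ ⟨w, h⟩) else none with hT
  have hTx : ∀ (x : G.edgeShift) (i : ℤ), T (fun j => x.1 (i + (j : ℤ))) =
      some (slidingBlockCode G.edgeShift 0 Φ x i) := by
    intro x i
    simp only [hT, slidingBlockCode, sub_zero]
    rw [dif_pos ⟨x.1, x.2, i, fun _ => rfl⟩]
  set K : ℕ → Set ((ℤ → E) × (ℤ → E)) := fun r =>
    {z | z.1 ∈ G.edgeShift ∧ z.2 ∈ G.edgeShift ∧ z.1 0 ≠ z.2 0 ∧ ∀ i : ℤ, |i| ≤ r →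
      T (fun j => z.1 (i + (j : ℤ))) = T (fun j => z.2 (i + (j : ℤ)))} with hK
  have hshift : IsClosed G.edgeShift := by
    have : G.edgeShift = ⋂ i : ℤ, {x | G.tgt (x i) = G.src (x (i + 1))} := by
      ext x; simp [DirMultigraph.edgeShift]
    rw [this]
    refine isClosed_iInter fun i => ?_
    have hc : Continuous fun x : ℤ → E => (x i, x (i + 1)) := by fun_prop
    exact (isClosed_discrete {p : E × E | G.tgt p.1 = G.src p.2}).preimage hc
  have hclosed : ∀ r, IsClosed (K r) := by
    intro r
    refine (hshift.preimage continuous_fst).inter ((hshift.preimage continuous_snd).inter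
      (IsClosed.inter ?_ ?_))
    · have hc : Continuous fun z : (ℤ → E) × (ℤ → E) => (z.1 0, z.2 0) := by fun_prop
      exact (isClosed_discrete {p : E × E | p.1 ≠ p.2}).preimage hc
    · have : {z : (ℤ → E) × (ℤ → E) | ∀ i : ℤ, |i| ≤ r →
          T (fun j => z.1 (i + (j : ℤ))) = T (fun j => z.2 (i + (j : ℤ)))} = ⋂ i : ℤ,
          {z | |i| ≤ r → T (fun j => z.1 (i + (j : ℤ))) = T (fun j => z.2 (i + (j : ℤ)))} := by
        ext z; simp
      have h2 : IsClosed {z : (ℤ → E) × (ℤ → E) | ∀ i : ℤ, |i| ≤ r →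
          T (fun j => z.1 (i + (j : ℤ))) = T (fun j => z.2 (i + (j : ℤ)))} := by
        rw [this]
        refine isClosed_iInter fun i => ?_
        have hc : Continuous fun z : (ℤ → E) × (ℤ → E) =>
            ((fun j : Fin k => z.1 (i + (j : ℤ))), fun j : Fin k => z.2 (i + (j : ℤ))) := by
          fun_prop
        exact (isClosed_discrete {p : (Fin k → E) × (Fin k → E) |
          |i| ≤ r → T p.1 = T p.2}).preimage hc
      exact h2
  -- A common point of the nested sets is a pair of points that differ at `0` and have the same
  -- image, against injectivity.
  obtain ⟨z, hz⟩ := IsCompact.nonempty_iInter_of_sequence_nonempty_isCompact_isClosed K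
    (fun r z hz => ⟨hz.1, hz.2.1, hz.2.2.1, fun i hi => hz.2.2.2 i
      (hi.trans (by push_cast; linarith))⟩)
    (fun r => by
      obtain ⟨x, x', h1, h2⟩ := hcon r
      exact ⟨(x.1, x'.1), x.2, x'.2, h2, fun i hi => by rw [hTx, hTx, h1 i hi]⟩)
    (hclosed 0).isCompact hclosed
  rw [Set.mem_iInter] at hz
  have h0 := hz 0
  have heq : (⟨z.1, h0.1⟩ : G.edgeShift) = ⟨z.2, h0.2.1⟩ := hinj <| funext fun i => by
    have := (hz i.natAbs).2.2.2 i (by rw [Int.abs_eq_natAbs])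
    rw [hTx ⟨z.1, h0.1⟩, hTx ⟨z.2, h0.2.1⟩] at this
    exact Option.some_injective _ this
  exact h0.2.2.1 (congrFun (congrArg Subtype.val heq) 0)

/-- A block code between edge shifts is a conjugacy if and only if it is a bijection. -/
theorem isBlockConjugacy_iff [Finite E] (mem : ℤ) :
    IsBlockConjugacy G.edgeShift H.edgeShift mem Φ ↔
      (∀ x, slidingBlockCode G.edgeShift 0 Φ x ∈ H.edgeShift) ∧
      Function.Injective (slidingBlockCode G.edgeShift 0 Φ) ∧
      ∀ y ∈ H.edgeShift, ∃ x, slidingBlockCode G.edgeShift 0 Φ x = y := by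
  have hfun : ∀ x, slidingBlockCode G.edgeShift mem Φ x =
      fun i => slidingBlockCode G.edgeShift 0 Φ x (i + -mem) := fun x =>
    funext fun i => slidingBlockCode_eq Φ mem x i
  have hfun' : ∀ x, slidingBlockCode G.edgeShift 0 Φ x =
      fun i => slidingBlockCode G.edgeShift mem Φ x (i + mem) := fun x =>
    funext fun i => by rw [slidingBlockCode_eq Φ mem]; simp
  constructor
  · rintro ⟨hf, l, -, mem', Ψ, hg, h1, h2⟩
    refine ⟨fun x => ?_, fun x x' hxx => ?_, fun y hy => ?_⟩
    · rw [hfun']; exact shift_mem_edgeShift H (hf x) mem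
    · have : slidingBlockCode G.edgeShift mem Φ x = slidingBlockCode G.edgeShift mem Φ x' := by
        rw [hfun, hfun, hxx]
      apply Subtype.ext
      rw [← h1 x, ← h1 x']
      congr 2
    · refine ⟨⟨_, hg ⟨_, shift_mem_edgeShift H hy (-mem)⟩⟩, ?_⟩
      rw [hfun', h2]
      simp
  · rintro ⟨hf0, hinj, hsurj⟩
    have hf : ∀ x, slidingBlockCode G.edgeShift mem Φ x ∈ H.edgeShift := fun x => by
      rw [hfun]; exact shift_mem_edgeShift H (hf0 x) (-mem)
    have hs : ∀ y : H.edgeShift, ∃ x, slidingBlockCode G.edgeShift mem Φ x = y.1 := by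
      intro y
      obtain ⟨x, hx⟩ := hsurj _ (shift_mem_edgeShift H y.2 mem)
      exact ⟨x, by rw [hfun, hx]; simp⟩
    choose g hg using hs
    obtain ⟨r, hr⟩ := exists_window Φ hinj
    -- Shift invariance moves the window of `exists_window` to any position; the memory displaces it
    -- by `mem`.
    have hwin : ∀ (y y' : H.edgeShift) (i i' : ℤ), (∀ t : ℤ, |t| ≤ r →
        y.1 (i + mem + t) = y'.1 (i' + mem + t)) → (g y).1 i = (g y').1 i' := by
      intro y y' i i' h
      have := hr ⟨_, shift_mem_edgeShift G (g y).2 i⟩ ⟨_, shift_mem_edgeShift G (g y').2 i'⟩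
        (fun t ht => by
          rw [slidingBlockCode_shift, slidingBlockCode_shift, hfun', hfun', hg, hg]
          have := h t ht
          rwa [show i + mem + t = t + i + mem by ring, show i' + mem + t = t + i' + mem by ring]
            at this)
      simpa using this
    -- The inverse block map uses any point `Y w` in which the block occurs, at any position `P w`:
    -- by `hwin` the preimage has the same symbol at the centre of the block, up to the displacement
    -- by `mem`, for every choice.
    choose Y hY P hP using fun w : shiftBlocks H.edgeShift (2 * r + 1) => w.2
    have hgy : ∀ y : H.edgeShift, slidingBlockCode H.edgeShift (r - mem)
        (fun w => (g ⟨Y w, hY w⟩).1 (P w + r - mem)) y = (g y).1 := by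
      intro y
      funext i
      simp only [slidingBlockCode]
      set w : shiftBlocks H.edgeShift (2 * r + 1) := ⟨fun j => y.1 (i - (r - mem) + (j : ℤ)),
        y.1, y.2, i - (r - mem), fun _ => rfl⟩ with hw
      refine hwin _ _ _ _ fun t ht => ?_
      rw [abs_le] at ht
      have hj : (t + r).toNat < 2 * r + 1 := by omega
      have := hP w ⟨(t + r).toNat, hj⟩
      have hj' : ((t + r).toNat : ℤ) = t + r := by omega
      simp only [hw, hj'] at this
      rw [show P w + r - mem + mem + t = P w + (t + r) by ring,
        show i + mem + t = i - (r - mem) + (t + r) by ring]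
      exact this.symm
    refine ⟨hf, 2 * r + 1, by omega, r - mem, _, fun y => by rw [hgy]; exact (g y).2,
      fun x => ?_, fun y => ?_⟩
    · rw [hgy]
      congr 1
      apply hinj
      rw [hfun', hfun', hg]
    · simp only [hgy]
      exact hg y

end Conjugacy

/-! ### Coding of words -/

section Codes

/-- The code of the word of length `k` at position `i`. -/
def wordCode (m k : ℕ) (x : ℤ → ℕ) (i : ℤ) : ℕ := ∑ j ∈ range k, x (i + j) * m ^ j

lemma wordCode_lt {m k : ℕ} {x : ℤ → ℕ} (hx : ∀ i, x i < m) (i : ℤ) : wordCode m k x i < m ^ k := by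
  induction k with
  | zero => simp [wordCode]
  | succ k ih =>
    have h1 : x (i + k) * m ^ k + m ^ k ≤ m ^ (k + 1) := by
      have := Nat.mul_le_mul_right (m ^ k) (hx (i + k))
      rw [pow_succ']
      linarith [Nat.succ_mul (x (i + k)) (m ^ k)]
    rw [wordCode, sum_range_succ]
    have h2 : ∑ j ∈ range k, x (i + j) * m ^ j < m ^ k := ih
    omega

/-- The first letter is the least significant digit. Hence division by `m` drops the first letter,
and the remainder modulo `m ^ k` drops the last one. -/
lemma wordCode_succ (m k : ℕ) (x : ℤ → ℕ) (i : ℤ) :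
    wordCode m (k + 1) x i = m * wordCode m k x (i + 1) + x i := by
  rw [wordCode, sum_range_succ', wordCode, mul_sum]
  simp only [Nat.cast_zero, add_zero, pow_zero, mul_one, Nat.cast_add, Nat.cast_one]
  congr 1
  refine sum_congr rfl fun j _ => ?_
  rw [show i + (j + 1 : ℤ) = i + 1 + j by ring, pow_succ']
  ring

lemma wordCode_succ' (m k : ℕ) (x : ℤ → ℕ) (i : ℤ) :
    wordCode m (k + 1) x i = m ^ k * x (i + k) + wordCode m k x i := by
  rw [wordCode, sum_range_succ, wordCode]
  ring

lemma wordCode_succ_div {m k : ℕ} {x : ℤ → ℕ} (hx : ∀ i, x i < m) (i : ℤ) :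
    wordCode m (k + 1) x i / m = wordCode m k x (i + 1) := by
  have hm : 0 < m := (Nat.zero_le _).trans_lt (hx 0)
  rw [wordCode_succ, Nat.mul_add_div hm, Nat.div_eq_of_lt (hx i), add_zero]

lemma wordCode_succ_mod {m k : ℕ} {x : ℤ → ℕ} (hx : ∀ i, x i < m) (i : ℤ) :
    wordCode m (k + 1) x i % m = x i := by
  rw [wordCode_succ, Nat.mul_add_mod, Nat.mod_eq_of_lt (hx i)]

lemma wordCode_succ_mod_pow {m k : ℕ} {x : ℤ → ℕ} (hx : ∀ i, x i < m) (i : ℤ) :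
    wordCode m (k + 1) x i % m ^ k = wordCode m k x i := by
  rw [wordCode_succ', Nat.mul_add_mod, Nat.mod_eq_of_lt (wordCode_lt hx i)]

/-- A sequence of overlapping codes is the sequence of the codes of its first letters. -/
lemma eq_wordCode {m k : ℕ} {z : ℤ → ℕ} (hz : ∀ i, z i < m ^ (k + 1))
    (h : ∀ i, z i / m = z (i + 1) % m ^ k) (i : ℤ) :
    z i = wordCode m (k + 1) (fun i => z i % m) i := by
  -- Induction on the number of low digits, for all positions at once: the next digits at `i` are
  -- the low digits at `i + 1`.
  have key : ∀ l ≤ k, ∀ i, z i % m ^ (l + 1) = wordCode m (l + 1) (fun i => z i % m) i := by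
    intro l
    induction l with
    | zero => intro _ i; simp [wordCode]
    | succ l ih =>
      intro hl i
      have h1 : z (i + 1) % m ^ k % m ^ (l + 1) = z (i + 1) % m ^ (l + 1) :=
        Nat.mod_mod_of_dvd _ (pow_dvd_pow m hl)
      rw [wordCode_succ, ← ih (by omega), ← h1, ← h, pow_succ' m (l + 1), Nat.mod_mul]
      ring
  rw [← key k le_rfl, Nat.mod_eq_of_lt (hz i)]

end Codes

/-! ### Higher block presentations -/

section Presentation

variable {p m q n k : ℕ} {G : DirMultigraph (Fin p) (Fin m)} {H : DirMultigraph (Fin q) (Fin n)}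

/-- The functions `s`, `t` on natural numbers give the ends of the edges. -/
def Codes {p m : ℕ} (G : DirMultigraph (Fin p) (Fin m)) (s t : ℕ → ℕ) : Prop :=
  ∀ f : Fin m, s f = (G.src f : ℕ) ∧ t f = (G.tgt f : ℕ)

lemma mem_walks_iff_edgeShift {s t : ℕ → ℕ} (h : Codes G s t) {x : ℤ → ℕ} :
    x ∈ walks (· < m) s t ↔ ∃ y ∈ G.edgeShift, x = fun i => (y i : ℕ) := by
  constructor
  · intro hx
    refine ⟨fun i => ⟨x i, (hx i).1⟩, fun i => ?_, rfl⟩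
    apply Fin.ext
    rw [← (h _).2, ← (h _).1]
    exact (hx i).2
  · rintro ⟨y, hy, rfl⟩ i
    exact ⟨(y i).2, by rw [(h _).2, (h _).1, hy i]⟩

/-- The walks on an edge-labelled graph are the sequences of codes of walks on `G` of which all
labels are admissible. -/
def Presents (m k n : ℕ) (s t : ℕ → ℕ) (ok : ℕ → Prop) (src tgt lab : ℕ → ℕ) : Prop :=
  ∀ z, z ∈ walks ok src tgt ↔
    ∃ x ∈ walks (· < m) s t, z = wordCode m k x ∧ ∀ i, lab (z i) < n

/-- The vertices are the words of length `k + 1`, and the overlap of consecutive words is built into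
the ends `c % m ^ (k + 1)` and `c / m`. Only the first two letters of a word need to be composable,
since every pair of consecutive letters stands in front of some word. Table entries at words that do
not occur are arbitrary; the bound on labels discards those that are not edges of the target. -/
lemma presents_long {s t : ℕ → ℕ} {ok : ℕ → Prop} {src tgt lab : ℕ → ℕ}
    (hok : ∀ c, ok c ↔ c < m ^ (k + 2) ∧ t (c % m) = s (c / m % m) ∧ lab c < n)
    (hsrc : ∀ c < m ^ (k + 2), src c = c % m ^ (k + 1))
    (htgt : ∀ c < m ^ (k + 2), tgt c = c / m) : Presents m (k + 2) n s t ok src tgt lab := by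
  intro z
  constructor
  · intro hz
    have hlt : ∀ i, z i < m ^ (k + 2) := fun i => ((hok _).mp (hz i).1).1
    have hov : ∀ i, z i / m = z (i + 1) % m ^ (k + 1) := fun i => by
      rw [← htgt _ (hlt i), ← hsrc _ (hlt _), (hz i).2]
    have hm : 0 < m := by
      rcases Nat.eq_zero_or_pos m with rfl | h
      · have := hlt 0; simp at this
      · exact h
    refine ⟨fun i => z i % m, fun i => ⟨Nat.mod_lt _ hm, ?_⟩, funext (eq_wordCode hlt hov),
      fun i => ((hok _).mp (hz i).1).2.2⟩
    rw [((hok _).mp (hz i).1).2.1, hov, Nat.mod_mod_of_dvd _ (dvd_pow_self m (Nat.succ_ne_zero k))]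
  · rintro ⟨x, hx, rfl, hl⟩ i
    have hxm : ∀ i, x i < m := fun i => (hx i).1
    have hlt : ∀ i, wordCode m (k + 2) x i < m ^ (k + 2) := wordCode_lt hxm
    refine ⟨(hok _).mpr ⟨hlt i, ?_, hl i⟩, ?_⟩
    · rw [wordCode_succ_mod hxm, wordCode_succ_div hxm, wordCode_succ_mod hxm]
      exact (hx i).2
    · rw [htgt _ (hlt i), hsrc _ (hlt _), wordCode_succ_div hxm, wordCode_succ_mod_pow hxm]

/-- Vertex numbers of the input are not bounded in terms of the number of edges, so a vertex is
renamed as an edge that starts there. The condition `s (tgt c) = t c` removes edges into vertices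
without outgoing edges, which have no such name and lie on no walk. -/
lemma presents_one {s t : ℕ → ℕ} {ok : ℕ → Prop} {src tgt lab L : ℕ → ℕ}
    (hok : ∀ c, ok c ↔ c < m ∧ s (tgt c) = t c ∧ lab c < n)
    (hsrc : ∀ c < m, src c = L (s c)) (htgt : ∀ c < m, tgt c = L (t c))
    (hL : ∀ f < m, s (L (s f)) = s f) : Presents m 1 n s t ok src tgt lab := by
  have hw : ∀ x : ℤ → ℕ, wordCode m 1 x = x := fun x => by funext i; simp [wordCode]
  intro z
  constructor
  · intro hz
    have hlt : ∀ i, z i < m := fun i => ((hok _).mp (hz i).1).1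
    refine ⟨z, fun i => ⟨hlt i, ?_⟩, (hw z).symm, fun i => ((hok _).mp (hz i).1).2.2⟩
    rw [← ((hok _).mp (hz i).1).2.1, (hz i).2, hsrc _ (hlt _), hL _ (hlt _)]
  · rintro ⟨x, hx, rfl, hl⟩ i
    rw [hw] at hl ⊢
    refine ⟨(hok _).mpr ⟨(hx i).1, ?_, hl i⟩, ?_⟩
    · rw [htgt _ (hx i).1, (hx i).2, hL _ (hx (i + 1)).1]
    · rw [htgt _ (hx i).1, (hx i).2, hsrc _ (hx (i + 1)).1]

variable (Φ : shiftBlocks G.edgeShift k → Fin n)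

/-- Coding is a bijection from the points of the edge shift to the walks of the presentation and
turns the block code into reading labels. The bound on labels is automatic at words that occur. -/
lemma bijOn_iff_of_presents (hk : 1 ≤ k) {s t s' t' : ℕ → ℕ} (hG : Codes G s t)
    (hH : Codes H s' t') {ok : ℕ → Prop} {src tgt lab : ℕ → ℕ}
    (hP : Presents m k n s t ok src tgt lab)
    (hlab : ∀ (x : G.edgeShift) (i : ℤ), lab (wordCode m k (fun i => (x.1 i : ℕ)) i) =
      ((slidingBlockCode G.edgeShift 0 Φ x i : Fin n) : ℕ)) :
    Set.BijOn (lab ∘ ·) (walks ok src tgt) (walks (· < n) s' t') ↔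
      (∀ x, slidingBlockCode G.edgeShift 0 Φ x ∈ H.edgeShift) ∧
      Function.Injective (slidingBlockCode G.edgeShift 0 Φ) ∧
      ∀ y ∈ H.edgeShift, ∃ x, slidingBlockCode G.edgeShift 0 Φ x = y := by
  set code : G.edgeShift → ℤ → ℕ := fun x => wordCode m k fun i => (x.1 i : ℕ) with hcode
  have hmem : ∀ z, z ∈ walks ok src tgt ↔ ∃ x, z = code x := by
    intro z
    rw [hP]
    constructor
    · rintro ⟨x, hx, rfl, -⟩
      obtain ⟨y, hy, rfl⟩ := (mem_walks_iff_edgeShift hG).mp hx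
      exact ⟨⟨y, hy⟩, rfl⟩
    · rintro ⟨x, rfl⟩
      exact ⟨_, (mem_walks_iff_edgeShift hG).mpr ⟨x.1, x.2, rfl⟩, rfl, fun i => by
        rw [hlab]; exact Fin.is_lt _⟩
  have himg : ∀ x, lab ∘ code x = fun i => ((slidingBlockCode G.edgeShift 0 Φ x i : Fin n) : ℕ) := fun x =>
    funext fun i => hlab x i
  have hinjcode : Function.Injective code := by
    intro x y hxy
    -- The first letter is recovered as the remainder modulo `m`; this needs words that are not
    -- empty.
    obtain ⟨k, rfl⟩ := Nat.exists_eq_succ_of_ne_zero (by omega : k ≠ 0)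
    apply Subtype.ext
    funext i
    apply Fin.ext
    have := congrArg (· % m) (congrFun hxy i)
    simp only [hcode] at this
    rwa [wordCode_succ_mod (fun i => (x.1 i).2), wordCode_succ_mod (fun i => (y.1 i).2)] at this
  have hval : ∀ y y' : ℤ → Fin n, (fun i => (y i : ℕ)) = (fun i => (y' i : ℕ)) → y = y' :=
    fun y y' h => funext fun i => Fin.ext (congrFun h i)
  refine and_congr ?_ (and_congr ?_ ?_)
  · constructor
    · intro h x
      have h1 : lab ∘ code x ∈ walks (· < n) s' t' := h ((hmem _).mpr ⟨x, rfl⟩)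
      obtain ⟨y, hy, hxy⟩ := (mem_walks_iff_edgeShift hH).mp h1
      rw [himg] at hxy
      rwa [hval _ _ hxy]
    · intro h z hz
      obtain ⟨x, rfl⟩ := (hmem z).mp hz
      exact (mem_walks_iff_edgeShift hH).mpr ⟨_, h x, himg x⟩
  · constructor
    · intro h x y hxy
      refine hinjcode (h ((hmem _).mpr ⟨x, rfl⟩) ((hmem _).mpr ⟨y, rfl⟩) ?_)
      change lab ∘ code x = lab ∘ code y
      rw [himg, himg, hxy]
    · intro h z hz z' hz' hzz
      obtain ⟨x, rfl⟩ := (hmem z).mp hz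
      obtain ⟨y, rfl⟩ := (hmem z').mp hz'
      change lab ∘ code x = lab ∘ code y at hzz
      rw [himg, himg] at hzz
      rw [h (hval _ _ hzz)]
  · constructor
    · intro h y hy
      obtain ⟨z, hz, hzy⟩ := h ((mem_walks_iff_edgeShift hH).mpr ⟨y, hy, rfl⟩)
      obtain ⟨x, rfl⟩ := (hmem z).mp hz
      change lab ∘ code x = _ at hzy
      rw [himg] at hzy
      exact ⟨x, hval _ _ hzy⟩
    · intro h w hw
      obtain ⟨y, hy, rfl⟩ := (mem_walks_iff_edgeShift hH).mp hw
      obtain ⟨x, rfl⟩ := h y hy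
      exact ⟨code x, (hmem _).mpr ⟨x, rfl⟩, himg x⟩

end Presentation

/-! ### Degenerate cases -/

section Degenerate

variable {V E : Type*} {G : DirMultigraph V E}

lemma DirMultigraph.IsEssential.exists_walk (h : G.IsEssential) (e : E) :
    ∃ x ∈ G.edgeShift, x 0 = e := by
  choose out hout using fun v => (h v).1
  choose inn hinn using fun v => (h v).2
  set p : ℕ → E := fun i => (fun e => inn (G.src e))^[i + 1] e with hp
  set q : ℕ → E := fun i => (fun e => out (G.tgt e))^[i] e with hq
  refine ⟨fun i => match i with | Int.ofNat i => q i | Int.negSucc i => p i, ?_, rfl⟩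
  rintro (i | i)
  · change G.tgt (q i) = G.src (q (i + 1))
    simp only [hq, Function.iterate_succ_apply', hout]
  · cases i with
    | zero => exact hinn _
    | succ i =>
      change G.tgt (p (i + 1)) = G.src (p i)
      simp only [hp, Function.iterate_succ_apply' _ (i + 1), hinn]

variable {W : Type*} {k m n : ℕ} {H : DirMultigraph W (Fin n)}

/-- A target graph with too many edges. -/
lemma not_isBlockConjugacy_of_lt {G : DirMultigraph V (Fin m)} (hH : H.IsEssential)
    (hn : m ^ k < n) (mem : ℤ) (Φ : shiftBlocks G.edgeShift k → Fin n) :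
    ¬ IsBlockConjugacy G.edgeShift H.edgeShift mem Φ := by
  rw [isBlockConjugacy_iff]
  rintro ⟨-, -, hs⟩
  -- Every edge of an essential graph occurs in a point, and that point has a preimage, so the edge
  -- is a value of the block map.
  have hsurj : Function.Surjective Φ := by
    intro f
    obtain ⟨y, hy, rfl⟩ := hH.exists_walk f
    obtain ⟨x, rfl⟩ := hs y hy
    exact ⟨_, rfl⟩
  have h1 := Nat.card_le_card_of_surjective Φ hsurj
  have h2 := Nat.card_le_card_of_injective _
    (Subtype.val_injective (p := fun w => w ∈ shiftBlocks G.edgeShift k))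
  simp only [Nat.card_eq_fintype_card, Fintype.card_fin, Fintype.card_fun] at h1 h2
  exact absurd (h1.trans h2) (not_le.mpr hn)

lemma edgeShift_nonempty_iff {G : DirMultigraph V (Fin m)} (hm : m ≤ 1) :
    G.edgeShift.Nonempty ↔ ∃ e, G.src e = G.tgt e := by
  have : Subsingleton (Fin m) := Fin.subsingleton_iff_le_one.mpr hm
  constructor
  · rintro ⟨x, hx⟩
    exact ⟨x 0, by rw [hx 0]; congr 1; exact Subsingleton.elim _ _⟩
  · rintro ⟨e, he⟩
    exact ⟨fun _ => e, fun _ => he.symm⟩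

/-- A source graph with at most one edge. -/
lemma isBlockConjugacy_iff_of_le_one {G : DirMultigraph V (Fin m)} (hm : m ≤ 1)
    (hH : H.IsEssential ∨ n ≤ m ^ k) (mem : ℤ) (Φ : shiftBlocks G.edgeShift k → Fin n) :
    IsBlockConjugacy G.edgeShift H.edgeShift mem Φ ↔
      n ≤ 1 ∧ (G.edgeShift.Nonempty ↔ H.edgeShift.Nonempty) := by
  have hsm : Subsingleton (Fin m) := Fin.subsingleton_iff_le_one.mpr hm
  rw [isBlockConjugacy_iff]
  constructor
  · rintro ⟨hf, -, hs⟩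
    refine ⟨?_, fun ⟨x, hx⟩ => ⟨_, hf ⟨x, hx⟩⟩, fun ⟨y, hy⟩ => ?_⟩
    -- Any two edges of an essential `H` occur at position `0` of points, and both points are images
    -- of the only point of the source shift.
    · rcases hH with hH | hH
      · rw [← Fin.subsingleton_iff_le_one]
        refine ⟨fun f g => ?_⟩
        obtain ⟨y, hy, rfl⟩ := hH.exists_walk f
        obtain ⟨z, hz, rfl⟩ := hH.exists_walk g
        obtain ⟨x, rfl⟩ := hs y hy
        obtain ⟨x', rfl⟩ := hs z hz
        rw [Subsingleton.elim x x']
      · exact hH.trans (pow_le_one' hm k)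
    · obtain ⟨x, -⟩ := hs y hy
      exact ⟨x.1, x.2⟩
  · rintro ⟨hn, h⟩
    have hsn : Subsingleton (Fin n) := Fin.subsingleton_iff_le_one.mpr hn
    refine ⟨fun x => ?_, fun x y _ => Subsingleton.elim _ _, fun y hy => ?_⟩
    · obtain ⟨y, hy⟩ := h.mp ⟨x.1, x.2⟩
      rwa [Subsingleton.elim (slidingBlockCode G.edgeShift 0 Φ x) y]
    · obtain ⟨x, hx⟩ := h.mpr ⟨y, hy⟩
      exact ⟨⟨x, hx⟩, Subsingleton.elim _ _⟩

end Degenerate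

/-! ### Reading the input -/

section Input

variable {p m q n k : ℕ} (G : DirMultigraph (Fin p) (Fin m)) (H : DirMultigraph (Fin q) (Fin n))
  (table : (Fin k → Fin m) → ℕ)

lemma getD_encode_src (f : Fin m) : (encodeInstance k G H table).getD (5 + f) 0 = G.src f := by
  have := f.2
  simp [encodeInstance, DirMultigraph.encode, List.getD_eq_getElem?_getD, List.getElem?_append,
    add_comm 5]

lemma getD_encode_tgt (f : Fin m) : (encodeInstance k G H table).getD (5 + m + f) 0 = G.tgt f := by
  have := f.2
  have h1 : 5 + m + (f : ℕ) = (m + f) + 5 := by omega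
  simp [encodeInstance, DirMultigraph.encode, List.getD_eq_getElem?_getD, List.getElem?_append,
    h1]

lemma getD_encode_srcH (f : Fin n) :
    (encodeInstance k G H table).getD (5 + m + m + f) 0 = H.src f := by
  have := f.2
  have h1 : 5 + m + m + (f : ℕ) = (m + (m + f)) + 5 := by omega
  simp [encodeInstance, DirMultigraph.encode, List.getD_eq_getElem?_getD, List.getElem?_append,
    h1]

lemma getD_encode_tgtH (f : Fin n) :
    (encodeInstance k G H table).getD (5 + m + m + n + f) 0 = H.tgt f := by
  have := f.2
  have h1 : 5 + m + m + n + (f : ℕ) = (m + (m + (n + f))) + 5 := by omega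
  simp [encodeInstance, DirMultigraph.encode, List.getD_eq_getElem?_getD, List.getElem?_append,
    h1]

lemma getD_encode_table (c : Fin (m ^ k)) :
    (encodeInstance k G H table).getD (5 + m + m + n + n + c) 0 =
      table (finFunctionFinEquiv.symm c) := by
  have := c.2
  have h1 : 5 + m + m + n + n + (c : ℕ) = (m + (m + (n + (n + c)))) + 5 := by omega
  simp [encodeInstance, DirMultigraph.encode, List.getD_eq_getElem?_getD, h1]

/-- `finFunctionFinEquiv` also takes the first letter as least significant digit, so the word code
is directly the position in the table. -/
lemma getD_encode_wordCode (Φ : shiftBlocks G.edgeShift k → Fin n)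
    (ht : ∀ w : shiftBlocks G.edgeShift k, table w.1 = (Φ w : ℕ)) (x : G.edgeShift) (i : ℤ) :
    (encodeInstance k G H table).getD
        (5 + m + m + n + n + wordCode m k (fun i => (x.1 i : ℕ)) i) 0 =
      ((slidingBlockCode G.edgeShift 0 Φ x i : Fin n) : ℕ) := by
  have h1 : wordCode m k (fun i => (x.1 i : ℕ)) i =
      finFunctionFinEquiv (fun j : Fin k => x.1 (i + (j : ℤ))) := by
    rw [finFunctionFinEquiv_apply, wordCode, Finset.sum_range]
  rw [h1, getD_encode_table, Equiv.symm_apply_apply,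
    ht ⟨fun j => x.1 (i + (j : ℤ)), x.1, x.2, i, fun _ => rfl⟩]
  simp only [slidingBlockCode, sub_zero]

end Input

/-! ### Construction of the higher block presentation by the program -/

namespace LoopLang

namespace Core

open LoopLang.Expr LoopLang.Cmd

/-- Read the sizes. -/
def readCmd : Cmd := block [assign .k (.inp (.lit 0)), assign .m (.inp (.lit 2)),
  assign .n (.inp (.lit 4))]

/-- Compute `pw = m ^ k` and `pw' = m ^ (k - 1)`. -/
def powCmd : Cmd := block [assign .pw (.lit 1), loop .i .k (block [assign .pw' (.var .pw),
  assign .t (.lit 0), loop .j .m (assign .t (.add (.var .t) (.var .pw))),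
  assign .pw (.var .t)])]

/-- `A[c] := c * x` -/
def multiples (A : Arr) (x : Var) : Cmd := accum .pw .pw A (lt d c) c (.var x)

/-- Compute multiplication tables. -/
def tableCmd : Cmd := block [multiples .mulP .pw, multiples .mulM .m, multiples .mulP' .pw',
  assign .sq (.add (.arr .mulP (.sub (.var .pw) (.lit 1))) (.var .pw)),
  assign .dbl (.add (.var .pw) (.var .pw))]

/-- Initial vertices in the source graph. -/
def srcG (e : Expr) : Expr := .inp (.add (.lit 5) e)
/-- Terminal vertices in the source graph. -/
def tgtG (e : Expr) : Expr := .inp (.add (.add (.lit 5) (.var .m)) e)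
/-- The table of the block map. -/
def entry (e : Expr) : Expr := .inp (.add (.add (.add (.add (.add (.lit 5) (.var .m)) (.var .m))
  (.var .n)) (.var .n)) e)

/-- The presentation by words of length one. -/
def oneCmd : Cmd := block [select .pw .pw .src (eq (srcG d) (srcG c)),
  select .pw .pw .tgt (eq (srcG d) (tgtG c)), fill .pw .lab (entry c),
  fill .pw .ok (and (eq (srcG (.arr .tgt c)) (tgtG c)) (lt (.arr .lab c) (.var .n)))]

/-- The presentation by longer words. -/
def longCmd : Cmd := block [accum .pw' .m .tgt (.lit 1) (.add (.arr .mulM c) d) c,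
  accum .pw' .m .fst (.lit 1) (.add (.arr .mulM c) d) d,
  accum .m .pw' .src (.lit 1) (.add (.arr .mulP' c) d) d, fill .pw .lab (entry c),
  fill .pw .ok (and (eq (tgtG (.arr .fst c)) (srcG (.arr .fst (.arr .tgt c))))
    (lt (.arr .lab c) (.var .n)))]

/-- The higher block presentation. -/
def wordsCmd : Cmd := Cmd.ite (.sub (.var .k) (.lit 1)) longCmd oneCmd

/-- The case of a source graph with at most one edge. -/
def smallCmd : Cmd := assign .res (.ite (.sub (.var .n) (.lit 1)) (.lit 0)
  (eq (.ite (.var .m) (eq (srcG (.lit 0)) (tgtG (.lit 0))) (.lit 0))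
    (.ite (.var .n) (eq (srcH (.lit 0)) (tgtH (.lit 0))) (.lit 0))))

/-- Initial vertices, as read from the input. -/
def srcGS (I : List ℕ) (f : ℕ) : ℕ := I.getD (5 + f) 0
/-- Terminal vertices, as read from the input. -/
def tgtGS (I : List ℕ) (s : St) (f : ℕ) : ℕ := I.getD (5 + s.v .m + f) 0
/-- The table of the block map, as read from the input. -/
def entryS (I : List ℕ) (s : St) (f : ℕ) : ℕ :=
  I.getD (5 + s.v .m + s.v .m + s.v .n + s.v .n + f) 0

variable (I : List ℕ) (s : St)

/-- Multiplication by `m` is repeated addition, and `pw'` keeps the power of the round before; it is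
therefore meaningful only after at least one round. -/
lemma run_pow : (powCmd.run I s).v .pw = s.v .m ^ s.v .k ∧
    (1 ≤ s.v .k → (powCmd.run I s).v .pw' = s.v .m ^ (s.v .k - 1)) := by
  have key := run_loop_induction I (x := .i) (b := .k) (P := block [assign .pw' (.var .pw),
      assign .t (.lit 0), loop .j .m (assign .t (.add (.var .t) (.var .pw))),
      assign .pw (.var .t)]) (s := s.setV .pw 1)
    (J := fun i s' => s'.v .m = s.v .m ∧ s'.v .pw = s.v .m ^ i ∧
      (1 ≤ i → s'.v .pw' = s.v .m ^ (i - 1)))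
    ⟨by rw [St.setV_v_of_ne _ _ (by decide)], by simp, by simp⟩ (by
      rintro i - s' ⟨h1, h2, h3⟩
      simp only [run_block_cons, run_block_nil]
      set s₁ := (assign .t (.lit 0)).run I ((assign .pw' (.var .pw)).run I (s'.setV .i i)) with hs₁
      set s₂ := (loop .j .m (assign .t (.add (.var .t) (.var .pw)))).run I s₁ with hs₂
      have m₁ : s₁.v .m = s.v .m := by
        rw [hs₁, run_v I _ _ rfl, run_v I _ _ rfl, St.setV_v_of_ne _ _ (by decide), h1]
      have p₁ : s₁.v .pw = s.v .m ^ i := by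
        rw [hs₁, run_v I _ _ rfl, run_v I _ _ rfl, St.setV_v_of_ne _ _ (by decide), h2]
      have q₁ : s₁.v .pw' = s.v .m ^ i := by
        rw [hs₁, run_v I _ _ rfl]
        simp only [run, St.setV_v_self, eval_var]
        rw [St.setV_v_of_ne _ _ (by decide), h2]
      have key := run_loop_induction I (x := .j) (b := .m)
        (P := assign .t (.add (.var .t) (.var .pw))) (s := s₁)
        (J := fun j s' => s'.v .pw = s.v .m ^ i ∧ s'.v .t = j * s.v .m ^ i)
        ⟨p₁, by rw [hs₁]; simp [run]⟩ (by
          rintro j - s' ⟨h1, h2⟩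
          constructor
          · rw [run_v I _ _ rfl, St.setV_v_of_ne _ _ (by decide), h1]
          · simp only [run, St.setV_v_self, eval_add, eval_var]
            rw [St.setV_v_of_ne _ _ (by decide), St.setV_v_of_ne _ _ (by decide), h1, h2]
            ring)
      rw [← hs₂, m₁] at key
      refine ⟨?_, ?_, fun _ => ?_⟩
      · rw [run_v I _ _ rfl, hs₂, run_v I _ _ rfl, m₁]
      · simp only [run, St.setV_v_self, eval_var, key.2]
        ring
      · rw [run_v I _ _ rfl, hs₂, run_v I _ _ rfl, q₁]
        rfl)
  rw [St.setV_v_of_ne _ _ (by decide)] at key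
  exact key.2

variable {s}

lemma run_multiples {A : Arr} {x : Var} (hx : x ≠ .c ∧ x ≠ .d) {a : ℕ} (ha : a < s.v .pw)
    (h0 : s.a A a = 0) : ((multiples A x).run I s).a A a = a * s.v x := by
  rw [multiples, run_accum I _ _ _ _ _ _ _ (by decide) rfl rfl rfl, h0, zero_add,
    sum_eq_single a]
  · have : ∀ j, (if (lt d c).eval I (s.at₂ a j) ≠ 0 ∧ c.eval I (s.at₂ a j) = a then
        (Expr.var x).eval I (s.at₂ a j) else 0) = if j < a then s.v x else 0 := by
      intro j
      refine if_congr ?_ ?_ rfl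
      · simp
      · rw [eval_var, St.at₂_v _ _ _ hx.1 hx.2]
    simp only [this]
    rw [← sum_filter, sum_const, smul_eq_mul]
    congr 1
    have : (range (s.v .pw)).filter (· < a) = range a := by
      ext j; simp only [mem_filter, mem_range]; omega
    rw [this, card_range]
  · intro i _ hi
    simp [hi]
  · simp [ha]

/-- Division by enumeration: every number below `a * b` arises from exactly one pair of digits, so
quotient and remainder are found by listing all pairs, without dividing. -/
lemma sum_digits {a b x : ℕ} (hx : x < a * b) (g : ℕ → ℕ → ℕ) :
    (∑ i ∈ range a, ∑ j ∈ range b, if i * b + j = x then g i j else 0) = g (x / b) (x % b) := by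
  have hb : 0 < b := Nat.pos_of_ne_zero fun h => by simp [h] at hx
  have hlt : ∀ i j, j < b → i * b + j = x → i = x / b ∧ j = x % b := by
    rintro i j hj rfl
    rw [mul_comm i b, Nat.mul_add_div hb, Nat.div_eq_of_lt hj, Nat.mul_add_mod,
      Nat.mod_eq_of_lt hj]
    simp
  rw [sum_eq_single (x / b)]
  · rw [sum_eq_single (x % b)]
    · rw [if_pos]
      rw [mul_comm]
      exact Nat.div_add_mod x b
    · intro j hj hne
      exact if_neg fun h => hne (hlt _ _ (mem_range.mp hj) h).2
    · intro h
      exact absurd (mem_range.mpr (Nat.mod_lt x hb)) h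
  · intro i _ hne
    refine sum_eq_zero fun j hj => if_neg fun h => hne (hlt _ _ (mem_range.mp hj) h).1
  · intro h
    exact absurd (mem_range.mpr ((Nat.div_lt_iff_lt_mul hb).mpr hx)) h

lemma run_digits {b₁ b₂ : Var} {A M : Arr} (hb : b₂ ≠ .c ∧ b₂ ≠ .d) (hM : M ≠ A) (e : Expr)
    (he : e.reads A = false) (g : ℕ → ℕ → ℕ) (hg : ∀ i j, e.eval I (s.at₂ i j) = g i j)
    (hmul : ∀ i < s.v b₁, s.a M i = i * s.v b₂) {x : ℕ} (hx : x < s.v b₁ * s.v b₂)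
    (h0 : s.a A x = 0) :
    ((accum b₁ b₂ A (.lit 1) (.add (.arr M c) d) e).run I s).a A x =
      g (x / s.v b₂) (x % s.v b₂) := by
  rw [run_accum I _ _ _ _ _ _ _ hb rfl (by simp [reads, hM]) he, h0, zero_add, ← sum_digits hx g]
  refine sum_congr rfl fun i hi => sum_congr rfl fun j _ => ?_
  simp [hg, hmul i (mem_range.mp hi)]

/-- What the construction of the higher block presentation expects. -/
structure Sized (s : St) : Prop where
  m : 2 ≤ s.v .m
  pow : s.v .pw = s.v .m ^ s.v .k
  pow' : s.v .pw' = s.v .m ^ (s.v .k - 1)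
  k : 1 ≤ s.v .k

lemma Sized.pos {s : St} (h : Sized s) : 0 < s.v .pw := by
  rw [h.pow]
  have := h.m
  positivity

lemma Sized.pos' {s : St} (h : Sized s) : 0 < s.v .pw' := by
  rw [h.pow']
  have := h.m
  positivity

lemma Sized.mul {s : St} (h : Sized s) : s.v .pw' * s.v .m = s.v .pw := by
  rw [h.pow, h.pow', ← pow_succ, Nat.sub_add_cancel h.k]

lemma Sized.le' {s : St} (h : Sized s) : s.v .pw' ≤ s.v .pw := by
  rw [← h.mul]
  exact Nat.le_mul_of_pos_right _ (by have := h.m; omega)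

lemma Sized.m_le {s : St} (h : Sized s) : s.v .m ≤ s.v .pw := by
  rw [← h.mul]
  exact Nat.le_mul_of_pos_left _ h.pos'

/-- The multiplication tables are in place, and the other arrays are empty. -/
structure Tables (s : St) : Prop where
  mulP : ∀ a < s.v .pw, s.a .mulP a = a * s.v .pw
  mulM : ∀ a < s.v .pw, s.a .mulM a = a * s.v .m
  mulP' : ∀ a < s.v .pw, s.a .mulP' a = a * s.v .pw'
  src : ∀ a, s.a .src a = 0
  tgt : ∀ a, s.a .tgt a = 0
  fst : ∀ a, s.a .fst a = 0

/-- A state with the sizes `k`, `m`, `n`, `pw`, `pw'` of `s`. -/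
def SameSizes (s s' : St) : Prop :=
  s'.v .k = s.v .k ∧ s'.v .m = s.v .m ∧ s'.v .n = s.v .n ∧ s'.v .pw = s.v .pw ∧
    s'.v .pw' = s.v .pw'

lemma SameSizes.run {s s' : St} (h : SameSizes s s') (P : Cmd)
    (hP : P.writesV .k = false ∧ P.writesV .m = false ∧ P.writesV .n = false ∧
      P.writesV .pw = false ∧ P.writesV .pw' = false) : SameSizes s (P.run I s') := by
  obtain ⟨h1, h2, h3, h4, h5⟩ := hP
  rw [SameSizes, run_v I P s' h1, run_v I P s' h2, run_v I P s' h3, run_v I P s' h4,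
    run_v I P s' h5]
  exact h

lemma SameSizes.refl (s : St) : SameSizes s s := ⟨rfl, rfl, rfl, rfl, rfl⟩

lemma SameSizes.sized {s s' : St} (h : SameSizes s s') (hs : Sized s) : Sized s' := by
  obtain ⟨h1, h2, h3, h4, h5⟩ := h
  exact ⟨by rw [h2]; exact hs.m, by rw [h4, h1, h2]; exact hs.pow,
    by rw [h5, h1, h2]; exact hs.pow', by rw [h1]; exact hs.k⟩

lemma run_table (hs : Sized s) (h0 : ∀ A i, s.a A i = 0) :
    Tables (tableCmd.run I s) ∧ SameSizes s (tableCmd.run I s) ∧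
      (tableCmd.run I s).v .sq = s.v .pw * s.v .pw ∧
      (tableCmd.run I s).v .dbl = s.v .pw + s.v .pw := by
  have hS : SameSizes s (tableCmd.run I s) := (SameSizes.refl s).run I _ (by decide)
  simp only [tableCmd, run_block_cons, run_block_nil] at hS ⊢
  set s₁ := (multiples .mulP .pw).run I s with e₁
  set s₂ := (multiples .mulM .m).run I s₁ with e₂
  set s₃ := (multiples .mulP' .pw').run I s₂ with e₃
  set s₄ := (assign .sq (.add (.arr .mulP (.sub (.var .pw) (.lit 1))) (.var .pw))).run I s₃ with e₄
  set s₅ := (assign .dbl (.add (.var .pw) (.var .pw))).run I s₄ with e₅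
  have pw₁ : s₁.v .pw = s.v .pw := run_v I _ _ rfl
  have m₁ : s₁.v .m = s.v .m := run_v I _ _ rfl
  have pw₂ : s₂.v .pw = s.v .pw := (run_v I _ _ rfl).trans pw₁
  have q₂ : s₂.v .pw' = s.v .pw' := (run_v I _ _ rfl).trans (run_v I _ _ rfl)
  have pw₃ : s₃.v .pw = s.v .pw := (run_v I _ _ rfl).trans pw₂
  have a₁ : ∀ a < s.v .pw, s₁.a .mulP a = a * s.v .pw := fun a ha =>
    run_multiples I (by decide) ha (h0 _ _)
  have a₂ : ∀ a < s.v .pw, s₂.a .mulM a = a * s.v .m := fun a ha => by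
    rw [e₂, run_multiples I (by decide) (pw₁ ▸ ha), m₁]
    rw [e₁, run_a I _ _ rfl, h0]
  have a₃ : ∀ a < s.v .pw, s₃.a .mulP' a = a * s.v .pw' := fun a ha => by
    rw [e₃, run_multiples I (by decide) (pw₂ ▸ ha), q₂]
    rw [e₂, run_a I _ _ rfl, e₁, run_a I _ _ rfl, h0]
  have b₃ : s₃.a .mulP = s₁.a .mulP := (run_a I _ _ rfl).trans (run_a I _ _ rfl)
  have h5 : s₅.a = s₃.a := rfl
  have z : ∀ A, (multiples .mulP .pw).writesA A = false → (multiples .mulM .m).writesA A = false →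
      (multiples .mulP' .pw').writesA A = false → ∀ i, s₅.a A i = 0 := fun A h1 h2 h3 i => by
    rw [h5, e₃, run_a I _ _ h3, e₂, run_a I _ _ h2, e₁, run_a I _ _ h1, h0]
  refine ⟨⟨?_, ?_, ?_, z _ rfl rfl rfl, z _ rfl rfl rfl, z _ rfl rfl rfl⟩, hS, ?_, ?_⟩
  · rw [hS.2.2.2.1, h5, b₃]
    exact a₁
  · rw [hS.2.2.2.1, hS.2.1, h5, show s₃.a .mulM = s₂.a .mulM from run_a I _ _ rfl]
    exact a₂
  · rw [hS.2.2.2.1, hS.2.2.2.2, h5]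
    exact a₃
  · rw [e₅, run_v I _ _ rfl, e₄]
    simp only [run, St.setV_v_self, eval_add, eval_arr, eval_sub, eval_var, eval_lit]
    -- The table `mulP` ends at `pw - 1`, so the square is computed as `(pw - 1) * pw + pw`.
    have := hs.pos
    rw [pw₃, b₃, a₁ _ (by omega), Nat.sub_mul, one_mul, Nat.sub_add_cancel]
    exact Nat.le_mul_self _
  · rw [e₅]
    simp only [run, St.setV_v_self, eval_add, eval_var]
    rw [e₄, run_v I _ _ rfl, pw₃]

/-- What the higher block presentation has to satisfy. -/
structure Presented (I : List ℕ) (s s' : St) : Prop where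
  presents : Presents (s.v .m) (s.v .k) (s.v .n) (srcGS I) (tgtGS I s) (okS s' .ok)
    (s'.a .src) (s'.a .tgt) (s'.a .lab)
  lab : ∀ i < s.v .pw, s'.a .lab i = entryS I s i
  ok : ∀ i, okS s' .ok i → s'.a .src i < s.v .pw ∧ s'.a .tgt i < s.v .pw ∧ s'.a .lab i < s.v .n

lemma eval_entry {s s' : St} (h : SameSizes s s') (i : ℕ) :
    (entry c).eval I (s'.at i) = entryS I s i := by
  simp [entry, entryS, St.at_v, h.2.1, h.2.2.1]

lemma run_long (hs : Sized s) (ht : Tables s) (hk : 2 ≤ s.v .k) :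
    Presented I s (longCmd.run I s) := by
  have hS : SameSizes s (longCmd.run I s) := (SameSizes.refl s).run I _ (by decide)
  simp only [longCmd, run_block_cons, run_block_nil] at hS ⊢
  set s₁ := (accum .pw' .m .tgt (.lit 1) (.add (.arr .mulM c) d) c).run I s with e₁
  set s₂ := (accum .pw' .m .fst (.lit 1) (.add (.arr .mulM c) d) d).run I s₁ with e₂
  set s₃ := (accum .m .pw' .src (.lit 1) (.add (.arr .mulP' c) d) d).run I s₂ with e₃
  set s₄ := (fill .pw .lab (entry c)).run I s₃ with e₄
  set s₅ := (fill .pw .ok (and (eq (tgtG (.arr .fst c)) (srcG (.arr .fst (.arr .tgt c))))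
    (lt (.arr .lab c) (.var .n)))).run I s₄ with e₅
  have S₁ : SameSizes s s₁ := (SameSizes.refl s).run I _ (by decide)
  have S₂ : SameSizes s s₂ := S₁.run I _ (by decide)
  have S₃ : SameSizes s s₃ := S₂.run I _ (by decide)
  have S₄ : SameSizes s s₄ := S₃.run I _ (by decide)
  have a₁ : ∀ i < s.v .pw, s₁.a .tgt i = i / s.v .m := fun i hi =>
    run_digits I (by decide) (by decide) c rfl (fun i _ => i) (by simp)
      (fun i hi => ht.mulM i (hi.trans_le hs.le')) (hs.mul ▸ hi) (ht.tgt i)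
  have a₂ : ∀ i < s.v .pw, s₂.a .fst i = i % s.v .m := fun i hi => by
    rw [e₂, run_digits I (by decide) (by decide) d rfl (fun _ j => j) (by simp)
      (fun i hi => ?_) (by rw [S₁.2.2.2.2, S₁.2.1, hs.mul]; exact hi)
      (by rw [e₁, run_a I _ _ rfl, ht.fst]), S₁.2.1]
    rw [e₁, run_a I _ _ rfl, ← e₁, S₁.2.1]
    rw [S₁.2.2.2.2] at hi
    exact ht.mulM i (hi.trans_le hs.le')
  have a₃ : ∀ i < s.v .pw, s₃.a .src i = i % s.v .pw' := fun i hi => by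
    rw [e₃, run_digits I (by decide) (by decide) d rfl (fun _ j => j) (by simp)
      (fun i hi => ?_) (by rw [S₂.2.2.2.2, S₂.2.1, mul_comm, hs.mul]; exact hi)
      (by rw [e₂, run_a I _ _ rfl, e₁, run_a I _ _ rfl, ht.src]), S₂.2.2.2.2]
    rw [e₂, run_a I _ _ rfl, e₁, run_a I _ _ rfl, ← e₁, ← e₂, S₂.2.2.2.2]
    rw [S₂.2.1] at hi
    exact ht.mulP' i (hi.trans_le hs.m_le)
  have a₄ : ∀ i < s.v .pw, s₄.a .lab i = entryS I s i := fun i hi => by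
    rw [e₄, run_fill I _ _ _ _ rfl, S₃.2.2.2.1, if_pos hi, eval_entry I S₃]
  have t₄ : s₄.a .tgt = s₁.a .tgt :=
    (run_a I _ _ rfl).trans ((run_a I _ _ rfl).trans (run_a I _ _ rfl))
  have f₄ : s₄.a .fst = s₂.a .fst := (run_a I _ _ rfl).trans (run_a I _ _ rfl)
  have t₅ : s₅.a .tgt = s₁.a .tgt := (run_a I _ _ rfl).trans t₄
  have r₅ : s₅.a .src = s₃.a .src := (run_a I _ _ rfl).trans (run_a I _ _ rfl)
  have l₅ : s₅.a .lab = s₄.a .lab := run_a I _ _ rfl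
  have hm : 0 < s.v .m := by have := hs.m; omega
  have hok : ∀ i, okS s₅ .ok i ↔ i < s.v .pw ∧ tgtGS I s (i % s.v .m) =
      srcGS I (i / s.v .m % s.v .m) ∧ s₅.a .lab i < s.v .n := by
    intro i
    rw [okS, hS.2.2.2.1]
    refine and_congr_right fun hi => ?_
    -- The second letter is looked up as the first letter of the quotient, which must lie in the
    -- range of the table.
    have hdiv : i / s.v .m < s.v .pw := (Nat.div_le_self _ _).trans_lt hi
    rw [e₅, run_fill I _ _ _ _ rfl, S₄.2.2.2.1, if_pos hi, ← e₅, l₅]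
    simp [tgtG, srcG, tgtGS, srcGS, St.at_v, S₄.2.1, S₄.2.2.1, t₄, f₄, a₁ i hi, a₂ i hi, a₂ _ hdiv]
  obtain ⟨k, hk'⟩ := Nat.exists_eq_add_of_le hk
  have hk2 : s.v .k = k + 2 := by omega
  refine ⟨?_, fun i hi => by rw [l₅, a₄ i hi], fun i hi => ?_⟩
  · have hp := hs.pow
    have hp' := hs.pow'
    rw [hk2] at hp hp' ⊢
    refine presents_long (fun i => by rw [hok, hp]) (fun i hi => ?_) (fun i hi => ?_)
    · rw [r₅, a₃ i (hp ▸ hi), hp']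
      rfl
    · rw [t₅, a₁ i (hp ▸ hi)]
  · have h := (hok i).mp hi
    refine ⟨?_, ?_, h.2.2⟩
    · rw [r₅, a₃ i h.1]
      exact (Nat.mod_lt _ hs.pos').trans_le hs.le'
    · rw [t₅, a₁ i h.1]
      exact (Nat.div_le_self _ _).trans_lt h.1

/-- A failed search returns the initial entry; it stays in range if the array starts with zeros. -/
lemma lastSat_lt (p : ℕ → Prop) [DecidablePred p] {w n : ℕ} (h : w < n) : lastSat p w n < n := by
  by_cases hp : ∃ j < n, p j
  · exact (lastSat_spec p w n hp).1
  · have : ∀ l ≤ n, lastSat p w l = w := by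
      intro l
      induction l with
      | zero => intro _; rfl
      | succ l ih =>
        intro hl
        rw [lastSat, if_neg fun h' => hp ⟨l, by omega, h'⟩, ih (by omega)]
    rwa [this n le_rfl]

lemma run_one (hs : Sized s) (ht : Tables s) (hk : s.v .k = 1) :
    Presented I s (oneCmd.run I s) := by
  have hS : SameSizes s (oneCmd.run I s) := (SameSizes.refl s).run I _ (by decide)
  simp only [oneCmd, run_block_cons, run_block_nil] at hS ⊢
  set s₁ := (select .pw .pw .src (eq (srcG d) (srcG c))).run I s with e₁
  set s₂ := (select .pw .pw .tgt (eq (srcG d) (tgtG c))).run I s₁ with e₂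
  set s₄ := (fill .pw .lab (entry c)).run I s₂ with e₄
  set s₅ := (fill .pw .ok (and (eq (srcG (.arr .tgt c)) (tgtG c))
    (lt (.arr .lab c) (.var .n)))).run I s₄ with e₅
  have S₁ : SameSizes s s₁ := (SameSizes.refl s).run I _ (by decide)
  have S₂ : SameSizes s s₂ := S₁.run I _ (by decide)
  have S₄ : SameSizes s s₄ := S₂.run I _ (by decide)
  have hpm : s.v .pw = s.v .m := by rw [hs.pow, hk, pow_one]
  -- The name of a vertex is the last edge that starts there. The default `0` comes from the empty
  -- arrays and is harmless: edges into vertices without a name are rejected by the test for `ok`.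
  set L : ℕ → ℕ := fun v => lastSat (fun f => srcGS I f = v) 0 (s.v .m) with hL
  have a₁ : ∀ i < s.v .m, s₁.a .src i = L (srcGS I i) := fun i hi => by
    rw [e₁, run_select I _ _ _ _ _ (by decide) rfl, if_pos (hpm ▸ hi), ht.src, hpm, hL]
    simp only [ne_eq, eval_eq_ne, not_not, srcG, eval_inp, eval_add, eval_lit, eval_var,
      St.at₂_c, St.at₂_d, srcGS]
    congr
  have a₂ : ∀ i < s.v .m, s₂.a .tgt i = L (tgtGS I s i) := fun i hi => by
    rw [e₂, run_select I _ _ _ _ _ (by decide) rfl, S₁.2.2.2.1, if_pos (hpm ▸ hi),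
      show s₁.a .tgt i = 0 by rw [e₁, run_a I _ _ rfl, ht.tgt], hpm, hL]
    simp only [ne_eq, eval_eq_ne, not_not, srcG, tgtG, eval_inp, eval_add, eval_lit, eval_var,
      St.at₂_c, St.at₂_d, srcGS, tgtGS, St.at₂_v s₁ _ _ (show Var.m ≠ .c by decide) (by decide),
      S₁.2.1]
    congr
  have a₄ : ∀ i < s.v .pw, s₄.a .lab i = entryS I s i := fun i hi => by
    rw [e₄, run_fill I _ _ _ _ rfl, S₂.2.2.2.1, if_pos hi, eval_entry I S₂]
  have t₄ : s₄.a .tgt = s₂.a .tgt := run_a I _ _ rfl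
  have t₅ : s₅.a .tgt = s₂.a .tgt := (run_a I _ _ rfl).trans t₄
  have r₅ : s₅.a .src = s₁.a .src :=
    (run_a I _ _ rfl).trans ((run_a I _ _ rfl).trans (run_a I _ _ rfl))
  have l₅ : s₅.a .lab = s₄.a .lab := run_a I _ _ rfl
  have hm : 0 < s.v .m := by have := hs.m; omega
  have hok : ∀ i, okS s₅ .ok i ↔ i < s.v .m ∧ srcGS I (s₅.a .tgt i) = tgtGS I s i ∧
      s₅.a .lab i < s.v .n := by
    intro i
    rw [okS, hS.2.2.2.1, hpm]
    refine and_congr_right fun hi => ?_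
    rw [e₅, run_fill I _ _ _ _ rfl, S₄.2.2.2.1, if_pos (hpm ▸ hi), ← e₅, l₅, t₅]
    simp [tgtG, srcG, tgtGS, srcGS, St.at_v, S₄.2.1, S₄.2.2.1, t₄]
  refine ⟨?_, fun i hi => by rw [l₅, a₄ i hi], fun i hi => ?_⟩
  · rw [hk]
    refine presents_one (L := L) hok (fun i hi => by rw [r₅, a₁ i hi])
      (fun i hi => by rw [t₅, a₂ i hi]) fun f hf => ?_
    exact (lastSat_spec (fun f' => srcGS I f' = srcGS I f) 0 (s.v .m) ⟨f, hf, rfl⟩).2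
  · have h := (hok i).mp hi
    refine ⟨?_, ?_, h.2.2⟩
    · rw [r₅, a₁ i h.1, hpm]
      exact lastSat_lt _ hm
    · rw [t₅, a₂ i h.1, hpm]
      exact lastSat_lt _ hm

lemma run_words (hs : Sized s) (ht : Tables s) : Presented I s (wordsCmd.run I s) := by
  have := hs.k
  change Presented I s (if s.v .k - 1 ≠ 0 then longCmd.run I s else oneCmd.run I s)
  by_cases h : s.v .k - 1 = 0
  · rw [if_neg (not_not.mpr h)]
    exact run_one I hs ht (by omega)
  · rw [if_pos h]
    exact run_long I hs ht (by omega)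

end Core
-- Running time
open RamProgram

/-- The exponents of the bounds for the loop counts. -/
def Var.deg : Var → ℕ
  | .k | .m | .pw | .pw' => 1
  | .sq | .dbl => 2
  | _ => 0

/-- The degree of the running time. -/
def Cmd.deg : Cmd → ℕ
  | skip => 0
  | assign _ _ => 0
  | store _ _ _ => 0
  | seq P Q => max P.deg Q.deg
  | ite _ P Q => max P.deg Q.deg
  | loop _ b P => b.deg + P.deg

/-- The constant factor of the running time. -/
def Cmd.coeff (P : Cmd) : ℕ := P.cost fun _ => 1

/-- The cost is a polynomial in the loop bounds with nonnegative coefficients. Its value with all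
bounds equal to `1` is the sum of the coefficients, and nesting adds the exponents. -/
lemma Cmd.cost_le {N : ℕ} (hN : 1 ≤ N) (P : Cmd) :
    P.cost (fun x => N ^ x.deg) ≤ P.coeff * N ^ P.deg := by
  have up : ∀ {a c d e : ℕ}, a ≤ c * N ^ d → d ≤ e → a ≤ c * N ^ e := fun h hd =>
    h.trans (Nat.mul_le_mul_left _ (Nat.pow_le_pow_right hN hd))
  induction P with
  | skip | assign x e | store A e f => simp [cost, coeff, deg]
  | seq P Q hP hQ =>
    have h1 := up hP (le_max_left P.deg Q.deg)
    have h2 := up hQ (le_max_right P.deg Q.deg)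
    simp only [cost, coeff, deg] at h1 h2 ⊢
    rw [add_mul]
    omega
  | ite e P Q hP hQ =>
    have h1 := up hP (le_max_left P.deg Q.deg)
    have h2 := up hQ (le_max_right P.deg Q.deg)
    have h3 : e.cost + 1 ≤ (e.cost + 1) * N ^ max P.deg Q.deg :=
      Nat.le_mul_of_pos_right _ (by positivity)
    simp only [cost, coeff, deg] at h1 h2 ⊢
    simp only [add_mul] at h3 ⊢
    omega
  | loop x b P hP =>
    have h1 : 1 ≤ N ^ P.deg := Nat.one_le_pow _ _ hN
    have h2 : 1 ≤ N ^ b.deg := Nat.one_le_pow _ _ hN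
    simp only [cost, coeff, deg, pow_add] at hP ⊢
    nlinarith [Nat.mul_le_mul_left (N ^ b.deg) hP, Nat.mul_le_mul h2 h1,
      Nat.mul_le_mul_left (N ^ b.deg) h1]

/-- The program leads from `s` to `s'` within `T` steps. -/
def Runs (I : List ℕ) (R : RamProgram) (s s' : St) (T : ℕ) : Prop :=
  ∀ σ, Rep I σ s → ∃ σ' t, Exec R σ σ' t ∧ t ≤ T ∧ Rep I σ' s'

variable {I : List ℕ} {s s₁ s₂ : St} {R R' : RamProgram} {T T₁ T₂ : ℕ}

lemma Runs.seq (h₁ : Runs I R s s₁ T₁) (h₂ : Runs I R' s₁ s₂ T₂) :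
    Runs I (.seq R R') s s₂ (T₁ + T₂) := by
  intro σ hσ
  obtain ⟨σ₁, t₁, e₁, c₁, r₁⟩ := h₁ σ hσ
  obtain ⟨σ₂, t₂, e₂, c₂, r₂⟩ := h₂ σ₁ r₁
  exact ⟨σ₂, _, .seq e₁ e₂, by omega, r₂⟩

/-- Branch on the value of an expression. -/
def branch (e : Expr) (R R' : RamProgram) : RamProgram := .seq (e.compile 16) (.ite 16 R R')

lemma Runs.branch_true {e : Expr} (he : e.eval I s ≠ 0) (h : Runs I R s s₁ T) :
    Runs I (branch e R R') s s₁ (e.cost + 1 + T) := by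
  intro σ hσ
  obtain ⟨σ₁, t₁, e₁, c₁, m₁, r₁, v₁⟩ := e.exec_compile le_rfl hσ
  obtain ⟨σ₂, t₂, e₂, c₂, r₂⟩ := h σ₁ (hσ.congr le_rfl r₁ m₁)
  exact ⟨σ₂, _, .seq e₁ (.ite_true (by rwa [v₁]) e₂), by omega, r₂⟩

lemma Runs.branch_false {e : Expr} (he : e.eval I s = 0) (h : Runs I R' s s₁ T) :
    Runs I (branch e R R') s s₁ (e.cost + 1 + T) := by
  intro σ hσ
  obtain ⟨σ₁, t₁, e₁, c₁, m₁, r₁, v₁⟩ := e.exec_compile le_rfl hσ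
  obtain ⟨σ₂, t₂, e₂, c₂, r₂⟩ := h σ₁ (hσ.congr le_rfl r₁ m₁)
  exact ⟨σ₂, _, .seq e₁ (.ite_false (by rwa [v₁]) e₂), by omega, r₂⟩

/-- A program without input-dependent loops other than those up to the sizes, with at most four of
them nested. -/
def Cmd.Tame (P : Cmd) : Prop :=
  P.deg ≤ 4 ∧ ∀ x, P.bounds x = true → 0 < x.deg ∧ P.writesV x = false

/-- The sizes are bounded in terms of `N`. -/
def St.Bounded (N : ℕ) (s : St) : Prop := ∀ x : Var, 0 < x.deg → s.v x ≤ N ^ x.deg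

lemma Cmd.Tame.runs {N : ℕ} {P : Cmd} (hP : P.Tame) (hN : 1 ≤ N)
    (hb : ∀ x, P.bounds x = true → s.v x ≤ N ^ x.deg) :
    Runs I (P.compile 16) s (P.run I s) (P.coeff * N ^ 4) := by
  intro σ hσ
  obtain ⟨σ', t, e, c, r, -⟩ := P.exec_compile (fun x => N ^ x.deg) le_rfl hσ hb
    fun x hx => (hP.2 x hx).2
  refine ⟨σ', t, e, c.trans ((P.cost_le hN).trans ?_), r⟩
  exact Nat.mul_le_mul_left _ (Nat.pow_le_pow_right hN hP.1)

lemma Cmd.Tame.runs_of_bounded {N : ℕ} {P : Cmd} (hP : P.Tame) (hN : 1 ≤ N) (hb : s.Bounded N) :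
    Runs I (P.compile 16) s (P.run I s) (P.coeff * N ^ 4) :=
  hP.runs hN fun x hx => hb x (hP.2 x hx).1

/-- All variables and arrays are zero. -/
def St.zero : St := ⟨fun _ => 0, fun _ _ => 0⟩

lemma rep_init (I : List ℕ) : Rep I (RamState.init I) St.zero where
  base := by simp [RamState.init]
  var x := by simp [RamState.init, St.zero, x.reg_pos.ne']
  arr A i := List.getD_eq_default _ _ (by omega)
  inp p _ := rfl

/-! ### The complete program -/

namespace Core
open LoopLang.Expr LoopLang.Cmd

/-- Negative answer. -/
def rejectCmd : Cmd := assign .res (.lit 0)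

/-- More edges in the target graph than words. -/
def tooMany : Expr := .sub (.var .n) (.var .pw)
/-- At least two edges in the source graph. -/
def isLarge : Expr := .sub (.var .m) (.lit 1)

/-- The case of a source graph with at least two edges. -/
def largeProgram : RamProgram :=
  .seq (powCmd.compile 16) <| branch tooMany (rejectCmd.compile 16) <|
    .seq (tableCmd.compile 16) <| .seq (wordsCmd.compile 16) (coreCmd.compile 16)

/-- The decision program, with the answer in a variable. -/
def program : RamProgram :=
  .seq (readCmd.compile 16) <| branch isLarge largeProgram (smallCmd.compile 16)

/-- The constant factor of the running time. -/
def totalCoeff : ℕ :=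
  readCmd.coeff + isLarge.cost + 1 + powCmd.coeff + tooMany.cost + 1 + rejectCmd.coeff +
    tableCmd.coeff + wordsCmd.coeff + coreCmd.coeff + smallCmd.coeff

lemma tame_read : readCmd.Tame := ⟨by decide, by intro x; cases x <;> decide⟩
lemma tame_pow : powCmd.Tame := ⟨by decide, by intro x; cases x <;> decide⟩
lemma tame_reject : rejectCmd.Tame := ⟨by decide, by intro x; cases x <;> decide⟩
lemma tame_table : tableCmd.Tame := ⟨by decide, by intro x; cases x <;> decide⟩
lemma tame_words : wordsCmd.Tame := ⟨by decide, by intro x; cases x <;> decide⟩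
-- The degree `4` is reached by `prune`, with `sq` rounds of a double loop up to `pw`. The
-- comparison of counts is also assigned degree `4`, because `dbl` is bounded by the square.
lemma tame_core : coreCmd.Tame := ⟨by decide, by intro x; cases x <;> decide⟩
lemma tame_small : smallCmd.Tame := ⟨by decide, by intro x; cases x <;> decide⟩

lemma runs_read {N : ℕ} (hN : 1 ≤ N) :
    Runs I (readCmd.compile 16) .zero (readCmd.run I .zero) (readCmd.coeff * N ^ 4) :=
  tame_read.runs hN fun _ _ => Nat.zero_le _

/-- The state after reading the sizes. -/
def start (I : List ℕ) : St := readCmd.run I .zero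

lemma runs_small (hm : isLarge.eval I (start I) = 0) {N : ℕ} (hN : 1 ≤ N) :
    Runs I program .zero (smallCmd.run I (start I)) (totalCoeff * N ^ 4) := by
  have h := (runs_read hN).seq <| Runs.branch_false (R := largeProgram) hm <|
    tame_small.runs hN fun x hx => by cases x <;> exact absurd hx (by decide)
  intro σ hσ
  obtain ⟨σ', t, e, c, r⟩ := h σ hσ
  refine ⟨σ', t, e, c.trans ?_, r⟩
  have h1 : 1 ≤ N ^ 4 := Nat.one_le_pow _ _ hN
  have h2 : isLarge.cost + 1 ≤ (isLarge.cost + 1) * N ^ 4 := Nat.le_mul_of_pos_right _ h1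
  simp only [totalCoeff, add_mul] at h2 ⊢
  omega

lemma runs_reject (hm : isLarge.eval I (start I) ≠ 0)
    (hn : tooMany.eval I (powCmd.run I (start I)) ≠ 0) {N : ℕ} (hN : 1 ≤ N)
    (hb : (start I).Bounded N) :
    Runs I program .zero (rejectCmd.run I (powCmd.run I (start I))) (totalCoeff * N ^ 4) := by
  have h := (runs_read hN).seq <| Runs.branch_true (R' := smallCmd.compile 16) hm <|
    (tame_pow.runs_of_bounded hN hb).seq <|
    Runs.branch_true (R' := .seq (tableCmd.compile 16) <|
      .seq (wordsCmd.compile 16) (coreCmd.compile 16)) hn <|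
    tame_reject.runs hN fun x hx => by cases x <;> exact absurd hx (by decide)
  intro σ hσ
  obtain ⟨σ', t, e, c, r⟩ := h σ hσ
  refine ⟨σ', t, e, c.trans ?_, r⟩
  have h1 : 1 ≤ N ^ 4 := Nat.one_le_pow _ _ hN
  have h2 : isLarge.cost + 1 ≤ (isLarge.cost + 1) * N ^ 4 := Nat.le_mul_of_pos_right _ h1
  have h3 : tooMany.cost + 1 ≤ (tooMany.cost + 1) * N ^ 4 := Nat.le_mul_of_pos_right _ h1
  simp only [totalCoeff, add_mul] at h2 h3 ⊢
  omega

lemma runs_large (hm : isLarge.eval I (start I) ≠ 0)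
    (hn : tooMany.eval I (powCmd.run I (start I)) = 0) {N : ℕ} (hN : 1 ≤ N)
    (h₁ : (start I).Bounded N) (h₂ : (powCmd.run I (start I)).Bounded N)
    (h₃ : (tableCmd.run I (powCmd.run I (start I))).Bounded N)
    (h₄ : (wordsCmd.run I (tableCmd.run I (powCmd.run I (start I)))).Bounded N) :
    Runs I program .zero
      (coreCmd.run I (wordsCmd.run I (tableCmd.run I (powCmd.run I (start I)))))
      (totalCoeff * N ^ 4) := by
  have h := (runs_read hN).seq <| Runs.branch_true (R' := smallCmd.compile 16) hm <|
    (tame_pow.runs_of_bounded hN h₁).seq <|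
    Runs.branch_false (R := rejectCmd.compile 16) hn <|
    (tame_table.runs_of_bounded hN h₂).seq <|
    (tame_words.runs_of_bounded hN h₃).seq <| tame_core.runs_of_bounded hN h₄
  intro σ hσ
  obtain ⟨σ', t, e, c, r⟩ := h σ hσ
  refine ⟨σ', t, e, c.trans ?_, r⟩
  have h1 : 1 ≤ N ^ 4 := Nat.one_le_pow _ _ hN
  have h2 : isLarge.cost + 1 ≤ (isLarge.cost + 1) * N ^ 4 := Nat.le_mul_of_pos_right _ h1
  have h3 : tooMany.cost + 1 ≤ (tooMany.cost + 1) * N ^ 4 := Nat.le_mul_of_pos_right _ h1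
  simp only [totalCoeff, add_mul] at h2 h3 ⊢
  omega

/-- The decision program. -/
def decideProgram : RamProgram := .seq program <| .seq (.const 0 0) (.add 0 0 Var.res.reg)

lemma decidesWithin (h : Runs I program .zero s T) {Q : Prop} (h1 : Q → s.v .res = 1)
    (h0 : ¬ Q → s.v .res = 0) : decideProgram.DecidesWithin I Q (T + 2) := by
  obtain ⟨σ, t, e, c, r⟩ := h _ (rep_init I)
  refine ⟨_, _, .seq e (.seq (.const ..) (.add ..)), by omega, fun hQ => ?_, fun hQ => ?_⟩
  · simp [RamState.setReg, Var.res.reg_pos.ne', r.var, h1 hQ]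
  · simp [RamState.setReg, Var.res.reg_pos.ne', r.var, h0 hQ]

lemma eval_eq (e f : Expr) :
    (eq e f).eval I s = if e.eval I s = f.eval I s then 1 else 0 := by
  split_ifs with h
  · simp [eq, h]
  · have : e.eval I s - f.eval I s + (f.eval I s - e.eval I s) ≠ 0 := by omega
    simp only [eq, eval_ite, eval_add, eval_sub, eval_lit]
    exact if_neg this

end Core

/-! ### The program on encoded instances -/

section
open LoopLang.Core LoopLang.Expr Classical

variable {k p m q n : ℕ} {G : DirMultigraph (Fin p) (Fin m)} {H : DirMultigraph (Fin q) (Fin n)}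
  {mem : ℤ} {Φ : shiftBlocks G.edgeShift k → Fin n} {table : (Fin k → Fin m) → ℕ}

/-- With at most one edge a walk exists exactly if this edge is a loop. The numbers `s` and `t` are
read from the input and mean something only if there is an edge. -/
lemma ite_loop_eq (G : DirMultigraph (Fin p) (Fin m)) (hm : m ≤ 1) {s t : ℕ}
    (hs : ∀ e : Fin m, s = G.src e) (ht : ∀ e : Fin m, t = G.tgt e) :
    (if m = 0 then 0 else if s = t then 1 else 0) = if G.edgeShift.Nonempty then 1 else 0 := by
  rw [edgeShift_nonempty_iff hm]
  obtain rfl | hm := Nat.eq_zero_or_pos m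
  · simp
  · have h : (∃ e, G.src e = G.tgt e) ↔ s = t := by
      constructor
      · rintro ⟨e, he⟩
        rw [hs e, ht e, he]
      · intro h
        exact ⟨⟨0, hm⟩, Fin.ext (by rw [← hs, ← ht, h])⟩
    simp [hm.ne', h]

lemma res_small (hm : m ≤ 1) (hH : H.IsEssential ∨ n ≤ m ^ k) :
    (smallCmd.run (encodeInstance k G H table) (start (encodeInstance k G H table))).v .res =
      if IsBlockConjugacy G.edgeShift H.edgeShift mem Φ then 1 else 0 := by
  have hn : (start (encodeInstance k G H table)).v .n = n := rfl
  have hm' : (start (encodeInstance k G H table)).v .m = m := rfl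
  have one : ∀ {l : ℕ}, l ≤ 1 → ∀ e : Fin l, (e : ℕ) = 0 := fun hl e => by omega
  simp only [smallCmd, Cmd.run, St.setV_v_self, eval_ite, eval_sub, eval_lit, Core.eval_eq,
    srcG, tgtG, srcH, tgtH, eval_var, eval_inp, eval_add, hn, hm', add_zero]
  rw [isBlockConjugacy_iff_of_le_one hm hH mem Φ]
  by_cases hn1 : n ≤ 1
  · rw [if_pos (by omega)]
    rw [ite_loop_eq G hm (fun e => by rw [← getD_encode_src (H := H) (table := table), one hm e])
      (fun e => by rw [← getD_encode_tgt (H := H) (table := table), one hm e]; rfl)]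
    rw [ite_loop_eq H hn1 (fun e => by rw [← getD_encode_srcH (G := G) (table := table), one hn1 e]; rfl)
      (fun e => by rw [← getD_encode_tgtH (G := G) (table := table), one hn1 e]; rfl)]
    by_cases h1 : G.edgeShift.Nonempty <;> by_cases h2 : H.edgeShift.Nonempty <;> simp [h1, h2, hn1]
  · rw [if_neg (by omega), if_neg (by tauto)]

lemma bounded_of_large {N : ℕ} {s : St} (hk : s.v .k ≤ N) (hm : s.v .m ≤ N)
    (hp : s.v .pw ≤ N) (hp' : s.v .pw' ≤ N) (hs : s.v .sq ≤ N ^ 2) (hd : s.v .dbl ≤ N ^ 2) :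
    s.Bounded N := by
  intro x hx
  cases x
  case sq => exact hs
  case dbl => exact hd
  case k | m | pw | pw' => simpa [Var.deg]
  all_goals exact absurd hx (by decide)

lemma decides_large (hk : 1 ≤ k) (hm : 2 ≤ m) (hH : H.IsEssential ∨ n ≤ m ^ k)
    (ht : ∀ w : shiftBlocks G.edgeShift k, table w.1 = (Φ w : ℕ)) :
    ∃ s, Runs (encodeInstance k G H table) program .zero s (totalCoeff * (m ^ k) ^ 4) ∧
      (IsBlockConjugacy G.edgeShift H.edgeShift mem Φ → s.v .res = 1) ∧
      (¬ IsBlockConjugacy G.edgeShift H.edgeShift mem Φ → s.v .res = 0) := by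
  set I := encodeInstance k G H table with hI
  set s₁ := start I with hs₁
  set s₂ := powCmd.run I s₁ with hs₂
  set s₃ := tableCmd.run I s₂ with hs₃
  set s₄ := wordsCmd.run I s₃ with hs₄
  have k₁ : s₁.v .k = k := rfl
  have m₁ : s₁.v .m = m := rfl
  have n₁ : s₁.v .n = n := rfl
  have k₂ : s₂.v .k = k := Cmd.run_v I _ _ rfl
  have m₂ : s₂.v .m = m := Cmd.run_v I _ _ rfl
  have n₂ : s₂.v .n = n := Cmd.run_v I _ _ rfl
  have a₂ : ∀ A i, s₂.a A i = 0 := fun A i => by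
    rw [hs₂, Cmd.run_a I _ _ (by cases A <;> rfl)]; rfl
  have p₂ : s₂.v .pw = m ^ k := (run_pow I s₁).1
  have p₂' : s₂.v .pw' = m ^ (k - 1) := (run_pow I s₁).2 hk
  have hS₂ : Sized s₂ := ⟨by rwa [m₂], by rw [p₂, m₂, k₂], by rw [p₂', m₂, k₂], by rwa [k₂]⟩
  have hN : 1 ≤ m ^ k := Nat.one_le_pow _ _ (by omega)
  -- Computing the power takes `k` rounds, and `k < 2 ^ k` bounds them by the number of words. This
  -- fails for `m ≤ 1`, which is one reason to treat that case separately.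
  have hkN : k ≤ m ^ k := (Nat.lt_two_pow_self).le.trans (Nat.pow_le_pow_left hm k)
  have hmN : m ≤ m ^ k := Nat.le_self_pow (by omega) m
  have hp' : m ^ (k - 1) ≤ m ^ k := Nat.pow_le_pow_right (by omega) (by omega)
  have hdbl : m ^ k + m ^ k ≤ (m ^ k) ^ 2 := by nlinarith
  have b₁ : s₁.Bounded (m ^ k) := bounded_of_large hkN hmN (Nat.zero_le _) (Nat.zero_le _)
    (Nat.zero_le _) (Nat.zero_le _)
  have b₂ : s₂.Bounded (m ^ k) := bounded_of_large (k₂ ▸ hkN) (m₂ ▸ hmN) p₂.le (p₂' ▸ hp')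
    ((Cmd.run_v I powCmd s₁ (x := .sq) rfl).trans_le (Nat.zero_le _))
    ((Cmd.run_v I powCmd s₁ (x := .dbl) rfl).trans_le (Nat.zero_le _))
  have hL : isLarge.eval I s₁ ≠ 0 := by
    change s₁.v .m - 1 ≠ 0
    omega
  -- The size of `H` is checked before the tables are built: the main algorithm needs the edges of
  -- `H` to be numbered below `pw`.
  by_cases hn : n ≤ m ^ k
  · obtain ⟨hT, S₃, sq₃, dbl₃⟩ := run_table I hS₂ a₂
    rw [← hs₃] at hT S₃ sq₃ dbl₃
    have hS₃ : Sized s₃ := S₃.sized hS₂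
    have S₄ : SameSizes s₃ s₄ := (SameSizes.refl s₃).run _ _ (by decide)
    have hP := run_words I hS₃ hT
    rw [← hs₄] at hP
    have k₃ : s₃.v .k = k := S₃.1.trans k₂
    have m₃ : s₃.v .m = m := S₃.2.1.trans m₂
    have n₃ : s₃.v .n = n := S₃.2.2.1.trans n₂
    have p₃ : s₃.v .pw = m ^ k := S₃.2.2.2.1.trans p₂
    have k₄ : s₄.v .k = k := S₄.1.trans k₃
    have m₄ : s₄.v .m = m := S₄.2.1.trans m₃
    have n₄ : s₄.v .n = n := S₄.2.2.1.trans n₃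
    have p₄ : s₄.v .pw = m ^ k := S₄.2.2.2.1.trans p₃
    have sq₄ : s₄.v .sq = m ^ k * m ^ k := by
      rw [hs₄, Cmd.run_v I _ _ rfl, sq₃, p₂]
    have dbl₄ : s₄.v .dbl = m ^ k + m ^ k := by
      rw [hs₄, Cmd.run_v I _ _ rfl, dbl₃, p₂]
    have b₃ : s₃.Bounded (m ^ k) := bounded_of_large (k₃ ▸ hkN) (m₃ ▸ hmN) p₃.le
      ((S₃.2.2.2.2.trans p₂').trans_le hp') (by rw [sq₃, p₂, sq]) (by rwa [dbl₃, p₂])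
    have b₄ : s₄.Bounded (m ^ k) := bounded_of_large (k₄ ▸ hkN) (m₄ ▸ hmN) p₄.le
      (((S₄.2.2.2.2.trans S₃.2.2.2.2).trans p₂').trans_le hp') (by rw [sq₄, sq]) (by rwa [dbl₄])
    have hR : Ready s₄ := by
      refine ⟨by omega, by rw [sq₄, p₄], by rw [dbl₄, p₄], by rwa [n₄, p₄], fun a ha => ?_,
        fun i hi => ?_⟩
      · rw [hs₄, Cmd.run_a I _ _ rfl, ← hs₄, hT.mulP a (by rwa [p₃, ← p₄]), p₃, p₄]
      · rw [p₄, n₄, ← p₃, ← n₃]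
        exact hP.ok i hi
    have hpres := hP.presents
    rw [k₃, m₃, n₃] at hpres
    have hcore := run_core (I := I) hR
    rw [n₄, bijOn_iff_of_presents (Φ := Φ) (G := G) (H := H) hk (s := srcGS I) (t := tgtGS I s₃)
      (s' := srcHS I s₄) (t' := tgtHS I s₄)
      (fun f => ⟨getD_encode_src G H table f, by rw [tgtGS, m₃]; exact getD_encode_tgt G H table f⟩)
      (fun f => ⟨by rw [srcHS, m₄]; exact getD_encode_srcH G H table f,
        by rw [tgtHS, m₄, n₄]; exact getD_encode_tgtH G H table f⟩) hpres (fun x i => ?_),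
      ← isBlockConjugacy_iff Φ mem] at hcore
    · refine ⟨_, runs_large hL ?_ hN b₁ b₂ b₃ b₄, hcore⟩
      change s₂.v .n - s₂.v .pw = 0
      omega
    · rw [hP.lab _ (by rw [p₃]; exact wordCode_lt (fun i => (x.1 i).2) i), entryS, m₃, n₃]
      exact getD_encode_wordCode G H table Φ ht x i
  · refine ⟨_, runs_reject hL ?_ hN b₁, fun h => ?_, fun _ => rfl⟩
    · change s₂.v .n - s₂.v .pw ≠ 0
      omega
    · exact absurd h (not_isBlockConjugacy_of_lt (hH.resolve_right hn) (by omega) mem Φ)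

end

end LoopLang

theorem mainTheorem11 :
    ∃ (P : RamProgram) (C : ℕ),
      ∀ (k : ℕ) (_ : 1 ≤ k) (p m q n : ℕ)
        (G : DirMultigraph (Fin p) (Fin m)) (H : DirMultigraph (Fin q) (Fin n))
        (_ : H.IsEssential ∨ n ≤ m ^ k)
        (mem : ℤ) (Φ : shiftBlocks G.edgeShift k → Fin n)
        (table : (Fin k → Fin m) → ℕ)
        (_ : ∀ w : shiftBlocks G.edgeShift k, table w.1 = (Φ w : ℕ)),
        P.DecidesWithin (encodeInstance k G H table)
          (IsBlockConjugacy G.edgeShift H.edgeShift mem Φ)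
          (C * (m ^ (4 * k) + 1)) := by
  refine ⟨LoopLang.Core.decideProgram, LoopLang.Core.totalCoeff + 2, ?_⟩
  intro k hk p m q n G H hH mem Φ table ht
  have mono : ∀ {R : RamProgram} {I : List ℕ} {Q : Prop} {T T' : ℕ},
      R.DecidesWithin I Q T → T ≤ T' → R.DecidesWithin I Q T' :=
    fun ⟨s, t, e, c, h⟩ hT => ⟨s, t, e, c.trans hT, h⟩
  -- For `m < 2` the time bound is used with `N = 1`, so it is constant; otherwise `N = m ^ k`. The
  -- summand `2` of the constant pays for copying the answer to register `0`.
  rcases Nat.lt_or_ge m 2 with hm | hm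
  · have hres := LoopLang.res_small (table := table) (mem := mem) (Φ := Φ) (by omega) hH
    refine mono (LoopLang.Core.decidesWithin (LoopLang.Core.runs_small ?_ le_rfl)
      (fun h => hres.trans (if_pos h)) fun h => hres.trans (if_neg h)) ?_
    · change m - 1 = 0
      omega
    · rw [one_pow, mul_one]
      exact Nat.le_mul_of_pos_right _ (Nat.succ_pos _)
  · obtain ⟨s, hs, h1, h0⟩ := LoopLang.decides_large (mem := mem) hk hm hH ht
    refine mono (LoopLang.Core.decidesWithin hs h1 h0) ?_
    rw [mul_comm 4 k, pow_mul]
    nlinarith [Nat.zero_le ((m ^ k) ^ 4)]
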